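/- **Definitions.** *Algebras.* A (not necessarily unital) *real $C^*$-algebra* is a complete normed real algebra with involution that admits an isometric $*$-representation by bounded operators on a real Hilbert space. It is *$\mathbb{Z}/2$-graded* if $A=A_0\oplus A_1$ with real subspaces $A_i$, $A_iA_j\subseteq A_{i+j}$, $A_i^*= A_i$ (and $1\in A_0$ if $A$ is unital). The graded opposite $A^{op}$ is the graded space $A$ with $a^{op}b^{op}=(-1)^{|a||b|}(ba)^{op}$ and $(a^{op})^*=(-1)^{|a|}(a^*)^{op}$ for homogeneous $a,b$. The tensor product $\otimes$ over $\mathbb{R}$ is the graded one: $(a_1\otimes b_1)(a_2\otimes b_2)=(-1)^{|b_1||a_2|}a_1a_2\otimes b_1b_2$, $|a\otimes b|=|a|+|b|$. For $n\ge 0$, $Cl_n=Cl_{+n}$ is the real Clifford algebra on $n$ anticommuting odd generators with square $+1$, and $Cl_{-n}$ the one on $n$ generators with square $-1$. *Polarizations and gradings.* Let $A$ be unital and let $M$ be a finitely generated projective left (ungraded) $A$-module, with the topology induced by an embedding of $M$ as a direct summand in some $A^k$ (it does not depend on the embedding). A real-linear continuous map $T\colon M\to M$ is *$A$-skew-linear*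 if $T(am)=(-1)^{|a|}a\,T(m)$ for all homogeneous $a\in A$ and all $m\in M$. Let $\mathrm{Pol}_A(M)$ be the space of $A$-skew-linear $J$ with $J^2=-\mathrm{id}_M$ ($A$-symmetric polarizations) and $\mathrm{Grad}_A(M)$ the space of $A$-skew-linear $\epsilon$ with $\epsilon^2=\mathrm{id}_M$ (gradings), both with the operator norm topology. *The groups.* Consider triples $(M,J_1,J_2)$ with $M$ as above and $J_1,J_2\in\mathrm{Pol}_A(M)$. Such a triple is *elementary* if $J_1$ and $J_2$ are joined by a path in $\mathrm{Pol}_A(M)$. Triples are added by direct sum, and an isomorphism of triples is an isomorphism of $A$-modules that intertwines the first and the second operators, respectively. Write $T_1\sim T_2$ if $T_1\oplus E_1\cong T_2\oplus E_2$ for some elementary $E_1,E_2$. The equivalence classes form an abelian group $\mathrm{SPT}^A$ under $\oplus$, the group of free neutral SPT phases protected by $A$. The Karoubi group $K_0(A)$ is defined in the same way with $\mathrm{Grad}_A$ in place of $\mathrm{Pol}_A$, and $K_n(A):=K_0(Cl_n\otimes A)$ for $n\in\mathbb{Z}$. A continuous unital graded homomorphism $A\to B$ induces homomorphisms of these groups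 through $M\mapsto B\otimes_A M$ (operators are extended by $b\otimes m\mapsto(-1)^{|b|}b\otimes T(m)$). For an algebra $A$ that is not assumed to be unital, let $A_+=\mathbb{R}\oplus A$ be its unitization, graded with $\mathbb{R}$ even, and let $A_+\to\mathbb{R}$ be the augmentation. Put $$\mathrm{SPT}^A:=\ker(\mathrm{SPT}^{A_+}\to\mathrm{SPT}^{\mathbb{R}}),\qquad \mathrm{SPT}^{A\otimes Cl_{+n}}:=\ker(\mathrm{SPT}^{A_+\otimes Cl_{+n}}\to\mathrm{SPT}^{\mathbb{R}\otimes Cl_{+n}}),\qquad K_n(A):=\ker(K_n(A_+)\to K_n(\mathbb{R})).$$ **Theorem.** Let $A$ be a unital $\mathbb{Z}/2$-graded real $C^*$-algebra. Then there is an isomorphism of abelian groups $$\mathrm{SPT}^A\;\cong\;K_2(A^{op}),$$ and for every integer $n\ge 0$ there is an isomorphism of abelian groups $$\mathrm{SPT}^{A\otimes Cl_{+n}}\;\cong\;K_{2-n}(A^{op}).$$ The same holds for every, not necessarily unital, $\mathbb{Z}/2$-graded real $C^*$-algebra $A$ with the groups defined through the unitization as above. -/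

import Mathlib

open scoped DirectSum TensorProduct

universe u v w

set_option linter.unusedSectionVars false

namespace FreeSPT

/-! ### Gradings -/

section Grading

variable {A : Type u} [AddCommGroup A] [Module ℝ A]

/-- If the homogeneous parts are the eigenspaces of a linear involution `θ`, then they form a
grading: `a = (a + θ a) / 2 + (a - θ a) / 2`. -/
@[reducible] noncomputable def decompositionOfInvolution {𝒜 : ZMod 2 → Submodule ℝ A}
    (θ : A →ₗ[ℝ] A) (hθ : ∀ a, θ (θ a) = a) (h0 : ∀ a, a ∈ 𝒜 0 ↔ θ a = a)
    (h1 : ∀ a, a ∈ 𝒜 1 ↔ θ a = -a) : DirectSum.Decomposition 𝒜 :=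
  DirectSum.Decomposition.ofLinearMap 𝒜
    (DirectSum.lof ℝ (ZMod 2) (fun i => 𝒜 i) 0 ∘ₗ
        LinearMap.codRestrict (𝒜 0) ((2⁻¹ : ℝ) • (LinearMap.id + θ)) (fun a => (h0 _).2 (by
          simp only [LinearMap.smul_apply, LinearMap.add_apply, LinearMap.id_apply, map_smul,
            map_add, hθ, add_comm])) +
      DirectSum.lof ℝ (ZMod 2) (fun i => 𝒜 i) 1 ∘ₗ
        LinearMap.codRestrict (𝒜 1) ((2⁻¹ : ℝ) • (LinearMap.id - θ)) (fun a => (h1 _).2 (by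
          simp only [LinearMap.smul_apply, LinearMap.sub_apply, LinearMap.id_apply, map_smul,
            map_sub, hθ, ← smul_neg, neg_sub])))
    (by
      ext a
      simp only [LinearMap.comp_apply, LinearMap.add_apply, map_add, LinearMap.id_apply,
        DirectSum.coeLinearMap_lof, LinearMap.codRestrict_apply, LinearMap.smul_apply,
        LinearMap.sub_apply]
      module)
    (by
      refine DirectSum.linearMap_ext ℝ fun i => LinearMap.ext fun x => ?_
      obtain ⟨x, hx⟩ := x
      simp only [LinearMap.comp_apply, LinearMap.add_apply, LinearMap.id_apply,
        DirectSum.coeLinearMap_lof]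
      have key : ∀ (i : ZMod 2) (y : 𝒜 i) (z : A) (hz : z ∈ 𝒜 i), z = y →
          DirectSum.lof ℝ (ZMod 2) (fun i => 𝒜 i) i ⟨z, hz⟩ =
            DirectSum.lof ℝ (ZMod 2) (fun i => 𝒜 i) i y := by
        rintro i ⟨y, hy⟩ z hz rfl
        rfl
      have hi : ∀ j : ZMod 2, j = 0 ∨ j = 1 := by decide
      rcases hi i with rfl | rfl
      · have h : θ x = x := (h0 x).1 hx
        refine (congrArg₂ (· + ·) (key 0 ⟨x, hx⟩ _ _ ?_) (key 1 0 _ _ ?_)).trans ?_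
        · simp only [LinearMap.smul_apply, LinearMap.add_apply, LinearMap.id_apply, h]
          module
        · simp [h]
        · simp
      · have h : θ x = -x := (h1 x).1 hx
        refine (congrArg₂ (· + ·) (key 0 0 _ _ ?_) (key 1 ⟨x, hx⟩ _ _ ?_)).trans ?_
        · simp [h]
        · simp only [LinearMap.smul_apply, LinearMap.sub_apply, LinearMap.id_apply, h]
          module
        · simp)

/-- The grading involution `a ↦ (-1)^|a| a` of a `ℤ/2`-graded real vector space. -/
noncomputable def gradeInv (𝒜 : ZMod 2 → Submodule ℝ A) [DirectSum.Decomposition 𝒜] :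
    A →ₗ[ℝ] A :=
  ((𝒜 0).subtype ∘ₗ DirectSum.component ℝ (ZMod 2) (fun i => 𝒜 i) 0
    - (𝒜 1).subtype ∘ₗ DirectSum.component ℝ (ZMod 2) (fun i => 𝒜 i) 1)
    ∘ₗ (DirectSum.decomposeLinearEquiv 𝒜).toLinearMap

variable (𝒜 : ZMod 2 → Submodule ℝ A) [DirectSum.Decomposition 𝒜]

theorem gradeInv_apply (a : A) : gradeInv 𝒜 a =
    (DirectSum.decompose 𝒜 a 0 : A) - (DirectSum.decompose 𝒜 a 1 : A) := rfl

theorem gradeInv_even {a : A} (ha : a ∈ 𝒜 0) : gradeInv 𝒜 a = a := by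
  rw [gradeInv_apply, DirectSum.decompose_of_mem_same 𝒜 ha,
    DirectSum.decompose_of_mem_ne 𝒜 ha (by decide), sub_zero]

theorem gradeInv_odd {a : A} (ha : a ∈ 𝒜 1) : gradeInv 𝒜 a = -a := by
  rw [gradeInv_apply, DirectSum.decompose_of_mem_same 𝒜 ha,
    DirectSum.decompose_of_mem_ne 𝒜 ha (by decide), zero_sub]

theorem even_add_odd (a : A) :
    (DirectSum.decompose 𝒜 a 0 : A) + (DirectSum.decompose 𝒜 a 1 : A) = a := by
  classical
  have h := DirectSum.sum_support_decompose 𝒜 a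
  rw [Finset.sum_subset (Finset.subset_univ _)] at h
  · exact (Fin.sum_univ_two fun i : ZMod 2 => (DirectSum.decompose 𝒜 a i : A)).symm.trans h
  · intro i _ hi
    simpa using hi

theorem grade_induction {P : A → Prop} (h0 : ∀ a ∈ 𝒜 0, P a) (h1 : ∀ a ∈ 𝒜 1, P a)
    (hadd : ∀ a b, P a → P b → P (a + b)) (a : A) : P a := by
  rw [← even_add_odd 𝒜 a]
  exact hadd _ _ (h0 _ (SetLike.coe_mem _)) (h1 _ (SetLike.coe_mem _))

theorem gradeInv_gradeInv (a : A) : gradeInv 𝒜 (gradeInv 𝒜 a) = a := by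
  induction a using grade_induction 𝒜 with
  | h0 a ha => rw [gradeInv_even 𝒜 ha, gradeInv_even 𝒜 ha]
  | h1 a ha => rw [gradeInv_odd 𝒜 ha, map_neg, gradeInv_odd 𝒜 ha, neg_neg]
  | hadd a b ha hb => rw [map_add, map_add, ha, hb]

theorem mem_even_iff {a : A} : a ∈ 𝒜 0 ↔ gradeInv 𝒜 a = a := by
  refine ⟨gradeInv_even 𝒜, fun h => ?_⟩
  have h2 : (DirectSum.decompose 𝒜 a 0 : A) = a := by
    have h1 := even_add_odd 𝒜 a
    rw [gradeInv_apply] at h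
    linear_combination (norm := module) (2⁻¹ : ℝ) • h1 + (2⁻¹ : ℝ) • h
  rw [← h2]
  exact SetLike.coe_mem _

theorem mem_odd_iff {a : A} : a ∈ 𝒜 1 ↔ gradeInv 𝒜 a = -a := by
  refine ⟨gradeInv_odd 𝒜, fun h => ?_⟩
  have h2 : (DirectSum.decompose 𝒜 a 1 : A) = a := by
    have h1 := even_add_odd 𝒜 a
    rw [gradeInv_apply] at h
    linear_combination (norm := module) (2⁻¹ : ℝ) • h1 - (2⁻¹ : ℝ) • h
  rw [← h2]
  exact SetLike.coe_mem _

end Grading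

section GradingMul

variable {A : Type u} [NonUnitalRing A] [Module ℝ A]
  (𝒜 : ZMod 2 → Submodule ℝ A) [DirectSum.Decomposition 𝒜] [SetLike.GradedMul 𝒜]

theorem gradeInv_mul (a b : A) : gradeInv 𝒜 (a * b) = gradeInv 𝒜 a * gradeInv 𝒜 b := by
  induction a using grade_induction 𝒜 with
  | h0 a ha =>
    induction b using grade_induction 𝒜 with
    | h0 b hb =>
      rw [gradeInv_even 𝒜 ha, gradeInv_even 𝒜 hb, gradeInv_even 𝒜 (SetLike.mul_mem_graded ha hb)]
    | h1 b hb =>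
      rw [gradeInv_even 𝒜 ha, gradeInv_odd 𝒜 hb, gradeInv_odd 𝒜 (SetLike.mul_mem_graded ha hb),
        mul_neg]
    | hadd x y hx hy => rw [mul_add, map_add, map_add, mul_add, hx, hy]
  | h1 a ha =>
    induction b using grade_induction 𝒜 with
    | h0 b hb =>
      rw [gradeInv_odd 𝒜 ha, gradeInv_even 𝒜 hb, gradeInv_odd 𝒜 (SetLike.mul_mem_graded ha hb),
        neg_mul]
    | h1 b hb =>
      rw [gradeInv_odd 𝒜 ha, gradeInv_odd 𝒜 hb, gradeInv_even 𝒜 (SetLike.mul_mem_graded ha hb),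
        neg_mul_neg]
    | hadd x y hx hy => rw [mul_add, map_add, map_add, mul_add, hx, hy]
  | hadd x y hx hy => rw [add_mul, map_add, map_add, add_mul, hx, hy]

end GradingMul


/-! ### The graded opposite -/

/-- The opposite of a `ℤ/2`-graded algebra: the same graded topological vector space, with
`a^op b^op = (-1)^(|a||b|) (b a)^op`. For a graded C*-algebra this is again one, with involution
`(a^op)^* = (-1)^|a| (a^*)^op`; the groups below depend only on the graded topological algebra, so
neither the involution nor the choice among equivalent norms enters. -/
def GradedOp {A : Type u} [NonUnitalRing A] [Module ℝ A] (_𝒜 : ZMod 2 → Submodule ℝ A) : Type u := A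

namespace GradedOp

section NonUnital

variable {A : Type u} [NonUnitalRing A] [Module ℝ A] (𝒜 : ZMod 2 → Submodule ℝ A)

instance : AddCommGroup (GradedOp 𝒜) := inferInstanceAs (AddCommGroup A)

instance : Module ℝ (GradedOp 𝒜) := inferInstanceAs (Module ℝ A)

/-- The identity map `a ↦ a^op`. -/
def op : A ≃ₗ[ℝ] GradedOp 𝒜 := LinearEquiv.refl ℝ A

instance [TopologicalSpace A] : TopologicalSpace (GradedOp 𝒜) :=
  inferInstanceAs (TopologicalSpace A)

instance [TopologicalSpace A] [ContinuousSMul ℝ A] : ContinuousSMul ℝ (GradedOp 𝒜) :=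
  inferInstanceAs (ContinuousSMul ℝ A)

/-- The grading of `A^op`. -/
def grading : ZMod 2 → Submodule ℝ (GradedOp 𝒜) := 𝒜

theorem op_mem {i : ZMod 2} {a : A} : op 𝒜 a ∈ grading 𝒜 i ↔ a ∈ 𝒜 i := Iff.rfl

variable [DirectSum.Decomposition 𝒜]

instance : DirectSum.Decomposition (grading 𝒜) := inferInstanceAs (DirectSum.Decomposition 𝒜)

/-- The product of `A^op`, on general elements; see `op_mul_op` for homogeneous ones. -/
noncomputable instance : Mul (GradedOp 𝒜) where
  mul x y := op 𝒜 ((op 𝒜).symm y * (DirectSum.decompose 𝒜 ((op 𝒜).symm x) 0 : A) +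
    gradeInv 𝒜 ((op 𝒜).symm y) * (DirectSum.decompose 𝒜 ((op 𝒜).symm x) 1 : A))

theorem op_mul (a b : A) : op 𝒜 a * op 𝒜 b =
    op 𝒜 (b * (DirectSum.decompose 𝒜 a 0 : A) + gradeInv 𝒜 b * (DirectSum.decompose 𝒜 a 1 : A)) :=
  rfl

theorem even_op_mul {a : A} (ha : a ∈ 𝒜 0) (b : A) : op 𝒜 a * op 𝒜 b = op 𝒜 (b * a) := by
  rw [op_mul, DirectSum.decompose_of_mem_same 𝒜 ha,
    DirectSum.decompose_of_mem_ne 𝒜 ha (by decide), mul_zero, add_zero]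

theorem odd_op_mul {a : A} (ha : a ∈ 𝒜 1) (b : A) :
    op 𝒜 a * op 𝒜 b = op 𝒜 (gradeInv 𝒜 b * a) := by
  rw [op_mul, DirectSum.decompose_of_mem_same 𝒜 ha,
    DirectSum.decompose_of_mem_ne 𝒜 ha (by decide), mul_zero, zero_add]

/-- `a^op b^op = (-1)^(|a||b|) (b a)^op` for homogeneous `a` and `b`. -/
theorem op_mul_op {i j : ZMod 2} {a b : A} (ha : a ∈ 𝒜 i) (hb : b ∈ 𝒜 j) :
    op 𝒜 a * op 𝒜 b = (-1 : ℤˣ) ^ (i * j) • op 𝒜 (b * a) := by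
  have h2 : ∀ k : ZMod 2, k = 0 ∨ k = 1 := by decide
  rcases h2 i with rfl | rfl
  · rw [even_op_mul 𝒜 ha, zero_mul, uzpow_zero, one_smul]
  · rw [odd_op_mul 𝒜 ha]
    rcases h2 j with rfl | rfl
    · rw [gradeInv_even 𝒜 hb, mul_zero, uzpow_zero, one_smul]
    · rw [gradeInv_odd 𝒜 hb, mul_one, uzpow_one, Units.neg_smul, one_smul, neg_mul, map_neg]

theorem op_induction {P : GradedOp 𝒜 → Prop} (h0 : ∀ a ∈ 𝒜 0, P (op 𝒜 a))
    (h1 : ∀ a ∈ 𝒜 1, P (op 𝒜 a)) (hadd : ∀ x y, P x → P y → P (x + y)) (x : GradedOp 𝒜) : P x :=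
  grade_induction 𝒜 (P := fun a => P (op 𝒜 a)) h0 h1 (fun a b => hadd (op 𝒜 a) (op 𝒜 b)) x

theorem add_mul' (x y z : GradedOp 𝒜) : (x + y) * z = x * z + y * z := by
  obtain ⟨x, rfl⟩ := (op 𝒜).surjective x
  obtain ⟨y, rfl⟩ := (op 𝒜).surjective y
  obtain ⟨z, rfl⟩ := (op 𝒜).surjective z
  rw [← map_add, op_mul, op_mul, op_mul, ← map_add, DirectSum.decompose_add,
    DirectSum.add_apply, DirectSum.add_apply, Submodule.coe_add, Submodule.coe_add, mul_add, mul_add]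
  congr 1
  abel

theorem mul_add' (x y z : GradedOp 𝒜) : x * (y + z) = x * y + x * z := by
  obtain ⟨x, rfl⟩ := (op 𝒜).surjective x
  obtain ⟨y, rfl⟩ := (op 𝒜).surjective y
  obtain ⟨z, rfl⟩ := (op 𝒜).surjective z
  rw [← map_add, op_mul, op_mul, op_mul, ← map_add, map_add (gradeInv 𝒜), add_mul, add_mul]
  congr 1
  abel

variable [SetLike.GradedMul 𝒜]

noncomputable instance instNonUnitalRing : NonUnitalRing (GradedOp 𝒜) where
  left_distrib := mul_add' 𝒜
  right_distrib := add_mul' 𝒜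
  zero_mul x := by
    have h := add_mul' 𝒜 0 0 x
    rwa [add_zero, left_eq_add] at h
  mul_zero x := by
    have h := mul_add' 𝒜 x 0 0
    rwa [add_zero, left_eq_add] at h
  mul_assoc x y z := by
    obtain ⟨z, rfl⟩ := (op 𝒜).surjective z
    induction x using op_induction 𝒜 with
    | h0 a ha =>
      induction y using op_induction 𝒜 with
      | h0 b hb =>
        rw [even_op_mul 𝒜 ha, even_op_mul 𝒜 hb, even_op_mul 𝒜 ha,
          even_op_mul 𝒜 (SetLike.mul_mem_graded hb ha), mul_assoc]
      | h1 b hb =>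
        rw [even_op_mul 𝒜 ha, odd_op_mul 𝒜 hb, even_op_mul 𝒜 ha,
          odd_op_mul 𝒜 (SetLike.mul_mem_graded hb ha), mul_assoc]
      | hadd x y hx hy => rw [mul_add', add_mul', add_mul', mul_add', hx, hy]
    | h1 a ha =>
      induction y using op_induction 𝒜 with
      | h0 b hb =>
        rw [odd_op_mul 𝒜 ha, even_op_mul 𝒜 hb, odd_op_mul 𝒜 ha, gradeInv_even 𝒜 hb,
          odd_op_mul 𝒜 (SetLike.mul_mem_graded hb ha), gradeInv_mul, gradeInv_even 𝒜 hb, mul_assoc]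
      | h1 b hb =>
        rw [odd_op_mul 𝒜 ha, odd_op_mul 𝒜 hb, odd_op_mul 𝒜 ha, gradeInv_odd 𝒜 hb, neg_mul,
          map_neg, ← map_neg, ← neg_mul, ← gradeInv_odd 𝒜 hb,
          even_op_mul 𝒜 (by rw [gradeInv_odd 𝒜 hb, neg_mul]
                            exact neg_mem (SetLike.mul_mem_graded hb ha)),
          gradeInv_mul, gradeInv_gradeInv, mul_assoc]
      | hadd x y hx hy => rw [mul_add', add_mul', add_mul', mul_add', hx, hy]
    | hadd x x' hx hx' => rw [add_mul', add_mul', add_mul', hx, hx']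

instance instGradedMul : SetLike.GradedMul (grading 𝒜) where
  mul_mem i j x y hx hy := by
    obtain ⟨x, rfl⟩ := (op 𝒜).surjective x
    obtain ⟨y, rfl⟩ := (op 𝒜).surjective y
    rw [op_mul_op 𝒜 ((op_mem 𝒜).1 hx) ((op_mem 𝒜).1 hy), Units.smul_def]
    refine zsmul_mem ?_ _
    rw [op_mem, add_comm]
    exact SetLike.mul_mem_graded ((op_mem 𝒜).1 hy) ((op_mem 𝒜).1 hx)

variable [IsScalarTower ℝ A A] [SMulCommClass ℝ A A]

instance instIsScalarTower : IsScalarTower ℝ (GradedOp 𝒜) (GradedOp 𝒜) where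
  smul_assoc r x y := by
    obtain ⟨x, rfl⟩ := (op 𝒜).surjective x
    obtain ⟨y, rfl⟩ := (op 𝒜).surjective y
    simp only [smul_eq_mul]
    rw [← map_smul, op_mul, op_mul, ← map_smul, DirectSum.decompose_smul, DirectSum.smul_apply,
      DirectSum.smul_apply, Submodule.coe_smul, Submodule.coe_smul, mul_smul_comm, mul_smul_comm,
      smul_add]

instance instSMulCommClass : SMulCommClass ℝ (GradedOp 𝒜) (GradedOp 𝒜) where
  smul_comm r x y := by
    obtain ⟨x, rfl⟩ := (op 𝒜).surjective x
    obtain ⟨y, rfl⟩ := (op 𝒜).surjective y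
    simp only [smul_eq_mul]
    rw [← map_smul, op_mul, op_mul, ← map_smul, map_smul (gradeInv 𝒜), smul_mul_assoc,
      smul_mul_assoc, smul_add]

end NonUnital

section Unital

variable {A : Type u} [Ring A] [Algebra ℝ A] (𝒜 : ZMod 2 → Submodule ℝ A) [GradedAlgebra 𝒜]

noncomputable instance instRing : Ring (GradedOp 𝒜) where
  __ := instNonUnitalRing 𝒜
  one := op 𝒜 1
  one_mul x := by
    obtain ⟨x, rfl⟩ := (op 𝒜).surjective x
    exact (even_op_mul 𝒜 SetLike.GradedOne.one_mem x).trans (by rw [mul_one])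
  mul_one x := by
    induction x using op_induction 𝒜 with
    | h0 a ha => exact (even_op_mul 𝒜 ha 1).trans (by rw [one_mul])
    | h1 a ha =>
      exact (odd_op_mul 𝒜 ha 1).trans (by
        rw [gradeInv_even 𝒜 SetLike.GradedOne.one_mem, one_mul])
    | hadd x y hx hy => exact (add_mul' 𝒜 x y _).trans (congrArg₂ (· + ·) hx hy)

noncomputable instance instAlgebra : Algebra ℝ (GradedOp 𝒜) :=
  Algebra.ofModule (fun r x y => smul_assoc r x y) (fun r x y => (smul_comm r x y).symm)

instance instGradedAlgebra : GradedAlgebra (grading 𝒜) where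
  one_mem := (SetLike.GradedOne.one_mem : (1 : A) ∈ 𝒜 0)
  __ := instGradedMul 𝒜
  __ := (inferInstance : DirectSum.Decomposition (grading 𝒜))

end Unital

end GradedOp

/-! ### Adjoining a unit -/

/-- The unitization `A_+ = ℝ ⊕ A`, with the product topology (the topology of its C*-norm, if `A`
is a real C*-algebra). -/
def AddUnit (A : Type u) : Type u := Unitization ℝ A

namespace AddUnit

variable {A : Type u} [NonUnitalRing A] [Module ℝ A] [IsScalarTower ℝ A A] [SMulCommClass ℝ A A]

noncomputable instance : Ring (AddUnit A) := inferInstanceAs (Ring (Unitization ℝ A))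

noncomputable instance : Algebra ℝ (AddUnit A) := inferInstanceAs (Algebra ℝ (Unitization ℝ A))

/-- The scalar part of an element of `A_+`, as a homomorphism (the augmentation). -/
noncomputable def augmentation (A : Type u) [NonUnitalRing A] [Module ℝ A] [IsScalarTower ℝ A A]
    [SMulCommClass ℝ A A] : AddUnit A →ₐ[ℝ] ℝ := Unitization.fstHom ℝ A

/-- The vector part of an element of `A_+`. -/
noncomputable def vectorPart (A : Type u) [NonUnitalRing A] [Module ℝ A] [IsScalarTower ℝ A A]
    [SMulCommClass ℝ A A] : AddUnit A →ₗ[ℝ] A := Unitization.sndHom ℝ ℝ A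

noncomputable instance [TopologicalSpace A] : TopologicalSpace (AddUnit A) :=
  TopologicalSpace.induced ((augmentation A).toLinearMap.prod (vectorPart A))
    (inferInstance : TopologicalSpace (ℝ × A))

instance [TopologicalSpace A] [ContinuousSMul ℝ A] : ContinuousSMul ℝ (AddUnit A) :=
  continuousSMul_induced ((augmentation A).toLinearMap.prod (vectorPart A))

theorem continuous_augmentation [TopologicalSpace A] : Continuous (augmentation A) :=
  continuous_fst.comp (continuous_induced_dom :
    Continuous ((augmentation A).toLinearMap.prod (vectorPart A)))

theorem ext_parts {x y : AddUnit A} (h1 : augmentation A x = augmentation A y)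
    (h2 : vectorPart A x = vectorPart A y) : x = y := Unitization.ext h1 h2

theorem vectorPart_mul (x y : AddUnit A) : vectorPart A (x * y) =
    augmentation A x • vectorPart A y + augmentation A y • vectorPart A x +
      vectorPart A x * vectorPart A y := Unitization.snd_mul x y

theorem vectorPart_one : vectorPart A (1 : AddUnit A) = 0 := Unitization.snd_one (R := ℝ) (A := A)

/-- The grading of `A_+` that extends the one of `A` and in which `ℝ` is even. -/
noncomputable def grading (𝒜 : ZMod 2 → Submodule ℝ A) (i : ZMod 2) : Submodule ℝ (AddUnit A) where
  carrier := {x | vectorPart A x ∈ 𝒜 i ∧ (i = 1 → augmentation A x = 0)}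
  zero_mem' := ⟨by rw [map_zero]; exact zero_mem _, fun _ => map_zero _⟩
  add_mem' := fun {x y} hx hy => ⟨by rw [map_add]; exact add_mem hx.1 hy.1,
    fun h => by rw [map_add, hx.2 h, hy.2 h, add_zero]⟩
  smul_mem' := fun r x hx => ⟨by rw [map_smul]; exact Submodule.smul_mem _ r hx.1,
    fun h => by rw [map_smul, hx.2 h, smul_zero]⟩

theorem mem_grading {𝒜 : ZMod 2 → Submodule ℝ A} {i : ZMod 2} {x : AddUnit A} :
    x ∈ grading 𝒜 i ↔ vectorPart A x ∈ 𝒜 i ∧ (i = 1 → augmentation A x = 0) := Iff.rfl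

variable (𝒜 : ZMod 2 → Submodule ℝ A) [DirectSum.Decomposition 𝒜]

/-- The inclusion `A → A_+`. -/
noncomputable def incl (A : Type u) [NonUnitalRing A] [Module ℝ A] [IsScalarTower ℝ A A]
    [SMulCommClass ℝ A A] : A →ₗ[ℝ] AddUnit A := Unitization.inrHom ℝ ℝ A

/-- The grading involution of `A_+`. -/
noncomputable def involution : AddUnit A →ₗ[ℝ] AddUnit A :=
  Algebra.linearMap ℝ (AddUnit A) ∘ₗ (augmentation A).toLinearMap +
    incl A ∘ₗ gradeInv 𝒜 ∘ₗ vectorPart A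

theorem augmentation_involution (x : AddUnit A) :
    augmentation A (involution 𝒜 x) = augmentation A x := by
  change augmentation A (algebraMap ℝ (AddUnit A) (augmentation A x) +
    incl A (gradeInv 𝒜 (vectorPart A x))) = _
  rw [map_add, AlgHom.commutes]
  exact add_zero _

theorem vectorPart_involution (x : AddUnit A) :
    vectorPart A (involution 𝒜 x) = gradeInv 𝒜 (vectorPart A x) :=
  zero_add _

noncomputable instance : DirectSum.Decomposition (grading 𝒜) :=
  decompositionOfInvolution (involution 𝒜)
    (fun x => ext_parts (by simp only [augmentation_involution])
      (by simp only [vectorPart_involution, gradeInv_gradeInv]))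
    (fun x => by
      rw [mem_grading, mem_even_iff 𝒜, ← vectorPart_involution]
      exact ⟨fun h => ext_parts (augmentation_involution 𝒜 x) h.1,
        fun h => ⟨by rw [h], fun h => absurd h (by decide)⟩⟩)
    (fun x => by
      rw [mem_grading, mem_odd_iff 𝒜, ← vectorPart_involution, ← map_neg]
      constructor
      · rintro ⟨h, h'⟩
        refine ext_parts ?_ h
        rw [augmentation_involution, map_neg, h' rfl, neg_zero]
      · intro h
        refine ⟨by rw [h], fun _ => ?_⟩
        have h3 := augmentation_involution 𝒜 x
        rw [h, map_neg] at h3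
        linarith)

variable [SetLike.GradedMul 𝒜]

noncomputable instance : GradedAlgebra (grading 𝒜) where
  one_mem := ⟨by rw [vectorPart_one]; exact zero_mem _, fun h => absurd h (by decide)⟩
  mul_mem i j x y hx hy := by
    have h2 : ∀ k : ZMod 2, k = 0 ∨ k = 1 := by decide
    rw [mem_grading] at *
    rw [vectorPart_mul, map_mul]
    have h := SetLike.mul_mem_graded hx.1 hy.1
    rcases h2 i with rfl | rfl <;> rcases h2 j with rfl | rfl
    · exact ⟨add_mem (add_mem (Submodule.smul_mem _ _ hy.1) (Submodule.smul_mem _ _ hx.1)) h,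
        fun h => absurd h (by decide)⟩
    · rw [hy.2 rfl, zero_smul, add_zero, mul_zero]
      exact ⟨add_mem (Submodule.smul_mem _ _ hy.1) h, fun _ => rfl⟩
    · rw [hx.2 rfl, zero_smul, zero_add, zero_mul]
      exact ⟨add_mem (Submodule.smul_mem _ _ hx.1) h, fun _ => rfl⟩
    · rw [hx.2 rfl, hy.2 rfl, zero_smul, zero_smul, zero_add, zero_add]
      exact ⟨h, fun h => absurd h (by decide)⟩
  __ := (inferInstance : DirectSum.Decomposition (grading 𝒜))

end AddUnit


/-! ### Graded tensor products -/

section Tensor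

variable {A : Type u} {B : Type v} [Ring A] [Algebra ℝ A] [Ring B] [Algebra ℝ B]
  (𝒜 : ZMod 2 → Submodule ℝ A) (ℬ : ZMod 2 → Submodule ℝ B) [GradedAlgebra 𝒜] [GradedAlgebra ℬ]

open GradedTensorProduct in
/-- The total grading of the graded tensor product `A ⊗ B`. -/
noncomputable def tensorGrading (i : ZMod 2) : Submodule ℝ (𝒜 ᵍ⊗[ℝ] ℬ) :=
  Submodule.span ℝ {x | ∃ j k : ZMod 2, j + k = i ∧ ∃ a ∈ 𝒜 j, ∃ b ∈ ℬ k, x = a ᵍ⊗ₜ[ℝ] b}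

theorem tmul_mem_tensorGrading {j k : ZMod 2} {a : A} {b : B} (ha : a ∈ 𝒜 j) (hb : b ∈ ℬ k) :
    (GradedTensorProduct.tmul ℝ a b : 𝒜 ᵍ⊗[ℝ] ℬ) ∈ tensorGrading 𝒜 ℬ (j + k) :=
  Submodule.subset_span ⟨j, k, rfl, a, ha, b, hb, rfl⟩

/-- Every element of `A ⊗ B` is a sum of products of homogeneous elements. -/
theorem tensor_induction {P : 𝒜 ᵍ⊗[ℝ] ℬ → Prop}
    (h : ∀ (j k : ZMod 2), ∀ a ∈ 𝒜 j, ∀ b ∈ ℬ k, P (GradedTensorProduct.tmul ℝ a b))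
    (h0 : P 0) (hadd : ∀ x y, P x → P y → P (x + y)) (x : 𝒜 ᵍ⊗[ℝ] ℬ) : P x := by
  obtain ⟨x, rfl⟩ := (GradedTensorProduct.of ℝ 𝒜 ℬ).surjective x
  induction x using TensorProduct.induction_on with
  | zero => rw [map_zero]; exact h0
  | add x y hx hy => rw [map_add]; exact hadd _ _ hx hy
  | tmul a b =>
    induction a using grade_induction 𝒜 with
    | h0 a ha =>
      induction b using grade_induction ℬ with
      | h0 b hb => exact h _ _ a ha b hb
      | h1 b hb => exact h _ _ a ha b hb
      | hadd b b' hb hb' => rw [TensorProduct.tmul_add, map_add]; exact hadd _ _ hb hb'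
    | h1 a ha =>
      induction b using grade_induction ℬ with
      | h0 b hb => exact h _ _ a ha b hb
      | h1 b hb => exact h _ _ a ha b hb
      | hadd b b' hb hb' => rw [TensorProduct.tmul_add, map_add]; exact hadd _ _ hb hb'
    | hadd a a' ha ha' => rw [TensorProduct.add_tmul, map_add]; exact hadd _ _ ha ha'

/-- The grading involution of `A ⊗ B`. -/
noncomputable def tensorInvolution : 𝒜 ᵍ⊗[ℝ] ℬ →ₗ[ℝ] 𝒜 ᵍ⊗[ℝ] ℬ :=
  (GradedTensorProduct.of ℝ 𝒜 ℬ).toLinearMap ∘ₗ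
    TensorProduct.map (gradeInv 𝒜) (gradeInv ℬ) ∘ₗ
      (GradedTensorProduct.of ℝ 𝒜 ℬ).symm.toLinearMap

theorem tensorInvolution_tmul (a : A) (b : B) :
    tensorInvolution 𝒜 ℬ (GradedTensorProduct.tmul ℝ a b) =
      GradedTensorProduct.tmul ℝ (gradeInv 𝒜 a) (gradeInv ℬ b) := rfl

theorem tensorInvolution_even {x : 𝒜 ᵍ⊗[ℝ] ℬ} (hx : x ∈ tensorGrading 𝒜 ℬ 0) :
    tensorInvolution 𝒜 ℬ x = x := by
  induction hx using Submodule.span_induction with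
  | mem x hx =>
    obtain ⟨j, k, hjk, a, ha, b, hb, rfl⟩ := hx
    have h2 : ∀ j k : ZMod 2, j + k = 0 → j = 0 ∧ k = 0 ∨ j = 1 ∧ k = 1 := by decide
    rw [tensorInvolution_tmul]
    rcases h2 j k hjk with ⟨rfl, rfl⟩ | ⟨rfl, rfl⟩
    · rw [gradeInv_even 𝒜 ha, gradeInv_even ℬ hb]
    · rw [gradeInv_odd 𝒜 ha, gradeInv_odd ℬ hb]
      simp only [GradedTensorProduct.tmul, TensorProduct.neg_tmul, TensorProduct.tmul_neg, neg_neg]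
  | zero => exact map_zero _
  | add x y _ _ hx hy => rw [map_add, hx, hy]
  | smul r x _ hx => rw [map_smul, hx]

theorem tensorInvolution_odd {x : 𝒜 ᵍ⊗[ℝ] ℬ} (hx : x ∈ tensorGrading 𝒜 ℬ 1) :
    tensorInvolution 𝒜 ℬ x = -x := by
  induction hx using Submodule.span_induction with
  | mem x hx =>
    obtain ⟨j, k, hjk, a, ha, b, hb, rfl⟩ := hx
    have h2 : ∀ j k : ZMod 2, j + k = 1 → j = 0 ∧ k = 1 ∨ j = 1 ∧ k = 0 := by decide
    rw [tensorInvolution_tmul]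
    rcases h2 j k hjk with ⟨rfl, rfl⟩ | ⟨rfl, rfl⟩
    · rw [gradeInv_even 𝒜 ha, gradeInv_odd ℬ hb]
      simp only [GradedTensorProduct.tmul, TensorProduct.tmul_neg, map_neg]
    · rw [gradeInv_odd 𝒜 ha, gradeInv_even ℬ hb]
      simp only [GradedTensorProduct.tmul, TensorProduct.neg_tmul, map_neg]
  | zero => rw [map_zero, neg_zero]
  | add x y _ _ hx hy => rw [map_add, hx, hy, neg_add]
  | smul r x _ hx => rw [map_smul, hx, smul_neg]

theorem add_tensorInvolution_mem (x : 𝒜 ᵍ⊗[ℝ] ℬ) :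
    x + tensorInvolution 𝒜 ℬ x ∈ tensorGrading 𝒜 ℬ 0 ∧
      x - tensorInvolution 𝒜 ℬ x ∈ tensorGrading 𝒜 ℬ 1 := by
  induction x using tensor_induction 𝒜 ℬ with
  | h j k a ha b hb =>
    have h := tmul_mem_tensorGrading 𝒜 ℬ ha hb
    have h2 : ∀ i : ZMod 2, i = 0 ∨ i = 1 := by decide
    rcases h2 (j + k) with hi | hi
    · rw [hi] at h
      rw [tensorInvolution_even 𝒜 ℬ h, sub_self]
      exact ⟨add_mem h h, zero_mem _⟩
    · rw [hi] at h
      rw [tensorInvolution_odd 𝒜 ℬ h, add_neg_cancel, sub_neg_eq_add]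
      exact ⟨zero_mem _, add_mem h h⟩
  | h0 => rw [map_zero, add_zero, sub_zero]; exact ⟨zero_mem _, zero_mem _⟩
  | hadd x y hx hy =>
    rw [map_add, add_add_add_comm, add_sub_add_comm]
    exact ⟨add_mem hx.1 hy.1, add_mem hx.2 hy.2⟩

noncomputable instance : DirectSum.Decomposition (tensorGrading 𝒜 ℬ) :=
  decompositionOfInvolution (tensorInvolution 𝒜 ℬ)
    (fun x => by
      induction x using tensor_induction 𝒜 ℬ with
      | h j k a ha b hb => simp only [tensorInvolution_tmul, gradeInv_gradeInv]
      | h0 => rw [map_zero, map_zero]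
      | hadd x y hx hy => rw [map_add, map_add, hx, hy])
    (fun x => ⟨tensorInvolution_even 𝒜 ℬ, fun h => by
      have h1 := Submodule.smul_mem _ (2⁻¹ : ℝ) (add_tensorInvolution_mem 𝒜 ℬ x).1
      rw [h, ← two_smul ℝ, inv_smul_smul₀ two_ne_zero] at h1
      exact h1⟩)
    (fun x => ⟨tensorInvolution_odd 𝒜 ℬ, fun h => by
      have h1 := Submodule.smul_mem _ (2⁻¹ : ℝ) (add_tensorInvolution_mem 𝒜 ℬ x).2
      rw [h, sub_neg_eq_add, ← two_smul ℝ, inv_smul_smul₀ two_ne_zero] at h1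
      exact h1⟩)

theorem gradeInv_tmul (a : A) (b : B) :
    gradeInv (tensorGrading 𝒜 ℬ) (GradedTensorProduct.tmul ℝ a b) =
      GradedTensorProduct.tmul ℝ (gradeInv 𝒜 a) (gradeInv ℬ b) := by
  rw [← tensorInvolution_tmul]
  generalize (GradedTensorProduct.tmul ℝ a b : 𝒜 ᵍ⊗[ℝ] ℬ) = x
  induction x using grade_induction (tensorGrading 𝒜 ℬ) with
  | h0 x hx => rw [gradeInv_even _ hx, tensorInvolution_even 𝒜 ℬ hx]
  | h1 x hx => rw [gradeInv_odd _ hx, tensorInvolution_odd 𝒜 ℬ hx]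
  | hadd x y hx hy => rw [map_add, map_add, hx, hy]

noncomputable instance : GradedAlgebra (tensorGrading 𝒜 ℬ) where
  one_mem := by
    have h := tmul_mem_tensorGrading 𝒜 ℬ (SetLike.GradedOne.one_mem : (1 : A) ∈ 𝒜 0)
      (SetLike.GradedOne.one_mem : (1 : B) ∈ ℬ 0)
    rwa [add_zero] at h
  mul_mem i i' x y hx hy := by
    induction hx using Submodule.span_induction with
    | zero => rw [zero_mul]; exact zero_mem _
    | add x x' _ _ hx hx' => rw [add_mul]; exact add_mem hx hx'
    | smul r x _ hx => rw [smul_mul_assoc]; exact Submodule.smul_mem _ r hx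
    | mem x hx =>
      obtain ⟨j, k, rfl, a, ha, b, hb, rfl⟩ := hx
      induction hy using Submodule.span_induction with
      | zero => rw [mul_zero]; exact zero_mem _
      | add x x' _ _ hx hx' => rw [mul_add]; exact add_mem hx hx'
      | smul r x _ hx => rw [mul_smul_comm]; exact Submodule.smul_mem _ r hx
      | mem y hy =>
        obtain ⟨j', k', rfl, a', ha', b', hb', rfl⟩ := hy
        have h := GradedTensorProduct.tmul_coe_mul_coe_tmul (R := ℝ) 𝒜 ℬ a ⟨b, hb⟩ ⟨a', ha'⟩ b'
        simp only at h
        rw [h, Units.smul_def, add_add_add_comm]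
        exact zsmul_mem (tmul_mem_tensorGrading 𝒜 ℬ (SetLike.mul_mem_graded ha ha')
          (SetLike.mul_mem_graded hb hb')) _
  __ := (inferInstance : DirectSum.Decomposition (tensorGrading 𝒜 ℬ))

/-- The finest vector space topology for which `(a, b) ↦ a ⊗ b` is continuous. If one of the
factors is finite-dimensional with its usual topology, then a basis of it identifies `A ⊗ B` with
a finite power of the other factor with the product topology; this is the norm topology of the
graded tensor product of C*-algebras. It is only used in this case. -/
noncomputable instance [TopologicalSpace A] [TopologicalSpace B] :
    TopologicalSpace (𝒜 ᵍ⊗[ℝ] ℬ) :=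
  sInf {t | @ContinuousAdd _ t _ ∧ @ContinuousSMul ℝ _ _ _ t ∧
    @Continuous _ _ _ t fun p : A × B => (GradedTensorProduct.tmul ℝ p.1 p.2 : 𝒜 ᵍ⊗[ℝ] ℬ)}

section Topology

variable [TopologicalSpace A] [TopologicalSpace B]

instance : ContinuousAdd (𝒜 ᵍ⊗[ℝ] ℬ) := continuousAdd_sInf fun _ h => h.1

instance : ContinuousSMul ℝ (𝒜 ᵍ⊗[ℝ] ℬ) := continuousSMul_sInf fun _ h => h.2.1

theorem continuous_tmul :
    Continuous fun p : A × B => (GradedTensorProduct.tmul ℝ p.1 p.2 : 𝒜 ᵍ⊗[ℝ] ℬ) :=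
  continuous_sInf_rng.2 fun _ h => h.2.2

variable {𝒜 ℬ} in
theorem tensor_continuous_iff {E : Type w} [AddCommGroup E] [Module ℝ E] [TopologicalSpace E]
    [ContinuousAdd E] [ContinuousSMul ℝ E] (f : 𝒜 ᵍ⊗[ℝ] ℬ →ₗ[ℝ] E)
    (hf : Continuous fun p : A × B => f (GradedTensorProduct.tmul ℝ p.1 p.2)) : Continuous f := by
  rw [continuous_iff_le_induced]
  refine sInf_le ⟨?_, ?_, ?_⟩
  · exact continuousAdd_induced f
  · exact continuousSMul_induced f
  · exact continuous_induced_rng.2 hf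

instance [IsTopologicalRing A] [IsTopologicalRing B] [IsModuleTopology ℝ A] [IsModuleTopology ℝ B]
    [Module.Finite ℝ A] : IsModuleTopology ℝ (𝒜 ᵍ⊗[ℝ] ℬ) := by
  have h : @Continuous _ _ _ (moduleTopology ℝ (A ⊗[ℝ] B))
      fun p : A × B => TensorProduct.mk ℝ A B p.1 p.2 :=
    letI := moduleTopology ℝ (A ⊗[ℝ] B)
    IsModuleTopology.continuous_bilinear_of_finite_left (TensorProduct.mk ℝ A B)
  exact IsModuleTopology.of_continuous_id (continuous_id_of_le (sInf_le
    ⟨ModuleTopology.continuousAdd ℝ _, ModuleTopology.continuousSMul ℝ _, h⟩))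

instance [IsTopologicalRing A] [IsTopologicalRing B] [IsModuleTopology ℝ A] [IsModuleTopology ℝ B]
    [Module.Finite ℝ A] [Module.Finite ℝ B] : IsTopologicalRing (𝒜 ᵍ⊗[ℝ] ℬ) :=
  haveI : Module.Finite ℝ (𝒜 ᵍ⊗[ℝ] ℬ) := inferInstanceAs (Module.Finite ℝ (A ⊗[ℝ] B))
  IsModuleTopology.isTopologicalRing ℝ _

instance [Module.Finite ℝ A] [Module.Finite ℝ B] : Module.Finite ℝ (𝒜 ᵍ⊗[ℝ] ℬ) :=
  inferInstanceAs (Module.Finite ℝ (A ⊗[ℝ] B))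

end Topology

end Tensor

/-! ### Clifford algebras -/

section Clifford

/-- The quadratic form `x₁² + ⋯ + x_p² - y₁² - ⋯ - y_q²`. -/
noncomputable def stdForm (p q : ℕ) : QuadraticForm ℝ (Fin p ⊕ Fin q → ℝ) :=
  QuadraticMap.weightedSumSquares ℝ (Sum.elim (fun _ => (1 : ℝ)) (fun _ => -1))

/-- The Clifford algebra `Cl_{p,q}` on `p` generators with square `1` and `q` with square `-1`. -/
abbrev Cl (p q : ℕ) : Type := CliffordAlgebra (stdForm p q)

/-- The grading of `Cl_{p,q}` in which the generators are odd. -/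
noncomputable abbrev clGrading (p q : ℕ) : ZMod 2 → Submodule ℝ (Cl p q) :=
  CliffordAlgebra.evenOdd (stdForm p q)

theorem finite_exteriorAlgebra (V : Type u) [AddCommGroup V] [Module ℝ V] [Module.Finite ℝ V] :
    Module.Finite ℝ (ExteriorAlgebra ℝ V) := by
  have hfg : ∀ n : ℕ, (⋀[ℝ]^n V).FG := fun n => Module.Finite.iff_fg.1 inferInstance
  have hbot : ∀ n : ℕ, Module.finrank ℝ V < n → ⋀[ℝ]^n V = ⊥ := fun n hn => by
    rw [← Submodule.finrank_eq_zero (R := ℝ), exteriorPower.finrank_eq, Nat.choose_eq_zero_of_lt hn]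
  have htop : (⨆ n : ℕ, ⋀[ℝ]^n V) = ⊤ :=
    (DirectSum.Decomposition.isInternal fun n : ℕ => ⋀[ℝ]^n V).submodule_iSup_eq_top
  have hfin : (⨆ n : ℕ, ⋀[ℝ]^n V) = ⨆ n : Fin (Module.finrank ℝ V + 1), ⋀[ℝ]^(n : ℕ) V := by
    refine le_antisymm (iSup_le fun n => ?_) (iSup_le fun n => le_iSup (fun n => ⋀[ℝ]^n V) (n : ℕ))
    by_cases hn : Module.finrank ℝ V < n
    · rw [hbot n hn]; exact bot_le
    · exact le_iSup (fun n : Fin (Module.finrank ℝ V + 1) => ⋀[ℝ]^(n : ℕ) V) ⟨n, by omega⟩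
  refine ⟨?_⟩
  rw [← htop, hfin]
  exact Submodule.fg_iSup _ fun n => hfg n

instance (p q : ℕ) : Module.Finite ℝ (Cl p q) :=
  haveI : Invertible (2 : ℝ) := invertibleOfNonzero two_ne_zero
  haveI := finite_exteriorAlgebra (Fin p ⊕ Fin q → ℝ)
  Module.Finite.equiv (CliffordAlgebra.equivExterior (stdForm p q)).symm

/-- `Cl_{p,q}` carries its topology as a finite-dimensional vector space. -/
noncomputable instance (p q : ℕ) : TopologicalSpace (Cl p q) := moduleTopology ℝ (Cl p q)

instance (p q : ℕ) : IsModuleTopology ℝ (Cl p q) := ⟨rfl⟩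

instance (p q : ℕ) : IsTopologicalRing (Cl p q) := IsModuleTopology.isTopologicalRing ℝ _

end Clifford

/-! ### The trivially graded algebra `ℝ` and graded homomorphisms -/

/-- The trivial grading of `ℝ`. -/
def realGrading (i : ZMod 2) : Submodule ℝ ℝ := if i = 0 then ⊤ else ⊥

theorem mem_realGrading_zero (r : ℝ) : r ∈ realGrading 0 := by
  rw [realGrading, if_pos rfl]; exact Submodule.mem_top

theorem mem_realGrading_one {r : ℝ} : r ∈ realGrading 1 ↔ r = 0 := by
  rw [realGrading, if_neg (by decide), Submodule.mem_bot]

noncomputable instance : DirectSum.Decomposition realGrading :=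
  decompositionOfInvolution LinearMap.id (fun _ => rfl)
    (fun a => ⟨fun _ => rfl, fun _ => mem_realGrading_zero a⟩)
    (fun a => by
      rw [mem_realGrading_one, LinearMap.id_apply]
      constructor <;> intro h <;> linarith)

noncomputable instance : GradedAlgebra realGrading where
  one_mem := mem_realGrading_zero 1
  mul_mem i j x y hx hy := by
    have h2 : ∀ k : ZMod 2, k = 0 ∨ k = 1 := by decide
    rcases h2 i with rfl | rfl
    · rcases h2 j with rfl | rfl
      · exact mem_realGrading_zero _
      · rw [mem_realGrading_one.1 hy, mul_zero]; exact zero_mem _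
    · rw [mem_realGrading_one.1 hx, zero_mul]; exact zero_mem _
  __ := (inferInstance : DirectSum.Decomposition realGrading)

section Hom

variable {A : Type u} {B : Type v} [Ring A] [Algebra ℝ A] [Ring B] [Algebra ℝ B]
  [TopologicalSpace A] [TopologicalSpace B]

/-- A continuous unital homomorphism of `ℤ/2`-graded topological algebras. -/
structure GradedHom (𝒜 : ZMod 2 → Submodule ℝ A) (ℬ : ZMod 2 → Submodule ℝ B) extends
    A →ₐ[ℝ] B where
  map_mem : ∀ i, ∀ a ∈ 𝒜 i, toAlgHom a ∈ ℬ i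
  cont : Continuous toAlgHom

namespace GradedHom

/-- The identity homomorphism. -/
def refl (𝒜 : ZMod 2 → Submodule ℝ A) : GradedHom 𝒜 𝒜 where
  __ := AlgHom.id ℝ A
  map_mem _ _ h := h
  cont := continuous_id

variable {A' : Type*} {B' : Type*} [Ring A'] [Algebra ℝ A'] [Ring B'] [Algebra ℝ B']
  [TopologicalSpace A'] [TopologicalSpace B']
  {𝒜 : ZMod 2 → Submodule ℝ A} {ℬ : ZMod 2 → Submodule ℝ B}
  {𝒜' : ZMod 2 → Submodule ℝ A'} {ℬ' : ZMod 2 → Submodule ℝ B'}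

theorem map_gradeInv [GradedAlgebra 𝒜] [GradedAlgebra ℬ] (f : GradedHom 𝒜 ℬ) (a : A) :
    f.toAlgHom (gradeInv 𝒜 a) = gradeInv ℬ (f.toAlgHom a) := by
  induction a using grade_induction 𝒜 with
  | h0 a ha => rw [gradeInv_even 𝒜 ha, gradeInv_even ℬ (f.map_mem _ _ ha)]
  | h1 a ha => rw [gradeInv_odd 𝒜 ha, gradeInv_odd ℬ (f.map_mem _ _ ha), map_neg]
  | hadd a b ha hb => rw [map_add, map_add, ha, hb, map_add, map_add]

variable [GradedAlgebra 𝒜] [GradedAlgebra ℬ] [GradedAlgebra 𝒜'] [GradedAlgebra ℬ']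

/-- The tensor product `f ⊗ g` as a homomorphism of algebras. -/
noncomputable def tensorAlgHom (f : GradedHom 𝒜 𝒜') (g : GradedHom ℬ ℬ') :
    𝒜 ᵍ⊗[ℝ] ℬ →ₐ[ℝ] 𝒜' ᵍ⊗[ℝ] ℬ' :=
  GradedTensorProduct.lift 𝒜 ℬ
    ((GradedTensorProduct.includeLeft 𝒜' ℬ').comp f.toAlgHom)
    ((GradedTensorProduct.includeRight 𝒜' ℬ').comp g.toAlgHom) (by
      intro i j a b
      have h := GradedTensorProduct.tmul_coe_mul_coe_tmul (R := ℝ) 𝒜' ℬ' 1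
        ⟨_, g.map_mem _ _ b.2⟩ ⟨_, f.map_mem _ _ a.2⟩ 1
      have h' := GradedTensorProduct.tmul_one_mul_one_tmul (R := ℝ) 𝒜' ℬ' (f.toAlgHom a)
        (g.toAlgHom b)
      simp only [one_mul, mul_one] at h
      simp only [AlgHom.comp_apply, GradedTensorProduct.includeLeft_apply,
        GradedTensorProduct.includeRight_apply]
      rw [h, h', smul_smul, Int.units_mul_self, one_smul])

theorem tensorAlgHom_tmul (f : GradedHom 𝒜 𝒜') (g : GradedHom ℬ ℬ') (a : A) (b : B) :
    tensorAlgHom f g (GradedTensorProduct.tmul ℝ a b) =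
      GradedTensorProduct.tmul ℝ (f.toAlgHom a) (g.toAlgHom b) := by
  rw [tensorAlgHom, GradedTensorProduct.lift_tmul]
  exact GradedTensorProduct.tmul_one_mul_one_tmul (R := ℝ) 𝒜' ℬ' _ _

/-- The tensor product `f ⊗ g` of graded homomorphisms. -/
noncomputable def tensor (f : GradedHom 𝒜 𝒜') (g : GradedHom ℬ ℬ') :
    GradedHom (tensorGrading 𝒜 ℬ) (tensorGrading 𝒜' ℬ') where
  __ := tensorAlgHom f g
  map_mem i x hx := by
    change tensorAlgHom f g x ∈ _
    induction hx using Submodule.span_induction with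
    | mem x hx =>
      obtain ⟨j, k, rfl, a, ha, b, hb, rfl⟩ := hx
      rw [tensorAlgHom_tmul]
      exact tmul_mem_tensorGrading 𝒜' ℬ' (f.map_mem _ _ ha) (g.map_mem _ _ hb)
    | zero => rw [map_zero]; exact zero_mem _
    | add x y _ _ hx hy => rw [map_add]; exact add_mem hx hy
    | smul r x _ hx => rw [map_smul]; exact Submodule.smul_mem _ r hx
  cont := by
    refine tensor_continuous_iff (tensorAlgHom f g).toLinearMap ?_
    simp only [AlgHom.toLinearMap_apply, tensorAlgHom_tmul]
    exact (continuous_tmul 𝒜' ℬ').comp (f.cont.prodMap g.cont)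

end GradedHom

/-- The augmentation `A_+ → ℝ` as a graded homomorphism. -/
noncomputable def augmentationHom {A : Type u} [NonUnitalRing A] [Module ℝ A] [IsScalarTower ℝ A A]
    [SMulCommClass ℝ A A] [TopologicalSpace A] (𝒜 : ZMod 2 → Submodule ℝ A) :
    GradedHom (AddUnit.grading 𝒜) realGrading where
  __ := AddUnit.augmentation A
  map_mem i x hx := by
    have h2 : ∀ k : ZMod 2, k = 0 ∨ k = 1 := by decide
    rcases h2 i with rfl | rfl
    · exact mem_realGrading_zero _
    · exact mem_realGrading_one.2 (hx.2 rfl)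
  cont := AddUnit.continuous_augmentation

end Hom


/-! ### Skew-linear operators and the Karoubi groups -/

section SkewRoots

variable {A : Type u} [Ring A] [Algebra ℝ A]

/-- The space of `A`-skew-linear operators `T` on `M` (that is, `T (a m) = (-1)^|a| a (T m)`) with
`T² = s`, where `s = ±1`. It is a subspace of the space of continuous real-linear operators, which
carries the topology of uniform convergence on bounded sets (the operator norm topology). -/
def skewRoots (𝒜 : ZMod 2 → Submodule ℝ A) (s : ℤˣ) (M : Type v) [AddCommGroup M] [Module ℝ M]
    [Module A M] [TopologicalSpace M] : Set (M →L[ℝ] M) :=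
  {T | (∀ i, ∀ a ∈ 𝒜 i, ∀ m, T (a • m) = (-1 : ℤˣ) ^ i • a • T m) ∧ ∀ m, T (T m) = s • m}

/-- `A`-symmetric polarizations. -/
abbrev Pol (𝒜 : ZMod 2 → Submodule ℝ A) (M : Type v) [AddCommGroup M] [Module ℝ M]
    [Module A M] [TopologicalSpace M] : Set (M →L[ℝ] M) := skewRoots 𝒜 (-1) M

/-- Grading operators compatible with the grading of `A`. -/
abbrev Grad (𝒜 : ZMod 2 → Submodule ℝ A) (M : Type v) [AddCommGroup M] [Module ℝ M]
    [Module A M] [TopologicalSpace M] : Set (M →L[ℝ] M) := skewRoots 𝒜 1 M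

variable (𝒜 : ZMod 2 → Submodule ℝ A) [GradedAlgebra 𝒜]
  {M : Type v} [AddCommGroup M] [Module ℝ M] [Module A M] [TopologicalSpace M]

theorem skew_apply {F : Type*} [FunLike F M M] [AddMonoidHomClass F M M] {T : F}
    (hT : ∀ i, ∀ a ∈ 𝒜 i, ∀ m, T (a • m) = (-1 : ℤˣ) ^ i • a • T m) (a : A) (m : M) :
    T (a • m) = gradeInv 𝒜 a • T m := by
  induction a using grade_induction 𝒜 with
  | h0 a ha => rw [gradeInv_even 𝒜 ha, hT 0 a ha, uzpow_zero, one_smul]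
  | h1 a ha => rw [gradeInv_odd 𝒜 ha, hT 1 a ha, uzpow_one, Units.neg_smul, one_smul, neg_smul]
  | hadd a b ha hb => rw [add_smul, map_add, ha, hb, map_add, add_smul]

theorem skew_of_apply {T : M → M} (hT : ∀ (a : A) (m : M), T (a • m) = gradeInv 𝒜 a • T m)
    (i : ZMod 2) (a : A) (ha : a ∈ 𝒜 i) (m : M) : T (a • m) = (-1 : ℤˣ) ^ i • a • T m := by
  have h2 : ∀ k : ZMod 2, k = 0 ∨ k = 1 := by decide
  rw [hT]
  rcases h2 i with rfl | rfl
  · rw [gradeInv_even 𝒜 ha, uzpow_zero, one_smul]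
  · rw [gradeInv_odd 𝒜 ha, uzpow_one, Units.neg_smul, one_smul, neg_smul]

theorem mem_skewRoots {s : ℤˣ} {T : M →L[ℝ] M} : T ∈ skewRoots 𝒜 s M ↔
    (∀ (a : A) (m : M), T (a • m) = gradeInv 𝒜 a • T m) ∧ ∀ m, T (T m) = s • m :=
  ⟨fun h => ⟨skew_apply 𝒜 h.1, h.2⟩, fun h => ⟨skew_of_apply 𝒜 h.1, h.2⟩⟩

end SkewRoots

/-- A finitely generated projective `A`-module `M` with a pair of skew-linear operators of square
`s`: for `s = -1` a formal difference of polarizations, for `s = 1` a Karoubi triple.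
The topology of `M` is the `A`-module topology, that is the one induced from `A^n` by any
presentation of `M` as a direct summand of `A^n`, and the real vector space structure of `M` is the
restriction of its `A`-module structure; both are determined by the `A`-module `M`. -/
structure Triple {A : Type u} [Ring A] [Algebra ℝ A] [TopologicalSpace A]
    (𝒜 : ZMod 2 → Submodule ℝ A) (s : ℤˣ) : Type (max u (v + 1)) where
  carrier : Type v
  [addCommGroup : AddCommGroup carrier]
  [module : Module A carrier]
  [realModule : Module ℝ carrier]
  [isScalarTower : IsScalarTower ℝ A carrier]
  [finite : Module.Finite A carrier]
  [projective : Module.Projective A carrier]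
  [topology : TopologicalSpace carrier]
  [isModuleTopology : IsModuleTopology A carrier]
  fst : carrier →L[ℝ] carrier
  snd : carrier →L[ℝ] carrier
  fst_mem : fst ∈ skewRoots 𝒜 s carrier
  snd_mem : snd ∈ skewRoots 𝒜 s carrier

namespace Triple

attribute [instance] addCommGroup module realModule isScalarTower finite projective topology
  isModuleTopology

variable {A : Type u} [Ring A] [Algebra ℝ A] [TopologicalSpace A]
  {𝒜 : ZMod 2 → Submodule ℝ A} {s : ℤˣ}

instance (T : Triple.{u, v} 𝒜 s) : IsTopologicalAddGroup T.carrier :=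
  IsModuleTopology.topologicalAddGroup A T.carrier

theorem continuousSMul_real [ContinuousSMul ℝ A] (M : Type*) [AddCommGroup M] [Module A M]
    [Module ℝ M] [IsScalarTower ℝ A M] [TopologicalSpace M] [ContinuousSMul A M] :
    ContinuousSMul ℝ M where
  continuous_smul := by
    have h : (fun p : ℝ × M => p.1 • p.2) = fun p : ℝ × M => (p.1 • (1 : A)) • p.2 := by
      funext p
      rw [smul_assoc, one_smul]
    rw [h]
    exact (continuous_fst.smul continuous_const).smul continuous_snd

instance [ContinuousSMul ℝ A] (T : Triple.{u, v} 𝒜 s) : ContinuousSMul ℝ T.carrier :=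
  continuousSMul_real (A := A) T.carrier

/-- A triple is elementary if its two operators are joined by a path of skew-linear operators of
square `s`. -/
def IsElementary (T : Triple.{u, v} 𝒜 s) : Prop :=
  JoinedIn (skewRoots 𝒜 s T.carrier) T.fst T.snd

/-- Isomorphism of triples: an isomorphism of `A`-modules that intertwines the operators. -/
def Iso (T T' : Triple.{u, v} 𝒜 s) : Prop :=
  ∃ e : T.carrier ≃ₗ[A] T'.carrier,
    (∀ m, e (T.fst m) = T'.fst (e m)) ∧ ∀ m, e (T.snd m) = T'.snd (e m)

theorem prodMap_mem {M N : Type*} [AddCommGroup M] [Module ℝ M] [Module A M] [TopologicalSpace M]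
    [AddCommGroup N] [Module ℝ N] [Module A N] [TopologicalSpace N]
    {f : M →L[ℝ] M} {g : N →L[ℝ] N} (hf : f ∈ skewRoots 𝒜 s M) (hg : g ∈ skewRoots 𝒜 s N) :
    f.prodMap g ∈ skewRoots 𝒜 s (M × N) :=
  ⟨fun i a ha m => Prod.ext (hf.1 i a ha m.1) (hg.1 i a ha m.2),
    fun m => Prod.ext (hf.2 m.1) (hg.2 m.2)⟩

/-- The direct sum of triples. -/
def sum (T T' : Triple.{u, v} 𝒜 s) : Triple.{u, v} 𝒜 s where
  carrier := T.carrier × T'.carrier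
  fst := T.fst.prodMap T'.fst
  snd := T.snd.prodMap T'.snd
  fst_mem := prodMap_mem T.fst_mem T'.fst_mem
  snd_mem := prodMap_mem T.snd_mem T'.snd_mem

/-- The triple with its two operators exchanged. -/
def swap (T : Triple.{u, v} 𝒜 s) : Triple.{u, v} 𝒜 s where
  carrier := T.carrier
  fst := T.snd
  snd := T.fst
  fst_mem := T.snd_mem
  snd_mem := T.fst_mem

/-- The triple on the zero module. -/
def zero (𝒜 : ZMod 2 → Submodule ℝ A) (s : ℤˣ) : Triple.{u, v} 𝒜 s where
  carrier := PUnit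
  fst := 0
  snd := 0
  fst_mem := ⟨fun _ _ _ _ => rfl, fun _ => rfl⟩
  snd_mem := ⟨fun _ _ _ _ => rfl, fun _ => rfl⟩

/-- `T₁ ∼ T₂` if `T₁ ⊕ E₁ ≅ T₂ ⊕ E₂` for some elementary triples `E₁` and `E₂`. -/
def Rel (T₁ T₂ : Triple.{u, v} 𝒜 s) : Prop :=
  ∃ E₁ E₂ : Triple.{u, v} 𝒜 s, E₁.IsElementary ∧ E₂.IsElementary ∧ Iso (T₁.sum E₁) (T₂.sum E₂)

namespace Iso

variable {T T₁ T₂ T₃ T₁' T₂' : Triple.{u, v} 𝒜 s}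

theorem refl (T : Triple.{u, v} 𝒜 s) : Iso T T :=
  ⟨LinearEquiv.refl A _, fun _ => rfl, fun _ => rfl⟩

theorem symm (h : Iso T₁ T₂) : Iso T₂ T₁ := by
  obtain ⟨e, h1, h2⟩ := h
  refine ⟨e.symm, fun m => ?_, fun m => ?_⟩
  · rw [LinearEquiv.symm_apply_eq, h1, LinearEquiv.apply_symm_apply]
  · rw [LinearEquiv.symm_apply_eq, h2, LinearEquiv.apply_symm_apply]

theorem trans (h : Iso T₁ T₂) (h' : Iso T₂ T₃) : Iso T₁ T₃ := by
  obtain ⟨e, h1, h2⟩ := h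
  obtain ⟨e', h1', h2'⟩ := h'
  refine ⟨e.trans e', fun m => ?_, fun m => ?_⟩
  · rw [LinearEquiv.trans_apply, LinearEquiv.trans_apply, h1, h1']
  · rw [LinearEquiv.trans_apply, LinearEquiv.trans_apply, h2, h2']

theorem sum (h : Iso T₁ T₂) (h' : Iso T₁' T₂') : Iso (T₁.sum T₁') (T₂.sum T₂') := by
  obtain ⟨e, h1, h2⟩ := h
  obtain ⟨e', h1', h2'⟩ := h'
  exact ⟨e.prodCongr e', fun m => Prod.ext (h1 m.1) (h1' m.2),
    fun m => Prod.ext (h2 m.1) (h2' m.2)⟩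

theorem comm (T₁ T₂ : Triple.{u, v} 𝒜 s) : Iso (T₁.sum T₂) (T₂.sum T₁) :=
  ⟨LinearEquiv.prodComm A _ _, fun _ => rfl, fun _ => rfl⟩

theorem assoc (T₁ T₂ T₃ : Triple.{u, v} 𝒜 s) :
    Iso ((T₁.sum T₂).sum T₃) (T₁.sum (T₂.sum T₃)) :=
  ⟨LinearEquiv.prodAssoc A _ _ _, fun _ => rfl, fun _ => rfl⟩

theorem zero_sum (T : Triple.{u, v} 𝒜 s) : Iso ((zero 𝒜 s).sum T) T :=
  ⟨(LinearEquiv.uniqueProd : (PUnit.{v + 1} × T.carrier) ≃ₗ[A] T.carrier), fun _ => rfl,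
    fun _ => rfl⟩

theorem sum_sum_comm (T₁ T₂ T₃ T₄ : Triple.{u, v} 𝒜 s) :
    Iso ((T₁.sum T₂).sum (T₃.sum T₄)) ((T₁.sum T₃).sum (T₂.sum T₄)) :=
  ⟨LinearEquiv.prodProdProdComm A _ _ _ _, fun _ => rfl, fun _ => rfl⟩

theorem swap (h : Iso T₁ T₂) : Iso T₁.swap T₂.swap := by
  obtain ⟨e, h1, h2⟩ := h
  exact ⟨e, h2, h1⟩

end Iso

namespace IsElementary

theorem of_eq (T : Triple.{u, v} 𝒜 s) (h : T.fst = T.snd) : T.IsElementary := by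
  rw [IsElementary, h]
  exact JoinedIn.refl T.snd_mem

theorem zero : (zero.{u, v} 𝒜 s).IsElementary := of_eq _ rfl

theorem swap {T : Triple.{u, v} 𝒜 s} (h : T.IsElementary) : T.swap.IsElementary :=
  JoinedIn.symm h

variable [ContinuousSMul ℝ A]

theorem continuous_prodMap (M N : Type*) [AddCommGroup M] [Module ℝ M] [TopologicalSpace M]
    [IsTopologicalAddGroup M] [ContinuousSMul ℝ M] [AddCommGroup N] [Module ℝ N]
    [TopologicalSpace N] [IsTopologicalAddGroup N] [ContinuousSMul ℝ N] :
    Continuous fun p : (M →L[ℝ] M) × (N →L[ℝ] N) => p.1.prodMap p.2 := by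
  have h : (fun p : (M →L[ℝ] M) × (N →L[ℝ] N) => p.1.prodMap p.2) = fun p =>
      ContinuousLinearMap.precomp (M × N) (ContinuousLinearMap.fst ℝ M N)
          (ContinuousLinearMap.postcomp M (ContinuousLinearMap.inl ℝ M N) p.1) +
        ContinuousLinearMap.precomp (M × N) (ContinuousLinearMap.snd ℝ M N)
          (ContinuousLinearMap.postcomp N (ContinuousLinearMap.inr ℝ M N) p.2) := by
    funext p
    ext m <;> simp
  rw [h]
  exact (((ContinuousLinearMap.continuous _).comp (ContinuousLinearMap.continuous _)).comp
    continuous_fst).add (((ContinuousLinearMap.continuous _).comp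
      (ContinuousLinearMap.continuous _)).comp continuous_snd)

theorem sum {T T' : Triple.{u, v} 𝒜 s} (h : T.IsElementary) (h' : T'.IsElementary) :
    (T.sum T').IsElementary := by
  obtain ⟨γ, hγ⟩ := h
  obtain ⟨γ', hγ'⟩ := h'
  exact ⟨(γ.prod γ').map (continuous_prodMap T.carrier T'.carrier),
    fun t => prodMap_mem (hγ t) (hγ' t)⟩

/-- `T ⊕ T.swap` is elementary, by conjugation with a rotation. -/
theorem sum_swap (T : Triple.{u, v} 𝒜 s) : (T.sum T.swap).IsElementary := by
  let N := T.carrier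
  let X : N × N →L[ℝ] N × N := T.fst.prodMap T.snd
  let Y : N × N →L[ℝ] N × N := T.snd.prodMap T.fst
  let D : N →L[ℝ] N := T.fst - T.snd
  let Z : N × N →L[ℝ] N × N :=
    (D.comp (ContinuousLinearMap.snd ℝ N N)).prod (D.comp (ContinuousLinearMap.fst ℝ N N))
  let P : ℝ → (N × N →L[ℝ] N × N) := fun t =>
    (Real.cos t * Real.cos t) • X + (Real.sin t * Real.sin t) • Y + (Real.cos t * Real.sin t) • Z
  have hP : Continuous P := by fun_prop
  have hX : X ∈ skewRoots 𝒜 s (N × N) := prodMap_mem T.fst_mem T.snd_mem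
  have hY : Y ∈ skewRoots 𝒜 s (N × N) := prodMap_mem T.snd_mem T.fst_mem
  have hmem : ∀ t, P t ∈ skewRoots 𝒜 s (N × N) := by
    intro t
    have hcs : Real.cos t * Real.cos t + Real.sin t * Real.sin t = 1 := by
      rw [← sq, ← sq, Real.cos_sq_add_sin_sq]
    constructor
    · intro i a ha m
      have hZ : Z (a • m) = (-1 : ℤˣ) ^ i • a • Z m := by
        have hD : ∀ n : N, D (a • n) = (-1 : ℤˣ) ^ i • a • D n := fun n => by
          change T.fst (a • n) - T.snd (a • n) = _ • a • (T.fst n - T.snd n)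
          rw [T.fst_mem.1 i a ha, T.snd_mem.1 i a ha, smul_sub, smul_sub]
        exact Prod.ext (hD m.2) (hD m.1)
      have hcomm : ∀ (r : ℝ) (x : N × N),
          r • (-1 : ℤˣ) ^ i • a • x = (-1 : ℤˣ) ^ i • a • r • x := fun r x => by
        have : SMulCommClass ℝ A (N × N) := IsScalarTower.to_smulCommClass
        rw [smul_comm r, smul_comm r]
      have hPm : ∀ x : N × N, P t x = (Real.cos t * Real.cos t) • X x +
          (Real.sin t * Real.sin t) • Y x + (Real.cos t * Real.sin t) • Z x := fun _ => rfl
      rw [hPm, hPm]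
      rw [hX.1 i a ha, hY.1 i a ha, hZ, hcomm, hcomm, hcomm, smul_add, smul_add, smul_add, smul_add]
    · have hF : ∀ n : N, T.fst (T.fst n) = s • n := T.fst_mem.2
      have hG : ∀ n : N, T.snd (T.snd n) = s • n := T.snd_mem.2
      have hP1 : ∀ x : N × N, (P t x).1 = (Real.cos t * Real.cos t) • T.fst x.1 +
          (Real.sin t * Real.sin t) • T.snd x.1 +
          (Real.cos t * Real.sin t) • (T.fst x.2 - T.snd x.2) := fun _ => rfl
      have hP2 : ∀ x : N × N, (P t x).2 = (Real.cos t * Real.cos t) • T.snd x.2 +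
          (Real.sin t * Real.sin t) • T.fst x.2 +
          (Real.cos t * Real.sin t) • (T.fst x.1 - T.snd x.1) := fun _ => rfl
      rintro ⟨m, n⟩
      have h1 : ∀ y : N, y = ((Real.cos t * Real.cos t + Real.sin t * Real.sin t) *
          (Real.cos t * Real.cos t + Real.sin t * Real.sin t)) • y := fun y => by
        rw [hcs, one_mul, one_smul]
      refine Prod.ext ((Eq.trans ?_ (h1 (s • m)).symm)) ((Eq.trans ?_ (h1 (s • n)).symm))
      all_goals
        simp only [hP1, hP2, map_add, map_sub, map_smul, hF, hG]
        generalize Real.cos t = c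
        generalize Real.sin t = d
        generalize s • m = m'
        generalize s • n = n'
        module
  refine ⟨⟨⟨fun t => P (t * (Real.pi / 2)), by fun_prop⟩, ?_, ?_⟩, fun t => hmem _⟩
  · change P _ = X
    simp [P]
  · change P _ = Y
    simp [P]

end IsElementary

variable [ContinuousSMul ℝ A]

theorem Rel.refl (T : Triple.{u, v} 𝒜 s) : Rel T T :=
  ⟨zero 𝒜 s, zero 𝒜 s, .zero, .zero, .refl _⟩

theorem Rel.symm {T₁ T₂ : Triple.{u, v} 𝒜 s} (h : Rel T₁ T₂) : Rel T₂ T₁ := by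
  obtain ⟨E₁, E₂, h1, h2, h⟩ := h
  exact ⟨E₂, E₁, h2, h1, h.symm⟩

theorem Rel.trans {T₁ T₂ T₃ : Triple.{u, v} 𝒜 s} (h : Rel T₁ T₂) (h' : Rel T₂ T₃) :
    Rel T₁ T₃ := by
  obtain ⟨E₁, E₂, h1, h2, h⟩ := h
  obtain ⟨F₂, F₃, h3, h4, h'⟩ := h'
  refine ⟨E₁.sum F₂, F₃.sum E₂, h1.sum h3, h4.sum h2, ?_⟩
  refine (Iso.assoc _ _ _).symm.trans ((h.sum (.refl F₂)).trans ?_)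
  refine ((Iso.assoc _ _ _).trans ((Iso.refl T₂).sum (.comm E₂ F₂))).trans ?_
  exact (Iso.assoc _ _ _).symm.trans ((h'.sum (.refl E₂)).trans (Iso.assoc _ _ _))

theorem Rel.of_iso {T₁ T₂ : Triple.{u, v} 𝒜 s} (h : Iso T₁ T₂) : Rel T₁ T₂ :=
  ⟨zero 𝒜 s, zero 𝒜 s, .zero, .zero, h.sum (.refl _)⟩

theorem Rel.sum {T₁ T₂ T₁' T₂' : Triple.{u, v} 𝒜 s} (h : Rel T₁ T₂) (h' : Rel T₁' T₂') :
    Rel (T₁.sum T₁') (T₂.sum T₂') := by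
  obtain ⟨E₁, E₂, h1, h2, h⟩ := h
  obtain ⟨F₁, F₂, h3, h4, h'⟩ := h'
  exact ⟨E₁.sum F₁, E₂.sum F₂, h1.sum h3, h2.sum h4,
    (Iso.sum_sum_comm _ _ _ _).trans ((h.sum h').trans (Iso.sum_sum_comm _ _ _ _))⟩

theorem Rel.swap {T₁ T₂ : Triple.{u, v} 𝒜 s} (h : Rel T₁ T₂) : Rel T₁.swap T₂.swap := by
  obtain ⟨E₁, E₂, h1, h2, h⟩ := h
  exact ⟨E₁.swap, E₂.swap, h1.swap, h2.swap, h.swap⟩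

theorem Rel.zero_of_isElementary {T : Triple.{u, v} 𝒜 s} (h : T.IsElementary) :
    Rel T (zero 𝒜 s) :=
  ⟨zero 𝒜 s, T, .zero, h, .comm _ _⟩

/-- Equivalence of triples. -/
@[reducible] def setoid (𝒜 : ZMod 2 → Submodule ℝ A) (s : ℤˣ) : Setoid (Triple.{u, v} 𝒜 s) where
  r := Rel
  iseqv := ⟨Rel.refl, Rel.symm, Rel.trans⟩

end Triple

section KGroup

variable {A : Type u} [Ring A] [Algebra ℝ A] [TopologicalSpace A] [ContinuousSMul ℝ A]

/-- The group of equivalence classes of triples, under direct sum. -/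
def KGroup (𝒜 : ZMod 2 → Submodule ℝ A) (s : ℤˣ) : Type (max u (v + 1)) :=
  Quotient (Triple.setoid.{u, v} 𝒜 s)

variable (𝒜 : ZMod 2 → Submodule ℝ A) (s : ℤˣ)

instance : Add (KGroup.{u, v} 𝒜 s) where
  add := Quotient.map₂ Triple.sum fun _ _ h _ _ h' => h.sum h'

instance : Zero (KGroup.{u, v} 𝒜 s) where
  zero := Quotient.mk _ (Triple.zero 𝒜 s)

instance : Neg (KGroup.{u, v} 𝒜 s) where
  neg := Quotient.map Triple.swap fun _ _ h => h.swap

instance : AddCommGroup (KGroup.{u, v} 𝒜 s) where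
  add_assoc := by
    rintro ⟨a⟩ ⟨b⟩ ⟨c⟩
    exact Quotient.sound (.of_iso (.assoc a b c))
  zero_add := by
    rintro ⟨a⟩
    exact Quotient.sound (.of_iso (.zero_sum a))
  add_zero := by
    rintro ⟨a⟩
    exact Quotient.sound (.of_iso ((Triple.Iso.comm _ _).trans (.zero_sum a)))
  add_comm := by
    rintro ⟨a⟩ ⟨b⟩
    exact Quotient.sound (.of_iso (.comm a b))
  neg_add_cancel := by
    rintro ⟨a⟩
    exact Quotient.sound ((Triple.Rel.of_iso (.comm _ _)).trans
      (.zero_of_isElementary (.sum_swap a)))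
  nsmul := nsmulRec
  zsmul := zsmulRec

/-- The class of a triple. -/
def KGroup.mk {𝒜 : ZMod 2 → Submodule ℝ A} {s : ℤˣ} (T : Triple.{u, v} 𝒜 s) : KGroup.{u, v} 𝒜 s :=
  Quotient.mk _ T

end KGroup


/-! ### Base change along a graded homomorphism -/

section BaseChange

variable {A : Type u} {B : Type w} [Ring A] [Algebra ℝ A] [Ring B] [Algebra ℝ B]
  [TopologicalSpace A] [TopologicalSpace B]
  {𝒜 : ZMod 2 → Submodule ℝ A} {ℬ : ZMod 2 → Submodule ℝ B}

/-- The relations `b f(a) ⊗ m = b ⊗ a m`. -/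
def baseChangeRel (f : GradedHom 𝒜 ℬ) (M : Type v) [AddCommGroup M] [Module ℝ M] [Module A M] :
    Submodule B (B ⊗[ℝ] M) :=
  Submodule.span B {x | ∃ (b : B) (a : A) (m : M),
    x = (b * f.toAlgHom a) ⊗ₜ[ℝ] m - b ⊗ₜ[ℝ] (a • m)}

/-- The `B`-module `B ⊗_A M`, for a homomorphism `f : A → B` and a left `A`-module `M`. -/
def BaseChange (f : GradedHom 𝒜 ℬ) (M : Type v) [AddCommGroup M] [Module ℝ M] [Module A M] :
    Type (max w v) :=
  (B ⊗[ℝ] M) ⧸ baseChangeRel f M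

namespace BaseChange

variable (f : GradedHom 𝒜 ℬ) (M : Type v) [AddCommGroup M] [Module ℝ M] [Module A M]

noncomputable instance : AddCommGroup (BaseChange f M) :=
  inferInstanceAs (AddCommGroup ((B ⊗[ℝ] M) ⧸ baseChangeRel f M))

noncomputable instance : Module B (BaseChange f M) :=
  inferInstanceAs (Module B ((B ⊗[ℝ] M) ⧸ baseChangeRel f M))

noncomputable instance : Module ℝ (BaseChange f M) :=
  inferInstanceAs (Module ℝ ((B ⊗[ℝ] M) ⧸ baseChangeRel f M))

instance : IsScalarTower ℝ B (BaseChange f M) :=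
  inferInstanceAs (IsScalarTower ℝ B ((B ⊗[ℝ] M) ⧸ baseChangeRel f M))

noncomputable instance : TopologicalSpace (BaseChange f M) := moduleTopology B (BaseChange f M)

instance : IsModuleTopology B (BaseChange f M) := ⟨rfl⟩

instance : IsTopologicalAddGroup (BaseChange f M) :=
  IsModuleTopology.topologicalAddGroup B (BaseChange f M)

variable {M}

variable (M) in
/-- The quotient map. -/
noncomputable def quot : B ⊗[ℝ] M →ₗ[B] BaseChange f M := (baseChangeRel f M).mkQ

/-- The class of `b ⊗ m`. -/
noncomputable def tmul (b : B) (m : M) : BaseChange f M := quot f M (b ⊗ₜ[ℝ] m)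

theorem tmul_smul (b : B) (a : A) (m : M) : tmul f b (a • m) = tmul f (b * f.toAlgHom a) m := by
  symm
  rw [← sub_eq_zero, tmul, tmul, ← map_sub]
  exact (Submodule.Quotient.mk_eq_zero _).2 (Submodule.subset_span ⟨b, a, m, rfl⟩)

theorem smul_tmul (c b : B) (m : M) : c • tmul f b m = tmul f (c * b) m := rfl

theorem tmul_add (b : B) (m m' : M) : tmul f b (m + m') = tmul f b m + tmul f b m' := by
  rw [tmul, TensorProduct.tmul_add, map_add]; rfl

theorem add_tmul (b b' : B) (m : M) : tmul f (b + b') m = tmul f b m + tmul f b' m := by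
  rw [tmul, TensorProduct.add_tmul, map_add]; rfl

theorem tmul_real_smul (r : ℝ) (b : B) (m : M) : tmul f b (r • m) = r • tmul f b m := by
  rw [tmul, TensorProduct.tmul_smul]; rfl

theorem induction {P : BaseChange f M → Prop} (h : ∀ b m, P (tmul f b m))
    (hadd : ∀ x y, P x → P y → P (x + y)) (x : BaseChange f M) : P x := by
  obtain ⟨x, rfl⟩ : ∃ y, quot f M y = x := (baseChangeRel f M).mkQ_surjective x
  induction x using TensorProduct.induction_on with
  | zero =>
    have h0 := h 0 0
    rwa [tmul, TensorProduct.tmul_zero] at h0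
  | tmul b m => exact h b m
  | add x y hx hy => rw [map_add]; exact hadd _ _ hx hy

/-- The `B`-linear map `b ⊗ m ↦ b g(m)` for an `f`-semilinear map `g`. -/
noncomputable def lift {P : Type*} [AddCommGroup P] [Module ℝ P] [Module B P] [IsScalarTower ℝ B P]
    (g : M →ₗ[ℝ] P) (hg : ∀ (a : A) (m : M), g (a • m) = f.toAlgHom a • g m) :
    BaseChange f M →ₗ[B] P :=
  haveI : SMulCommClass ℝ B P := IsScalarTower.to_smulCommClass
  haveI : SMulCommClass B ℝ P := SMulCommClass.symm _ _ _
  (baseChangeRel f M).liftQ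
    (TensorProduct.AlgebraTensorModule.lift (LinearMap.toSpanSingleton B (M →ₗ[ℝ] P) g)) (by
      rw [baseChangeRel, Submodule.span_le]
      rintro _ ⟨b, a, m, rfl⟩
      rw [SetLike.mem_coe, LinearMap.mem_ker, map_sub, sub_eq_zero]
      simp [hg, mul_smul])

theorem lift_tmul {P : Type*} [AddCommGroup P] [Module ℝ P] [Module B P] [IsScalarTower ℝ B P]
    (g : M →ₗ[ℝ] P) (hg : ∀ (a : A) (m : M), g (a • m) = f.toAlgHom a • g m) (b : B) (m : M) :
    lift f g hg (tmul f b m) = b • g m := rfl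

variable (M) in
/-- The canonical map `m ↦ 1 ⊗ m`. -/
noncomputable def unit : M →ₗ[ℝ] BaseChange f M where
  toFun m := tmul f 1 m
  map_add' := tmul_add f 1
  map_smul' r m := tmul_real_smul f r 1 m

theorem unit_smul (a : A) (m : M) : unit f M (a • m) = f.toAlgHom a • unit f M m := by
  change tmul f 1 (a • m) = f.toAlgHom a • tmul f 1 m
  rw [tmul_smul, smul_tmul, one_mul, mul_one]

theorem tmul_eq_smul_unit (b : B) (m : M) : tmul f b m = b • unit f M m := by
  change _ = b • tmul f 1 m
  rw [smul_tmul, mul_one]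

theorem hom_ext {P : Type*} [AddCommGroup P] [Module B P] {g h : BaseChange f M →ₗ[B] P}
    (H : ∀ m, g (unit f M m) = h (unit f M m)) : g = h := by
  ext x
  induction x using induction f with
  | h b m => rw [tmul_eq_smul_unit, map_smul, map_smul, H]
  | hadd x y hx hy => rw [map_add, map_add, hx, hy]

theorem continuous_unit [TopologicalSpace M] [IsModuleTopology A M] : Continuous (unit f M) :=
  IsModuleTopology.continuous_of_linearMapₛₗ (R := A) (S := B) (σ := f.toAlgHom.toRingHom) f.cont
    { toFun := unit f M
      map_add' := map_add _
      map_smul' := unit_smul f }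

instance [Module.Finite A M] : Module.Finite B (BaseChange f M) := by
  obtain ⟨S, hS⟩ := Module.Finite.fg_top (R := A) (M := M)
  classical
  refine ⟨⟨S.image (unit f M), ?_⟩⟩
  have key : ∀ m : M, unit f M m ∈ Submodule.span B (unit f M '' (S : Set M)) := by
    intro m
    have hm : m ∈ Submodule.span A (S : Set M) := by rw [hS]; exact Submodule.mem_top
    induction hm using Submodule.span_induction with
    | mem m hm => exact Submodule.subset_span ⟨m, hm, rfl⟩
    | zero => rw [map_zero]; exact zero_mem _
    | add x y _ _ hx hy => rw [map_add]; exact add_mem hx hy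
    | smul a x _ hx => rw [unit_smul]; exact Submodule.smul_mem _ _ hx
  rw [Finset.coe_image, eq_top_iff]
  have : ∀ x, x ∈ Submodule.span B (unit f M '' (S : Set M)) := fun x => by
    induction x using induction f with
    | h b m => rw [tmul_eq_smul_unit]; exact Submodule.smul_mem _ _ (key m)
    | hadd x y hx hy => exact add_mem hx hy
  exact fun x _ => this x

instance [IsScalarTower ℝ A M] [Module.Projective A M] : Module.Projective B (BaseChange f M) := by
  refine Module.Projective.of_lifting_property'' fun p hp => ?_
  let X := BaseChange f M →₀ B
  let _ : Module A X := Module.compHom X f.toAlgHom.toRingHom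
  let _ : Module A (BaseChange f M) := Module.compHom _ f.toAlgHom.toRingHom
  let p' : X →ₗ[A] BaseChange f M :=
    { toFun := p
      map_add' := map_add p
      map_smul' := fun a x => map_smul p (f.toAlgHom a) x }
  let j : M →ₗ[A] BaseChange f M :=
    { toFun := unit f M
      map_add' := map_add _
      map_smul' := unit_smul f }
  obtain ⟨h, hh⟩ := Module.projective_lifting_property p' j hp
  let h' : M →ₗ[ℝ] X :=
    { toFun := h
      map_add' := map_add h
      map_smul' := fun r m => by
        have e : r • m = (r • (1 : A)) • m := by rw [smul_assoc, one_smul]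
        rw [e, map_smul]
        change f.toAlgHom (r • (1 : A)) • h m = r • h m
        rw [map_smul, map_one, smul_assoc, one_smul] }
  refine ⟨lift f h' (fun a m => map_smul h a m), hom_ext f fun m => ?_⟩
  rw [LinearMap.comp_apply, LinearMap.id_apply]
  change p (lift f h' _ (tmul f 1 m)) = _
  rw [lift_tmul, one_smul]
  exact LinearMap.congr_fun hh m

/-- The map `b ⊗ m ↦ b ⊗ g(m)` for an `A`-linear map `g`. -/
noncomputable def map {N : Type*} [AddCommGroup N] [Module ℝ N] [Module A N] [IsScalarTower ℝ A M]
    [IsScalarTower ℝ A N] (g : M →ₗ[A] N) : BaseChange f M →ₗ[B] BaseChange f N :=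
  lift f (unit f N ∘ₗ g.restrictScalars ℝ) (fun a m => by
    change unit f N (g (a • m)) = _
    rw [map_smul, unit_smul]
    rfl)

theorem map_tmul {N : Type*} [AddCommGroup N] [Module ℝ N] [Module A N] [IsScalarTower ℝ A M]
    [IsScalarTower ℝ A N] (g : M →ₗ[A] N) (b : B) (m : M) :
    map f g (tmul f b m) = tmul f b (g m) := by
  rw [map, lift_tmul, LinearMap.comp_apply, ← tmul_eq_smul_unit]
  rfl

theorem map_map_of_leftInverse {N : Type*} [AddCommGroup N] [Module ℝ N] [Module A N]
    [IsScalarTower ℝ A M] [IsScalarTower ℝ A N] (g : M →ₗ[A] N) (h : N →ₗ[A] M)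
    (H : ∀ m, h (g m) = m) (x : BaseChange f M) : map f h (map f g x) = x := by
  induction x using induction f with
  | h b m => rw [map_tmul, map_tmul, H]
  | hadd x y hx hy => rw [map_add, map_add, hx, hy]

/-- The isomorphism `B ⊗ M ≃ B ⊗ N` for an isomorphism `M ≃ N`. -/
noncomputable def mapEquiv {N : Type*} [AddCommGroup N] [Module ℝ N] [Module A N]
    [IsScalarTower ℝ A M] [IsScalarTower ℝ A N] (e : M ≃ₗ[A] N) :
    BaseChange f M ≃ₗ[B] BaseChange f N where
  __ := map f e.toLinearMap
  invFun := map f e.symm.toLinearMap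
  left_inv := map_map_of_leftInverse f e.toLinearMap e.symm.toLinearMap e.symm_apply_apply
  right_inv := map_map_of_leftInverse f e.symm.toLinearMap e.toLinearMap e.apply_symm_apply

theorem tmul_zero (b : B) : tmul f b (0 : M) = 0 := by
  rw [tmul_eq_smul_unit, map_zero, smul_zero]

/-- The isomorphism `B ⊗ (M × N) ≃ (B ⊗ M) × (B ⊗ N)`. -/
noncomputable def prodEquiv (M N : Type*) [AddCommGroup M] [Module ℝ M] [Module A M]
    [IsScalarTower ℝ A M] [AddCommGroup N] [Module ℝ N] [Module A N] [IsScalarTower ℝ A N] :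
    BaseChange f (M × N) ≃ₗ[B] BaseChange f M × BaseChange f N :=
  LinearEquiv.ofLinearMap ((map f (LinearMap.fst A M N)).prod (map f (LinearMap.snd A M N)))
    ((map f (LinearMap.inl A M N)).coprod (map f (LinearMap.inr A M N)))
    (by
      refine LinearMap.prod_ext (hom_ext f fun m => ?_) (hom_ext f fun m => ?_)
      all_goals
        simp only [LinearMap.comp_apply, LinearMap.coprod_apply, LinearMap.inl_apply,
          LinearMap.inr_apply, LinearMap.prod_apply, map_zero, add_zero, zero_add,
          LinearMap.id_apply]
        change (map f _ (map f _ (tmul f 1 m)), map f _ (map f _ (tmul f 1 m))) = _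
        rw [map_tmul, map_tmul, map_tmul]
      · exact Prod.ext rfl (tmul_zero f 1)
      · exact Prod.ext (tmul_zero f 1) rfl)
    (hom_ext f fun m => by
      change map f _ (map f _ (tmul f 1 m)) + map f _ (map f _ (tmul f 1 m)) = tmul f 1 m
      rw [map_tmul, map_tmul, map_tmul, map_tmul, ← tmul_add]
      congr 1
      exact Prod.ext (add_zero _) (zero_add _))

variable [GradedAlgebra 𝒜] [GradedAlgebra ℬ]

/-- The operator `b ⊗ m ↦ (-1)^|b| b ⊗ T m` for a skew-linear operator `T`, as a linear map. -/
noncomputable def skewMap (T : M →ₗ[ℝ] M)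
    (hT : ∀ (a : A) (m : M), T (a • m) = gradeInv 𝒜 a • T m) :
    BaseChange f M →ₗ[ℝ] BaseChange f M :=
  (Submodule.Quotient.restrictScalarsEquiv ℝ (baseChangeRel f M)).toLinearMap ∘ₗ
    Submodule.mapQ ((baseChangeRel f M).restrictScalars ℝ) ((baseChangeRel f M).restrictScalars ℝ)
      (TensorProduct.map (gradeInv ℬ) T) (by
        intro x hx
        rw [Submodule.restrictScalars_mem] at hx
        rw [Submodule.mem_comap, Submodule.restrictScalars_mem]
        induction hx using Submodule.span_induction with
        | zero => rw [map_zero]; exact zero_mem _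
        | add x y _ _ hx hy => rw [map_add]; exact add_mem hx hy
        | mem x hx =>
          obtain ⟨b, a, m, rfl⟩ := hx
          rw [map_sub, TensorProduct.map_tmul, TensorProduct.map_tmul, hT, gradeInv_mul,
            ← f.map_gradeInv]
          exact Submodule.subset_span ⟨_, _, _, rfl⟩
        | smul c x _ hx =>
          have h : ∀ y : B ⊗[ℝ] M, TensorProduct.map (gradeInv ℬ) T (c • y) =
              gradeInv ℬ c • TensorProduct.map (gradeInv ℬ) T y := by
            intro y
            induction y using TensorProduct.induction_on with
            | zero => rw [smul_zero, map_zero, smul_zero]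
            | tmul b m =>
              rw [TensorProduct.smul_tmul', TensorProduct.map_tmul, TensorProduct.map_tmul,
                TensorProduct.smul_tmul', smul_eq_mul, smul_eq_mul, gradeInv_mul]
            | add x y hx hy => rw [smul_add, map_add, hx, hy, map_add, smul_add]
          rw [h]
          exact Submodule.smul_mem _ _ hx) ∘ₗ
    (Submodule.Quotient.restrictScalarsEquiv ℝ (baseChangeRel f M)).symm.toLinearMap

theorem skewMap_tmul (T : M →ₗ[ℝ] M) (hT : ∀ (a : A) (m : M), T (a • m) = gradeInv 𝒜 a • T m)
    (b : B) (m : M) : skewMap f T hT (tmul f b m) = tmul f (gradeInv ℬ b) (T m) := rfl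

theorem skewMap_smul (T : M →ₗ[ℝ] M) (hT : ∀ (a : A) (m : M), T (a • m) = gradeInv 𝒜 a • T m)
    (c : B) (x : BaseChange f M) : skewMap f T hT (c • x) = gradeInv ℬ c • skewMap f T hT x := by
  induction x using induction f with
  | h b m => rw [smul_tmul, skewMap_tmul, skewMap_tmul, smul_tmul, gradeInv_mul]
  | hadd x y hx hy => rw [smul_add, map_add, map_add, hx, hy, smul_add]

end BaseChange

/-- The grading involution as a ring homomorphism. -/
noncomputable def gradeInvRingHom (ℬ : ZMod 2 → Submodule ℝ B) [GradedAlgebra ℬ] : B →+* B where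
  toFun := gradeInv ℬ
  map_one' := gradeInv_even ℬ SetLike.GradedOne.one_mem
  map_mul' := gradeInv_mul ℬ
  map_zero' := map_zero _
  map_add' := map_add _

section Push

variable [GradedAlgebra 𝒜] [GradedAlgebra ℬ] [IsTopologicalRing B] [IsModuleTopology ℝ B]

theorem continuous_gradeInv (ℬ : ZMod 2 → Submodule ℝ B) [GradedAlgebra ℬ] :
    Continuous (gradeInv ℬ) :=
  IsModuleTopology.continuous_of_linearMap (gradeInv ℬ)

/-- A pointwise continuous family of skew-linear operators is continuous. -/
theorem continuous_of_pointwise {N : Type v} [AddCommGroup N] [Module ℝ N] [Module B N]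
    [IsScalarTower ℝ B N] [TopologicalSpace N] [IsModuleTopology B N] [IsTopologicalAddGroup N]
    [Module.Finite B N] [Module.Projective B N] {ι : Type*} [TopologicalSpace ι]
    (T : ι → N →L[ℝ] N) (hT : ∀ t (b : B) (n : N), T t (b • n) = gradeInv ℬ b • T t n)
    (h : ∀ n, Continuous fun t => T t n) : Continuous T := by
  have : ContinuousSMul ℝ N := Triple.continuousSMul_real (A := B) N
  have : SMulCommClass ℝ B N := IsScalarTower.to_smulCommClass
  have : SMulCommClass B ℝ N := SMulCommClass.symm _ _ _
  obtain ⟨k, p, hp⟩ := Module.Finite.exists_fin' B N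
  obtain ⟨σ, hσ⟩ := Module.projective_lifting_property p LinearMap.id hp
  have hσc : Continuous σ := IsModuleTopology.continuous_of_linearMap σ
  let σ' : N →L[ℝ] (Fin k → B) := ⟨σ.restrictScalars ℝ, hσc⟩
  let L : N →ₗ[ℝ] (B →L[ℝ] N) :=
    { toFun := fun n => ⟨(LinearMap.toSpanSingleton B N n).restrictScalars ℝ ∘ₗ gradeInv ℬ,
        (continuous_gradeInv ℬ).smul continuous_const⟩
      map_add' := fun n n' => by ext b; exact smul_add _ _ _
      map_smul' := fun r n => by ext b; exact smul_comm _ _ _ }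
  have hL : Continuous L := by
    refine ContinuousLinearMap.continuous_of_continuous_uncurry L ?_
    exact ((continuous_gradeInv ℬ).comp continuous_snd).smul continuous_fst
  have key : T = fun t => ∑ i, ((L (T t (p (Pi.single i 1)))).comp
      ((ContinuousLinearMap.proj i).comp σ')) := by
    funext t
    ext n
    have hn : n = ∑ i, σ n i • p (Pi.single i 1) := by
      conv_lhs => rw [← LinearMap.id_apply (R := B) n, ← hσ, LinearMap.comp_apply]
      conv_lhs => rw [← Finset.univ_sum_single (σ n), map_sum]
      refine Finset.sum_congr rfl fun i _ => ?_
      rw [← map_smul, ← Pi.single_smul, smul_eq_mul, mul_one]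
    conv_lhs => rw [hn, map_sum]
    rw [sum_apply]
    exact Finset.sum_congr rfl fun i _ => hT _ _ _
  rw [key]
  refine continuous_finsetSum _ fun i _ => ?_
  exact (ContinuousLinearMap.precomp N ((ContinuousLinearMap.proj i).comp σ')).continuous.comp
    (hL.comp (h _))

namespace BaseChange

variable (f : GradedHom 𝒜 ℬ) {M : Type v} [AddCommGroup M] [Module ℝ M] [Module A M]
  [TopologicalSpace M] {s : ℤˣ}

/-- The operator `b ⊗ m ↦ (-1)^|b| b ⊗ T m` on `B ⊗_A M`. -/
noncomputable def skewCLM (T : M →L[ℝ] M)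
    (hT : ∀ (a : A) (m : M), T (a • m) = gradeInv 𝒜 a • T m) :
    BaseChange f M →L[ℝ] BaseChange f M where
  __ := skewMap f T.toLinearMap hT
  cont := IsModuleTopology.continuous_of_linearMapₛₗ (R := B) (S := B) (σ := gradeInvRingHom ℬ)
    (continuous_gradeInv ℬ)
    { toFun := skewMap f T.toLinearMap hT
      map_add' := map_add _
      map_smul' := skewMap_smul f T.toLinearMap hT }

theorem skewCLM_tmul (T : M →L[ℝ] M) (hT : ∀ (a : A) (m : M), T (a • m) = gradeInv 𝒜 a • T m)
    (b : B) (m : M) : skewCLM f T hT (tmul f b m) = tmul f (gradeInv ℬ b) (T m) := rfl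

theorem skewCLM_smul (T : M →L[ℝ] M) (hT : ∀ (a : A) (m : M), T (a • m) = gradeInv 𝒜 a • T m)
    (c : B) (x : BaseChange f M) : skewCLM f T hT (c • x) = gradeInv ℬ c • skewCLM f T hT x :=
  skewMap_smul f T.toLinearMap hT c x

theorem skewCLM_mem {T : M →L[ℝ] M} (hT : T ∈ skewRoots 𝒜 s M) :
    skewCLM f T ((mem_skewRoots 𝒜).1 hT).1 ∈ skewRoots ℬ s (BaseChange f M) := by
  refine (mem_skewRoots ℬ).2 ⟨skewCLM_smul f T _, fun x => ?_⟩
  induction x using induction f with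
  | h b m =>
    rw [skewCLM_tmul, skewCLM_tmul, gradeInv_gradeInv, hT.2, tmul_eq_smul_unit, tmul_eq_smul_unit,
      Units.smul_def, Units.smul_def, map_zsmul, smul_comm]
  | hadd x y hx hy => rw [map_add, map_add, hx, hy, smul_add]

theorem map_skewCLM {N : Type v} [AddCommGroup N] [Module ℝ N] [Module A N] [TopologicalSpace N]
    [IsScalarTower ℝ A M] [IsScalarTower ℝ A N] (g : M →ₗ[A] N) (T : M →L[ℝ] M) (T' : N →L[ℝ] N)
    (hT : ∀ (a : A) (m : M), T (a • m) = gradeInv 𝒜 a • T m)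
    (hT' : ∀ (a : A) (n : N), T' (a • n) = gradeInv 𝒜 a • T' n)
    (h : ∀ m, g (T m) = T' (g m)) (x : BaseChange f M) :
    map f g (skewCLM f T hT x) = skewCLM f T' hT' (map f g x) := by
  induction x using induction f with
  | h b m => rw [skewCLM_tmul, map_tmul, map_tmul, skewCLM_tmul, h]
  | hadd x y hx hy => rw [map_add, map_add, map_add, map_add, hx, hy]

end BaseChange

namespace Triple

variable [ContinuousSMul ℝ A] {s : ℤˣ} (f : GradedHom 𝒜 ℬ)

/-- The base change of a triple along a graded homomorphism. -/
noncomputable def push (T : Triple.{u, v} 𝒜 s) : Triple.{w, max w v} ℬ s where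
  carrier := BaseChange f T.carrier
  fst := BaseChange.skewCLM f T.fst ((mem_skewRoots 𝒜).1 T.fst_mem).1
  snd := BaseChange.skewCLM f T.snd ((mem_skewRoots 𝒜).1 T.snd_mem).1
  fst_mem := BaseChange.skewCLM_mem f T.fst_mem
  snd_mem := BaseChange.skewCLM_mem f T.snd_mem

theorem IsElementary.push {T : Triple.{u, v} 𝒜 s} (h : T.IsElementary) :
    (T.push f).IsElementary := by
  obtain ⟨γ, hγ⟩ := h
  refine ⟨⟨⟨fun t => BaseChange.skewCLM f (γ t) ((mem_skewRoots 𝒜).1 (hγ t)).1, ?_⟩, ?_, ?_⟩,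
    fun t => BaseChange.skewCLM_mem f (hγ t)⟩
  · refine continuous_of_pointwise (ℬ := ℬ) (N := BaseChange f T.carrier) _
      (fun t => BaseChange.skewCLM_smul f (γ t) _) fun n => ?_
    induction n using BaseChange.induction f with
    | h b m =>
      change Continuous fun t => BaseChange.tmul f (gradeInv ℬ b) (γ t m)
      simp only [BaseChange.tmul_eq_smul_unit]
      have hm : Continuous fun g : T.carrier →L[ℝ] T.carrier => g m := continuous_eval_const m
      have h3 : Continuous fun t => BaseChange.unit f T.carrier (γ t m) :=
        (BaseChange.continuous_unit f).comp (hm.comp γ.continuous)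
      exact (continuous_const (y := gradeInv ℬ b)).smul h3
    | hadd x y hx hy => simp only [map_add]; exact hx.add hy
  · change BaseChange.skewCLM f (γ 0) _ = BaseChange.skewCLM f T.fst _
    congr 1
    exact γ.source
  · change BaseChange.skewCLM f (γ 1) _ = BaseChange.skewCLM f T.snd _
    congr 1
    exact γ.target

theorem Iso.push {T T' : Triple.{u, v} 𝒜 s} (h : Iso T T') : Iso (T.push f) (T'.push f) := by
  obtain ⟨e, h1, h2⟩ := h
  exact ⟨BaseChange.mapEquiv f e,
    BaseChange.map_skewCLM f e.toLinearMap T.fst T'.fst _ ((mem_skewRoots 𝒜).1 T'.fst_mem).1 h1,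
    BaseChange.map_skewCLM f e.toLinearMap T.snd T'.snd _ ((mem_skewRoots 𝒜).1 T'.snd_mem).1 h2⟩

theorem Iso.push_sum (T T' : Triple.{u, v} 𝒜 s) :
    Iso ((T.sum T').push f) ((T.push f).sum (T'.push f)) :=
  ⟨BaseChange.prodEquiv f T.carrier T'.carrier,
    fun x => Prod.ext
      (BaseChange.map_skewCLM f (LinearMap.fst A T.carrier T'.carrier) (T.fst.prodMap T'.fst) T.fst
        ((mem_skewRoots 𝒜).1 (prodMap_mem T.fst_mem T'.fst_mem)).1
        ((mem_skewRoots 𝒜).1 T.fst_mem).1 (fun _ => rfl) x)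
      (BaseChange.map_skewCLM f (LinearMap.snd A T.carrier T'.carrier) (T.fst.prodMap T'.fst)
        T'.fst ((mem_skewRoots 𝒜).1 (prodMap_mem T.fst_mem T'.fst_mem)).1
        ((mem_skewRoots 𝒜).1 T'.fst_mem).1 (fun _ => rfl) x),
    fun x => Prod.ext
      (BaseChange.map_skewCLM f (LinearMap.fst A T.carrier T'.carrier) (T.snd.prodMap T'.snd) T.snd
        ((mem_skewRoots 𝒜).1 (prodMap_mem T.snd_mem T'.snd_mem)).1
        ((mem_skewRoots 𝒜).1 T.snd_mem).1 (fun _ => rfl) x)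
      (BaseChange.map_skewCLM f (LinearMap.snd A T.carrier T'.carrier) (T.snd.prodMap T'.snd)
        T'.snd ((mem_skewRoots 𝒜).1 (prodMap_mem T.snd_mem T'.snd_mem)).1
        ((mem_skewRoots 𝒜).1 T'.snd_mem).1 (fun _ => rfl) x)⟩

theorem Rel.push {T T' : Triple.{u, v} 𝒜 s} (h : Rel T T') : Rel (T.push f) (T'.push f) := by
  obtain ⟨E, E', h1, h2, h⟩ := h
  exact ⟨E.push f, E'.push f, h1.push f, h2.push f,
    (Iso.push_sum f T E).symm.trans ((h.push f).trans (Iso.push_sum f T' E'))⟩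

end Triple

/-- The homomorphism `K(A) → K(B)` induced by a graded homomorphism `A → B` through the functor
`M ↦ B ⊗_A M`, for algebras `B` that carry the finest vector space topology (for instance
finite-dimensional ones). -/
noncomputable def KGroup.map [ContinuousSMul ℝ A] (s : ℤˣ) (f : GradedHom 𝒜 ℬ) :
    KGroup.{u, v} 𝒜 s →+ KGroup.{w, max w v} ℬ s :=
  AddMonoidHom.mk' (Quotient.map (Triple.push f) fun _ _ h => h.push f) (by
    rintro ⟨a⟩ ⟨b⟩
    exact Quotient.sound (.of_iso (Triple.Iso.push_sum f a b)))

end Push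

end BaseChange


/-! ### Graded real C*-algebras and their K-groups -/

section CStar

/-- `A` is a real C*-algebra with a `ℤ/2`-grading by `*`-invariant subspaces. The algebra `A` is a
complete normed real algebra with involution, not necessarily with a unit, and it has an isometric
`*`-representation by bounded operators on some real Hilbert space. -/
structure IsGradedRealCStarAlgebra {A : Type u} [NonUnitalNormedRing A] [NormedSpace ℝ A]
    [StarRing A] (𝒜 : ZMod 2 → Submodule ℝ A) : Prop where
  complete : CompleteSpace A
  exists_representation : ∃ (H : Type u) (_ : NormedAddCommGroup H) (_ : InnerProductSpace ℝ H)
    (_ : CompleteSpace H) (φ : A →⋆ₙₐ[ℝ] (H →L[ℝ] H)), Isometry φ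
  star_mem : ∀ i, ∀ a ∈ 𝒜 i, star a ∈ 𝒜 i

/-- The grading of the Clifford algebra `Cl_n` for an integer `n`: there are `n` generators with
square `1` if `n` is nonnegative, and `-n` generators with square `-1` if `n` is nonpositive. -/
noncomputable abbrev clIntGrading (n : ℤ) : ZMod 2 → Submodule ℝ (Cl n.toNat (-n).toNat) :=
  clGrading n.toNat (-n).toNat

section Unital

variable {A : Type u} [Ring A] [Algebra ℝ A] [TopologicalSpace A] [ContinuousSMul ℝ A]
  (𝒜 : ZMod 2 → Submodule ℝ A)

/-- The group `SPT^A` of free SPT phases protected by a unital algebra `A`: equivalence classes of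
pairs of `A`-symmetric polarizations on finitely generated projective `A`-modules. -/
abbrev SPT : Type (u + 1) := KGroup.{u, u} 𝒜 (-1)

/-- The Karoubi K-group `K_0(A)` of a unital algebra `A`: equivalence classes of pairs of gradings
on finitely generated projective `A`-modules. -/
abbrev K0 : Type (u + 1) := KGroup.{u, u} 𝒜 1

variable [GradedAlgebra 𝒜]

/-- The group `SPT^{A ⊗ Cl_{+n}}`. -/
abbrev SPTCl (n : ℕ) : Type (u + 1) := SPT (tensorGrading 𝒜 (clGrading n 0))

/-- The Karoubi K-group `K_n(A) = K_0(Cl_n ⊗ A)` of a unital algebra `A`. -/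
abbrev K (n : ℤ) : Type (u + 1) := K0 (tensorGrading (clIntGrading n) 𝒜)

end Unital

section NonUnital

variable {A : Type u} [NonUnitalRing A] [Module ℝ A] [IsScalarTower ℝ A A] [SMulCommClass ℝ A A]
  [TopologicalSpace A] [ContinuousSMul ℝ A]
  (𝒜 : ZMod 2 → Submodule ℝ A) [DirectSum.Decomposition 𝒜] [SetLike.GradedMul 𝒜]

/-- `SPT^A` for a not necessarily unital algebra: the kernel of `SPT^{A_+} → SPT^ℝ`. -/
noncomputable def nonunitalSPT : AddSubgroup (SPT (AddUnit.grading 𝒜)) :=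
  (KGroup.map.{u, u, 0} (-1) (augmentationHom 𝒜)).ker

/-- `SPT^{A ⊗ Cl_{+n}}` for a not necessarily unital algebra `A`: the kernel of
`SPT^{A_+ ⊗ Cl_{+n}} → SPT^{ℝ ⊗ Cl_{+n}}`. -/
noncomputable def nonunitalSPTCl (n : ℕ) : AddSubgroup (SPTCl (AddUnit.grading 𝒜) n) :=
  (KGroup.map.{u, u, 0} (-1)
    ((augmentationHom 𝒜).tensor (GradedHom.refl (clGrading n 0)))).ker

/-- `K_n(A)` for a not necessarily unital algebra: the kernel of `K_n(A_+) → K_n(ℝ)`. -/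
noncomputable def nonunitalK (n : ℤ) : AddSubgroup (K (AddUnit.grading 𝒜) n) :=
  (KGroup.map.{u, u, 0} 1
    ((GradedHom.refl (clIntGrading n)).tensor (augmentationHom 𝒜))).ker

end NonUnital

end CStar

end FreeSPT

/-! The isomorphisms are dualities. Let `Q` be a bimodule over `R` and `S`, both acting on the left,
with a real-linear operator `τ` that is skew for both actions and satisfies `τ² = -1`. If `T` is a
skew-linear operator on an `R`-module `M`, then `φ ↦ τ ∘ φ ∘ T` maps `Hom_R(M, Q)` to itself, is
skew over `S`, and has square `-T²`. So dualizing turns polarizations over `R` into gradings over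
`S`, and conversely. If `Q` is finitely generated projective and faithful on both sides, and if `R`
and `S` are each other's commutants on `Q`, then finitely generated projective modules are reflexive
(`Duality.doubleDual_bijective`). Finite dual bases show that paths are carried to paths, and the
groups of triples with opposite signs become isomorphic (`Duality.equiv`).

Such a `Q` comes from an idempotent `p` of `R` with `R p R = R`: identify `S` with the opposite of
`p R p` and put `Q = R p`. If `u` is odd, `u² = 1` and `θ(p) = u p u`, where `θ` is the grading
involution, then `τ(q) = θ(q) u` preserves `R p`, and `τ² = -1` because `θ(u) = -u`
(`Corner.duality`).

Clifford generators supply `u` and `p`. Replacing an odd element `a` by `a u` absorbs the sign in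
the product of the graded opposite (`GradedAntiEquiv.untwist_mul`), so `A^op` meets the ordinary
opposite of a corner. For `A ⊗ Cl_1` take `p = 1`: its opposite is `Cl_1 ⊗ A^op` with a twisted
grading. For `A ⊗ Cl_{2+m}` with generators `u`, `e`, `g_j` take `p = (1 + e) / 2`: the corner is
generated by the even `a`, the products `a u` with `a` odd, and the `g_j u`, which have square `-1`;
it is the opposite of `Cl_{-m} ⊗ A^op` (`CliffordExt.exists_corner_of_two`). The cases `SPT^A` and
`n = 0` are the same statement read backwards: `A` is the opposite of a corner of `Cl_2 ⊗ A^op`.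

For algebras without unit the dualities for `A_+` and for `ℝ` are compared. Base change of `Hom_R(M,
Q)` is the dual of the base change of `M` (`DualityHom.compare_bijective`), so the isomorphisms
commute with the augmentation maps and identify their kernels.

The C*-structure enters only through the continuity of `θ`. The homogeneous subspaces are not
assumed closed; `θ` is nevertheless a contraction, because the norm of a C*-algebra is controlled by
quasi-invertibility, which any algebra automorphism preserves
(`IsGradedRealCStarAlgebra.norm_gradeInv_le`). -/

namespace FreeSPT

/-! ### Dualizing bimodules -/

section Pointwise

variable {B : Type w} [Ring B] [Algebra ℝ B] [TopologicalSpace B] [IsTopologicalRing B]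
  [ContinuousSMul ℝ B] {ℬ : ZMod 2 → Submodule ℝ B} [GradedAlgebra ℬ]

/-- A pointwise continuous family of skew-linear operators is continuous, over any topological
algebra with continuous grading involution. -/
theorem continuous_of_pointwise_of_continuous_gradeInv (hθ : Continuous (gradeInv ℬ)) {N : Type v}
    [AddCommGroup N] [Module ℝ N] [Module B N]
    [IsScalarTower ℝ B N] [TopologicalSpace N] [IsModuleTopology B N] [IsTopologicalAddGroup N]
    [Module.Finite B N] [Module.Projective B N] {ι : Type*} [TopologicalSpace ι]
    (T : ι → N →L[ℝ] N) (hT : ∀ t (b : B) (n : N), T t (b • n) = gradeInv ℬ b • T t n)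
    (h : ∀ n, Continuous fun t => T t n) : Continuous T := by
  have : ContinuousSMul ℝ N := Triple.continuousSMul_real (A := B) N
  have : SMulCommClass ℝ B N := IsScalarTower.to_smulCommClass
  have : SMulCommClass B ℝ N := SMulCommClass.symm _ _ _
  obtain ⟨k, p, hp⟩ := Module.Finite.exists_fin' B N
  obtain ⟨σ, hσ⟩ := Module.projective_lifting_property p LinearMap.id hp
  have hσc : Continuous σ := IsModuleTopology.continuous_of_linearMap σ
  let σ' : N →L[ℝ] (Fin k → B) := ⟨σ.restrictScalars ℝ, hσc⟩
  let L : N →ₗ[ℝ] (B →L[ℝ] N) :=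
    { toFun := fun n => ⟨(LinearMap.toSpanSingleton B N n).restrictScalars ℝ ∘ₗ gradeInv ℬ,
        hθ.smul continuous_const⟩
      map_add' := fun n n' => by ext b; exact smul_add _ _ _
      map_smul' := fun r n => by ext b; exact smul_comm _ _ _ }
  have hL : Continuous L := by
    refine ContinuousLinearMap.continuous_of_continuous_uncurry L ?_
    exact (hθ.comp continuous_snd).smul continuous_fst
  -- With generators `x_i = p(e_i)` and a section `σ`, skew-linearity gives `T_t(n) = ∑ θ(σ_i(n))
  -- T_t(x_i)`. The whole operator is a fixed continuous function of finitely many of its values, so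
  -- pointwise continuity upgrades to the operator topology.
  have key : T = fun t => ∑ i, ((L (T t (p (Pi.single i 1)))).comp
      ((ContinuousLinearMap.proj i).comp σ')) := by
    funext t
    ext n
    have hn : n = ∑ i, σ n i • p (Pi.single i 1) := by
      conv_lhs => rw [← LinearMap.id_apply (R := B) n, ← hσ, LinearMap.comp_apply]
      conv_lhs => rw [← Finset.univ_sum_single (σ n), map_sum]
      refine Finset.sum_congr rfl fun i _ => ?_
      rw [← map_smul, ← Pi.single_smul, smul_eq_mul, mul_one]
    conv_lhs => rw [hn, map_sum]
    rw [sum_apply]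
    exact Finset.sum_congr rfl fun i _ => hT _ _ _
  rw [key]
  refine continuous_finsetSum _ fun i _ => ?_
  exact (ContinuousLinearMap.precomp N ((ContinuousLinearMap.proj i).comp σ')).continuous.comp
    (hL.comp (h _))

end Pointwise

/-- A finitely generated projective module has a finite dual basis. -/
theorem exists_dualBasis (R : Type*) [Ring R] (M : Type*) [AddCommGroup M] [Module R M]
    [Module.Finite R M] [Module.Projective R M] :
    ∃ (k : ℕ) (x : Fin k → M) (f : Fin k → M →ₗ[R] R), ∀ m, ∑ i, f i m • x i = m := by
  obtain ⟨k, p, hp⟩ := Module.Finite.exists_fin' R M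
  obtain ⟨σ, hσ⟩ := Module.projective_lifting_property p LinearMap.id hp
  refine ⟨k, fun i => p (Pi.single i 1), fun i => LinearMap.proj i ∘ₗ σ, fun m => ?_⟩
  conv_rhs => rw [← LinearMap.id_apply (R := R) m, ← hσ, LinearMap.comp_apply]
  conv_rhs => rw [← Finset.univ_sum_single (σ m), map_sum]
  refine Finset.sum_congr rfl fun i _ => ?_
  rw [← map_smul, ← Pi.single_smul, smul_eq_mul, mul_one]
  rfl

/-- The grading involution of a graded algebra as a ring homomorphism. -/
noncomputable def gradeInvHom {R : Type u} [Ring R] [Algebra ℝ R] (ℛ : ZMod 2 → Submodule ℝ R)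
    [GradedAlgebra ℛ] : R →+* R where
  toFun := gradeInv ℛ
  map_one' := gradeInv_even ℛ SetLike.GradedOne.one_mem
  map_mul' := gradeInv_mul ℛ
  map_zero' := map_zero _
  map_add' := map_add _

/-! ### Dualizing bimodules and reflexivity -/

section DualityDef

variable {R S : Type w} [Ring R] [Algebra ℝ R] [TopologicalSpace R] [Ring S] [Algebra ℝ S]
  [TopologicalSpace S]

/-- A bimodule `Q` (with the actions of `R` and `S` both written on the left) for which
`M ↦ Hom_R(M, Q)` is a duality between finitely generated projective modules over `R` and `S`,
with an operator of square `-1` that is skew-linear for both actions. -/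
structure Duality (ℛ : ZMod 2 → Submodule ℝ R) (𝒮 : ZMod 2 → Submodule ℝ S) [GradedAlgebra ℛ]
    [GradedAlgebra 𝒮] : Type (w + 1) where
  carrier : Type w
  [addCommGroup : AddCommGroup carrier]
  [moduleLeft : Module R carrier]
  [moduleRight : Module S carrier]
  [realModule : Module ℝ carrier]
  [towerLeft : IsScalarTower ℝ R carrier]
  [towerRight : IsScalarTower ℝ S carrier]
  [smulComm : SMulCommClass R S carrier]
  [finiteLeft : Module.Finite R carrier]
  [finiteRight : Module.Finite S carrier]
  [projectiveLeft : Module.Projective R carrier]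
  [projectiveRight : Module.Projective S carrier]
  [topology : TopologicalSpace carrier]
  [moduleTopologyLeft : IsModuleTopology R carrier]
  [moduleTopologyRight : IsModuleTopology S carrier]
  twist : carrier →ₗ[ℝ] carrier
  twist_left : ∀ (r : R) (q : carrier), twist (r • q) = gradeInv ℛ r • twist q
  twist_right : ∀ (s : S) (q : carrier), twist (s • q) = gradeInv 𝒮 s • twist q
  twist_twist : ∀ q, twist (twist q) = -q
  exists_left : ∀ h : carrier →ₗ[S] carrier, ∃ r : R, ∀ q, h q = r • q
  exists_right : ∀ h : carrier →ₗ[R] carrier, ∃ s : S, ∀ q, h q = s • q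
  faithful_left : ∀ r : R, (∀ q : carrier, r • q = 0) → r = 0
  faithful_right : ∀ s : S, (∀ q : carrier, s • q = 0) → s = 0

attribute [instance] Duality.addCommGroup Duality.moduleLeft Duality.moduleRight
  Duality.realModule Duality.towerLeft Duality.towerRight Duality.smulComm Duality.finiteLeft
  Duality.finiteRight Duality.projectiveLeft Duality.projectiveRight Duality.topology
  Duality.moduleTopologyLeft Duality.moduleTopologyRight

variable {ℛ : ZMod 2 → Submodule ℝ R} {𝒮 : ZMod 2 → Submodule ℝ S} [GradedAlgebra ℛ]
  [GradedAlgebra 𝒮]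

namespace Duality

/-- The duality in the opposite direction. -/
def symm (d : Duality ℛ 𝒮) : Duality 𝒮 ℛ where
  carrier := d.carrier
  smulComm := SMulCommClass.symm _ _ _
  -- With this sign the twists of the two directions compose to `(-τ) τ = 1`, so dualizing an
  -- operator twice gives it back and not its negative.
  twist := -d.twist
  twist_left s q := by simp [d.twist_right]
  twist_right s q := by simp [d.twist_left]
  twist_twist q := by simp [d.twist_twist]
  exists_left := d.exists_right
  exists_right := d.exists_left
  faithful_left := d.faithful_right
  faithful_right := d.faithful_left

theorem symm_symm (d : Duality ℛ 𝒮) : d.symm.symm = d := by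
  obtain ⟨⟩ := d
  simp only [symm]
  congr 1
  exact neg_neg _

/-- The dual `Hom_R(M, Q)` of an `R`-module, as an `S`-module. -/
def Dual (d : Duality ℛ 𝒮) (M : Type v) [AddCommGroup M] [Module R M] : Type (max v w) :=
  M →ₗ[R] d.carrier

variable (d : Duality ℛ 𝒮) (M : Type v) [AddCommGroup M] [Module R M]

instance : SMulCommClass R ℝ d.carrier :=
  haveI : SMulCommClass ℝ R d.carrier := IsScalarTower.to_smulCommClass
  SMulCommClass.symm _ _ _

instance : AddCommGroup (d.Dual M) := inferInstanceAs (AddCommGroup (M →ₗ[R] d.carrier))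

instance : Module S (d.Dual M) := inferInstanceAs (Module S (M →ₗ[R] d.carrier))

instance : Module ℝ (d.Dual M) := inferInstanceAs (Module ℝ (M →ₗ[R] d.carrier))

instance : IsScalarTower ℝ S (d.Dual M) :=
  inferInstanceAs (IsScalarTower ℝ S (M →ₗ[R] d.carrier))

instance : FunLike (d.Dual M) M d.carrier :=
  inferInstanceAs (FunLike (M →ₗ[R] d.carrier) M d.carrier)

instance : LinearMapClass (d.Dual M) R M d.carrier :=
  inferInstanceAs (LinearMapClass (M →ₗ[R] d.carrier) R M d.carrier)

instance : TopologicalSpace (d.Dual M) := moduleTopology S (d.Dual M)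

instance : IsModuleTopology S (d.Dual M) := ⟨rfl⟩

variable {M} {d}

@[ext] theorem Dual.ext {f g : d.Dual M} (h : ∀ m, f m = g m) : f = g := LinearMap.ext h

theorem Dual.add_apply (f g : d.Dual M) (m : M) : (f + g) m = f m + g m := rfl

theorem Dual.sum_apply {ι : Type*} (t : Finset ι) (f : ι → d.Dual M) (m : M) :
    (∑ i ∈ t, f i) m = ∑ i ∈ t, f i m := LinearMap.sum_apply t f m

variable (d)

/-- The elements `m ↦ f m • q` of the dual module, as an `S`-linear function of `q`. -/
def rankOne (f : M →ₗ[R] R) : d.carrier →ₗ[S] d.Dual M where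
  toFun q := LinearMap.toSpanSingleton R d.carrier q ∘ₗ f
  map_add' q q' := Dual.ext fun m => smul_add (f m) q q'
  map_smul' s q := Dual.ext fun m => smul_comm (f m) s q

/-- Evaluation at an element, as an `S`-linear map. -/
def evalAt (m : M) : d.Dual M →ₗ[S] d.carrier where
  toFun f := f m
  map_add' _ _ := rfl
  map_smul' _ _ := rfl

/-- Apply `g` to the expansion `m = ∑ f_i(m) x_i`. A homomorphism to `Q` is thus determined, with an
explicit formula, by its values on a dual basis; most arguments about the dual module reduce to this
identity. -/
theorem sum_rankOne {k : ℕ} {x : Fin k → M} {f : Fin k → M →ₗ[R] R}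
    (h : ∀ m, ∑ i, f i m • x i = m) (g : d.Dual M) : ∑ i, d.rankOne (f i) (g (x i)) = g := by
  ext m
  rw [Dual.sum_apply]
  conv_rhs => rw [← h m, map_sum]
  exact Finset.sum_congr rfl fun i _ => (map_smul g _ _).symm

variable [Module.Finite R M] [Module.Projective R M]

/-- Evaluation at a dual basis embeds the dual in a finite power of `Q`, and `sum_rankOne` is the
splitting. Finiteness and projectivity over `S` then pass from `Q` to the dual. -/
theorem exists_retract : ∃ (k : ℕ) (i : d.Dual M →ₗ[S] (Fin k → d.carrier))
    (p : (Fin k → d.carrier) →ₗ[S] d.Dual M), p ∘ₗ i = LinearMap.id := by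
  obtain ⟨k, x, f, h⟩ := exists_dualBasis R M
  refine ⟨k, LinearMap.pi fun i => d.evalAt (x i),
    ∑ i, d.rankOne (f i) ∘ₗ LinearMap.proj i, LinearMap.ext fun g => ?_⟩
  simp only [LinearMap.comp_apply, LinearMap.sum_apply]
  exact d.sum_rankOne h g

instance : Module.Finite S (d.Dual M) := by
  obtain ⟨k, i, p, h⟩ := d.exists_retract (M := M)
  exact Module.Finite.of_surjective p fun g => ⟨i g, LinearMap.congr_fun h g⟩

instance : Module.Projective S (d.Dual M) := by
  obtain ⟨k, i, p, h⟩ := d.exists_retract (M := M)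
  have : Module.Projective S (Fin k → d.carrier) :=
    Module.Projective.of_equiv (DFinsupp.linearEquivFunOnFintype (R := S) (M := fun _ : Fin k => d.carrier))
  exact Module.Projective.of_split i p h

/-- The canonical map to the double dual. -/
def doubleDual (M : Type v) [AddCommGroup M] [Module R M] : M →ₗ[R] d.symm.Dual (d.Dual M) where
  toFun m := d.evalAt m
  map_add' m m' := LinearMap.ext fun g => map_add (F := d.Dual M) g m m'
  map_smul' r m := LinearMap.ext fun g => map_smul (F := d.Dual M) g r m

/-- Reflexivity comes from a dual basis of `M` together with the two properties of `Q` on the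
`R`-side: faithfulness for injectivity, and the fact that every `S`-endomorphism is multiplication
by an element of `R` for surjectivity. -/
theorem doubleDual_bijective : Function.Bijective (d.doubleDual M) := by
  obtain ⟨k, x, f, h⟩ := exists_dualBasis R M
  constructor
  · rw [injective_iff_map_eq_zero]
    intro m hm
    rw [← h m]
    refine Finset.sum_eq_zero fun i _ => ?_
    rw [d.faithful_left (f i m) fun q => ?_, zero_smul]
    -- Testing `m` against the rank one functionals `f_i(·) q` shows that `f_i(m)` annihilates `Q`,
    -- hence vanishes.
    exact LinearMap.congr_fun hm (d.rankOne (f i) q)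
  · intro F
    -- Restricted to rank one functionals, `F` becomes an `S`-endomorphism of `Q`, that is,
    -- multiplication by some `r_i`; the preimage of `F` has these coefficients.
    choose r hr using fun i => d.exists_left ((F : d.Dual M →ₗ[S] d.carrier) ∘ₗ d.rankOne (f i))
    refine ⟨∑ i, r i • x i, LinearMap.ext fun g => ?_⟩
    change g (∑ i, r i • x i) = (F : d.Dual M →ₗ[S] d.carrier) g
    conv_rhs => rw [← d.sum_rankOne h g]
    rw [map_sum, map_sum]
    exact Finset.sum_congr rfl fun i _ => (map_smul g _ _).trans (hr i _).symm

end Duality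

end DualityDef

/-! ### Duality for triples: polarizations against gradings -/

section DualTriple

variable {R S : Type w} [Ring R] [Algebra ℝ R] [TopologicalSpace R] [IsTopologicalRing R]
  [ContinuousSMul ℝ R] [Ring S] [Algebra ℝ S] [TopologicalSpace S] [IsTopologicalRing S]
  [ContinuousSMul ℝ S] {ℛ : ZMod 2 → Submodule ℝ R} {𝒮 : ZMod 2 → Submodule ℝ S}
  [GradedAlgebra ℛ] [GradedAlgebra 𝒮]

namespace Duality

variable (d : Duality ℛ 𝒮)

/-- A map that is semilinear over a continuous ring homomorphism is continuous for module
topologies. -/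
theorem continuous_twist (hθ : Continuous (gradeInv ℛ)) : Continuous d.twist :=
  haveI : IsTopologicalAddGroup d.carrier := IsModuleTopology.topologicalAddGroup R _
  IsModuleTopology.continuous_of_linearMapₛₗ (R := R) (S := R) (σ := gradeInvHom ℛ) hθ
    { toFun := d.twist
      map_add' := map_add _
      map_smul' := d.twist_left }

variable {M : Type v} [AddCommGroup M] [Module R M] [Module ℝ M] [TopologicalSpace M]

/-- The dual operator `φ ↦ τ ∘ φ ∘ T` of a skew-linear operator. -/
def dualMap (T : M →L[ℝ] M) (hT : ∀ (r : R) (m : M), T (r • m) = gradeInv ℛ r • T m) :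
    d.Dual M →ₗ[ℝ] d.Dual M where
  toFun f :=
    { toFun := fun m => d.twist (f (T m))
      map_add' := fun m m' => by rw [map_add, map_add, map_add]
      -- The operators `T` and `τ` contribute one `θ` each, and `θ² = 1`, so the composite is
      -- honestly `R`-linear.
      map_smul' := fun r m => by
        rw [hT, map_smul, d.twist_left, gradeInv_gradeInv, RingHom.id_apply] }
  map_add' f g := Dual.ext fun m => map_add d.twist _ _
  map_smul' r f := Dual.ext fun m => map_smul d.twist r _

theorem dualMap_smul (T : M →L[ℝ] M) (hT : ∀ (r : R) (m : M), T (r • m) = gradeInv ℛ r • T m)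
    (s : S) (f : d.Dual M) : d.dualMap T hT (s • f) = gradeInv 𝒮 s • d.dualMap T hT f :=
  Dual.ext fun _ => d.twist_right s _

/-- The dual operator as a continuous map. -/
def dualCLM (hθ : Continuous (gradeInv 𝒮)) (T : M →L[ℝ] M)
    (hT : ∀ (r : R) (m : M), T (r • m) = gradeInv ℛ r • T m) : d.Dual M →L[ℝ] d.Dual M where
  __ := d.dualMap T hT
  cont := haveI : IsTopologicalAddGroup (d.Dual M) := IsModuleTopology.topologicalAddGroup S _
    IsModuleTopology.continuous_of_linearMapₛₗ (R := S) (S := S) (σ := gradeInvHom 𝒮) hθ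
    { toFun := d.dualMap T hT
      map_add' := map_add _
      map_smul' := d.dualMap_smul T hT }

theorem dualCLM_apply (hθ : Continuous (gradeInv 𝒮)) (T : M →L[ℝ] M)
    (hT : ∀ (r : R) (m : M), T (r • m) = gradeInv ℛ r • T m) (f : d.Dual M) (m : M) :
    d.dualCLM hθ T hT f m = d.twist (f (T m)) := rfl

/-- The dual operator squares to `τ² ∘ φ ∘ T² = -s φ`. This sign is what exchanges `Pol` and `Grad`.
-/
theorem dualCLM_mem (hθ : Continuous (gradeInv 𝒮)) {s s' : ℤˣ} (hs : s' = -s) {T : M →L[ℝ] M}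
    (hT : T ∈ skewRoots ℛ s M) :
    d.dualCLM hθ T ((mem_skewRoots ℛ).1 hT).1 ∈ skewRoots 𝒮 s' (d.Dual M) := by
  refine (mem_skewRoots 𝒮).2 ⟨d.dualMap_smul T ((mem_skewRoots ℛ).1 hT).1, fun f => Dual.ext fun m => ?_⟩
  rw [dualCLM_apply, dualCLM_apply, d.twist_twist, hT.2, hs]
  rcases Int.units_eq_one_or s with rfl | rfl
  · simp only [one_smul, Units.neg_smul]; rfl
  · simp only [neg_neg, one_smul, Units.neg_smul, map_neg]

/-- The dual triple. -/
def dual (hθ : Continuous (gradeInv 𝒮)) {s s' : ℤˣ} (hs : s' = -s)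
    (T : Triple.{w, max w v} ℛ s) : Triple.{w, max w v} 𝒮 s' where
  carrier := d.Dual T.carrier
  fst := d.dualCLM hθ T.fst ((mem_skewRoots ℛ).1 T.fst_mem).1
  snd := d.dualCLM hθ T.snd ((mem_skewRoots ℛ).1 T.snd_mem).1
  fst_mem := d.dualCLM_mem hθ hs T.fst_mem
  snd_mem := d.dualCLM_mem hθ hs T.snd_mem

variable (hR : Continuous (gradeInv ℛ)) (hS : Continuous (gradeInv 𝒮)) {s s' : ℤˣ} (hs : s' = -s)

-- It suffices to check continuity of the dual path pointwise. On a fixed `g` the dual operator is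
-- expanded in rank one functionals with coefficients `τ(g(γ_t(x_i)))`, which depend only on
-- finitely many values of `γ_t`.
include hR in
theorem dual_isElementary {T : Triple.{w, max w v} ℛ s} (h : T.IsElementary) :
    (d.dual hS hs T).IsElementary := by
  obtain ⟨γ, hγ⟩ := h
  have : IsTopologicalAddGroup (d.Dual T.carrier) := IsModuleTopology.topologicalAddGroup S _
  refine ⟨⟨⟨fun t => d.dualCLM hS (γ t) ((mem_skewRoots ℛ).1 (hγ t)).1, ?_⟩, ?_, ?_⟩,
    fun t => d.dualCLM_mem hS hs (hγ t)⟩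
  · refine continuous_of_pointwise_of_continuous_gradeInv hS (N := d.Dual T.carrier) _
      (fun t => d.dualMap_smul (γ t) ((mem_skewRoots ℛ).1 (hγ t)).1) fun g => ?_
    obtain ⟨k, x, f, h⟩ := exists_dualBasis R T.carrier
    have key : (fun t => d.dualCLM hS (γ t) ((mem_skewRoots ℛ).1 (hγ t)).1 g) =
        fun t => ∑ i, d.rankOne (f i) (d.twist (g (γ t (x i)))) := by
      funext t
      rw [← d.sum_rankOne h (d.dualCLM hS (γ t) _ g)]
      rfl
    rw [key]
    refine continuous_finsetSum _ fun i _ => ?_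
    have : IsTopologicalAddGroup d.carrier := IsModuleTopology.topologicalAddGroup S _
    have hg : Continuous g :=
      IsModuleTopology.continuous_of_linearMap (g : T.carrier →ₗ[R] d.carrier)
    have h1 : Continuous (d.rankOne (f i)) := IsModuleTopology.continuous_of_linearMap _
    have h2 : Continuous fun T' : T.carrier →L[ℝ] T.carrier => T' (x i) :=
      continuous_eval_const _
    exact h1.comp ((d.continuous_twist hR).comp (hg.comp (h2.comp γ.continuous)))
  · change d.dualCLM hS (γ 0) _ = d.dualCLM hS T.fst _
    congr 1
    exact γ.source
  · change d.dualCLM hS (γ 1) _ = d.dualCLM hS T.snd _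
    congr 1
    exact γ.target

/-- Dualizing is contravariant, so the isomorphism of duals is precomposition with `e⁻¹`. -/
theorem dual_iso {T T' : Triple.{w, max w v} ℛ s} (h : Triple.Iso T T') :
    Triple.Iso (d.dual hS hs T) (d.dual hS hs T') := by
  obtain ⟨e, h1, h2⟩ := h
  have hs1 : ∀ m, e.symm (T'.fst m) = T.fst (e.symm m) := fun m => by
    rw [LinearEquiv.symm_apply_eq, h1, LinearEquiv.apply_symm_apply]
  have hs2 : ∀ m, e.symm (T'.snd m) = T.snd (e.symm m) := fun m => by
    rw [LinearEquiv.symm_apply_eq, h2, LinearEquiv.apply_symm_apply]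
  refine ⟨LinearEquiv.ofLinearMap
    { toFun := fun f => (LinearMap.comp f e.symm.toLinearMap : T'.carrier →ₗ[R] d.carrier)
      map_add' := fun _ _ => rfl
      map_smul' := fun _ _ => rfl }
    { toFun := fun f => (LinearMap.comp f e.toLinearMap : T.carrier →ₗ[R] d.carrier)
      map_add' := fun _ _ => rfl
      map_smul' := fun _ _ => rfl } ?_ ?_, fun (f : d.Dual T.carrier) => ?_,
    fun (f : d.Dual T.carrier) => ?_⟩
  · exact LinearMap.ext fun f => Dual.ext fun m => congrArg (DFunLike.coe (F := d.Dual _) f) (e.apply_symm_apply m)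
  · exact LinearMap.ext fun f => Dual.ext fun m => congrArg (DFunLike.coe (F := d.Dual _) f) (e.symm_apply_apply m)
  · exact Dual.ext fun m => congrArg (fun x => d.twist (f x)) (hs1 m).symm
  · exact Dual.ext fun m => congrArg (fun x => d.twist (f x)) (hs2 m).symm

theorem dual_sum (T T' : Triple.{w, max w v} ℛ s) :
    Triple.Iso (d.dual hS hs (T.sum T')) ((d.dual hS hs T).sum (d.dual hS hs T')) := by
  refine ⟨LinearEquiv.ofLinearMap
    { toFun := fun f =>
        ((LinearMap.comp f (LinearMap.inl R _ _) : T.carrier →ₗ[R] d.carrier),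
          (LinearMap.comp f (LinearMap.inr R _ _) : T'.carrier →ₗ[R] d.carrier))
      map_add' := fun _ _ => rfl
      map_smul' := fun _ _ => rfl }
    { toFun := fun f => (LinearMap.coprod f.1 f.2 : T.carrier × T'.carrier →ₗ[R] d.carrier)
      map_add' := fun f g => Dual.ext fun m => add_add_add_comm _ _ _ _
      map_smul' := fun s f => Dual.ext fun m => (smul_add s _ _).symm } ?_ ?_,
      fun (f : d.Dual (T.carrier × T'.carrier)) => ?_,
      fun (f : d.Dual (T.carrier × T'.carrier)) => ?_⟩
  · refine LinearMap.ext fun (f : d.Dual T.carrier × d.Dual T'.carrier) => Prod.ext (Dual.ext fun m => ?_) (Dual.ext fun m => ?_)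
    · change f.1 m + f.2 0 = f.1 m
      rw [map_zero, add_zero]
    · change f.1 0 + f.2 m = f.2 m
      rw [map_zero, zero_add]
  · refine LinearMap.ext fun (f : d.Dual (T.carrier × T'.carrier)) => Dual.ext fun m => ?_
    change f (m.1, 0) + f (0, m.2) = f m
    rw [← map_add (F := d.Dual (T.carrier × T'.carrier)) f]
    exact congrArg (DFunLike.coe (F := d.Dual _) f) (Prod.ext (add_zero _) (zero_add _))
  · refine Prod.ext (Dual.ext fun m => ?_) (Dual.ext fun m => ?_)
    · change d.twist (f (T.fst m, T'.fst 0)) = d.twist (f (T.fst m, 0))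
      rw [map_zero]
    · change d.twist (f (T.fst 0, T'.fst m)) = d.twist (f (0, T'.fst m))
      rw [map_zero]
  · refine Prod.ext (Dual.ext fun m => ?_) (Dual.ext fun m => ?_)
    · change d.twist (f (T.snd m, T'.snd 0)) = d.twist (f (T.snd m, 0))
      rw [map_zero]
    · change d.twist (f (T.snd 0, T'.snd m)) = d.twist (f (0, T'.snd m))
      rw [map_zero]

/-- The evaluation isomorphism intertwines `T` with its double dual because the twist of the
opposite duality is `-τ`, and `-τ² = 1`. -/
theorem dual_dual (hs' : s = -s') (T : Triple.{w, max w v} ℛ s) :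
    Triple.Iso T (d.symm.dual hR hs' (d.dual hS hs T)) := by
  refine ⟨LinearEquiv.ofBijective (d.doubleDual T.carrier) d.doubleDual_bijective,
    fun m => Dual.ext fun (f : d.Dual T.carrier) => ?_, fun m => Dual.ext fun (f : d.Dual T.carrier) => ?_⟩
  · change f (T.fst m) = -d.twist (d.twist (f (T.fst m)))
    rw [d.twist_twist, neg_neg]
  · change f (T.snd m) = -d.twist (d.twist (f (T.snd m)))
    rw [d.twist_twist, neg_neg]

include hR in
theorem dual_rel {T T' : Triple.{w, max w v} ℛ s} (h : Triple.Rel T T') :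
    Triple.Rel (d.dual hS hs T) (d.dual hS hs T') := by
  obtain ⟨E, E', h1, h2, h⟩ := h
  exact ⟨d.dual hS hs E, d.dual hS hs E', d.dual_isElementary hR hS hs h1,
    d.dual_isElementary hR hS hs h2,
    (d.dual_sum hS hs T E).symm.trans ((d.dual_iso hS hs h).trans (d.dual_sum hS hs T' E'))⟩

/-- A duality induces an isomorphism of the groups of triples, which exchanges the two signs. -/
noncomputable def equiv (hs' : s = -s') :
    KGroup.{w, max w v} ℛ s ≃+ KGroup.{w, max w v} 𝒮 s' where
  toFun := Quotient.map (d.dual hS hs) fun _ _ h => d.dual_rel hR hS hs h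
  invFun := Quotient.map (d.symm.dual hR hs') fun _ _ h => d.symm.dual_rel hS hR hs' h
  left_inv := by
    rintro ⟨T⟩
    exact Quotient.sound (.of_iso (d.dual_dual hR hS hs hs' T).symm)
  right_inv := by
    rintro ⟨T⟩
    have h := d.symm.dual_dual hS hR hs' hs T
    rw [d.symm_symm] at h
    exact Quotient.sound (.of_iso h.symm)
  map_add' := by
    rintro ⟨T⟩ ⟨T'⟩
    exact Quotient.sound (.of_iso (d.dual_sum hS hs T T'))

end Duality

end DualTriple


/-! ### Compatibility of dualities with base change -/

section DualityBaseChange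

universe w'

variable {R S : Type w} [Ring R] [Algebra ℝ R] [TopologicalSpace R] [IsTopologicalRing R]
  [ContinuousSMul ℝ R] [Ring S] [Algebra ℝ S] [TopologicalSpace S] [IsTopologicalRing S]
  [ContinuousSMul ℝ S] {ℛ : ZMod 2 → Submodule ℝ R} {𝒮 : ZMod 2 → Submodule ℝ S}
  [GradedAlgebra ℛ] [GradedAlgebra 𝒮]
  {R' S' : Type w'} [Ring R'] [Algebra ℝ R'] [TopologicalSpace R'] [IsTopologicalRing R']
  [ContinuousSMul ℝ R'] [Ring S'] [Algebra ℝ S'] [TopologicalSpace S'] [IsTopologicalRing S']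
  [ContinuousSMul ℝ S'] {ℛ' : ZMod 2 → Submodule ℝ R'} {𝒮' : ZMod 2 → Submodule ℝ S'}
  [GradedAlgebra ℛ'] [GradedAlgebra 𝒮']

/-- A morphism of dualities along graded homomorphisms `F : R → R'` and `G : S → S'`: a map
`Q → Q'` that induces an isomorphism `S' ⊗_S Q → Q'`. -/
structure DualityHom (d : Duality ℛ 𝒮) (d' : Duality ℛ' 𝒮') (F : GradedHom ℛ ℛ')
    (G : GradedHom 𝒮 𝒮') where
  toMap : d.carrier →ₗ[ℝ] d'.carrier
  map_left : ∀ (r : R) (q : d.carrier), toMap (r • q) = F.toAlgHom r • toMap q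
  map_right : ∀ (s : S) (q : d.carrier), toMap (s • q) = G.toAlgHom s • toMap q
  map_twist : ∀ q, toMap (d.twist q) = d'.twist (toMap q)
  inv : d'.carrier →ₗ[S'] BaseChange G d.carrier
  inv_toMap : ∀ q, inv (toMap q) = BaseChange.unit G d.carrier q
  lift_inv : ∀ q, BaseChange.lift G toMap map_right (inv q) = q

namespace DualityHom

variable {d : Duality ℛ 𝒮} {d' : Duality ℛ' 𝒮'} {F : GradedHom ℛ ℛ'} {G : GradedHom 𝒮 𝒮'}
  (h : DualityHom d d' F G) (M : Type v) [AddCommGroup M] [Module R M] [Module ℝ M]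
  [IsScalarTower ℝ R M]

/-- The map `Hom_R(M, Q) → Hom_{R'}(R' ⊗_R M, Q')`. -/
noncomputable def dualMap : d.Dual M →ₗ[ℝ] d'.Dual (BaseChange F M) where
  toFun f := BaseChange.lift F (h.toMap ∘ₗ LinearMap.restrictScalars ℝ (f : M →ₗ[R] d.carrier))
    (fun r m => (congrArg h.toMap (map_smul f r m)).trans (h.map_left r (f m)))
  map_add' f g := BaseChange.hom_ext F fun m =>
    (congrArg (fun x => (1 : R') • x) (map_add h.toMap (f m) (g m))).trans (smul_add _ _ _)
  map_smul' c f := BaseChange.hom_ext F fun m =>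
    (congrArg (fun x => (1 : R') • x) (map_smul h.toMap c (f m))).trans (smul_comm _ _ _)

theorem dualMap_smul (s : S) (f : d.Dual M) :
    h.dualMap M (s • f) = G.toAlgHom s • h.dualMap M f :=
  BaseChange.hom_ext F fun m =>
    (congrArg (fun x => (1 : R') • x) (h.map_right s (f m))).trans (smul_comm _ _ _)

/-- The comparison map `S' ⊗_S Hom_R(M, Q) → Hom_{R'}(R' ⊗_R M, Q')`. -/
noncomputable def compare : BaseChange G (d.Dual M) →ₗ[S'] d'.Dual (BaseChange F M) :=
  BaseChange.lift G (h.dualMap M) (h.dualMap_smul M)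

/-- On rank one functionals the comparison map is just the identification `S' ⊗_S Q → Q'`,
multiplied by `F(f(m))`. Dual bases reduce everything about the comparison map to this case. -/
theorem compare_map_rankOne (f : M →ₗ[R] R) (y : BaseChange G d.carrier) (m : M) :
    h.compare M (BaseChange.map G (d.rankOne f) y) (BaseChange.unit F M m) =
      F.toAlgHom (f m) • BaseChange.lift G h.toMap h.map_right y := by
  induction y using BaseChange.induction G with
  | h s q =>
    rw [BaseChange.map_tmul, BaseChange.lift_tmul]
    change s • (1 : R') • h.toMap (f m • q) = _
    rw [one_smul, h.map_left]
    exact (smul_comm (F.toAlgHom (f m)) s (h.toMap q)).symm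
  | hadd x y hx hy =>
    rw [map_add, map_add, Duality.Dual.add_apply, hx, hy, map_add, smul_add]

/-- For `M = R` the claim is the assumed isomorphism `S' ⊗_S Q ≅ Q'`. A dual basis of `M` extends
its inverse: send `g` to the sum of the rank one pieces obtained from the values `g(1 ⊗ x_i)`. -/
theorem compare_bijective [Module.Finite R M] [Module.Projective R M] :
    Function.Bijective (h.compare M) := by
  obtain ⟨k, x, f, hx⟩ := exists_dualBasis R M
  let inv : d'.Dual (BaseChange F M) →ₗ[S'] BaseChange G (d.Dual M) :=
    ∑ i, BaseChange.map G (d.rankOne (f i)) ∘ₗ h.inv ∘ₗ d'.evalAt (BaseChange.unit F M (x i))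
  have hinv : ∀ g, inv g = ∑ i, BaseChange.map G (d.rankOne (f i))
      (h.inv (g (BaseChange.unit F M (x i)))) := fun g => LinearMap.sum_apply _ _ _
  have h1 : inv ∘ₗ h.compare M = LinearMap.id := BaseChange.hom_ext G fun g => by
    rw [LinearMap.comp_apply, hinv, LinearMap.id_apply]
    have e : ∀ i, h.compare M (BaseChange.unit G (d.Dual M) g) (BaseChange.unit F M (x i)) =
        h.toMap (g (x i)) := fun i =>
      (one_smul S' _).trans (one_smul R' _)
    simp only [e, h.inv_toMap]
    conv_rhs => rw [← d.sum_rankOne hx g, map_sum]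
    exact Finset.sum_congr rfl fun i _ => BaseChange.map_tmul G (d.rankOne (f i)) 1 (g (x i))
  have h2 : ∀ g, h.compare M (inv g) = g := fun g => BaseChange.hom_ext F fun m => by
    rw [hinv, map_sum]
    change (∑ i, h.compare M (BaseChange.map G (d.rankOne (f i)) _) : d'.Dual (BaseChange F M))
      (BaseChange.unit F M m) = g (BaseChange.unit F M m)
    rw [Duality.Dual.sum_apply]
    simp only [compare_map_rankOne, h.lift_inv]
    conv_rhs => rw [← hx m, map_sum, map_sum]
    exact Finset.sum_congr rfl fun i _ => by
      rw [BaseChange.unit_smul, map_smul]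
  exact Function.bijective_iff_has_inverse.2 ⟨inv, LinearMap.congr_fun h1, h2⟩

/-- On `s ⊗ f`, evaluated at `1 ⊗ m`, both sides give `θ(s)` times the image in `Q'` of `τ(f(T m))`,
since `Q → Q'` respects the twists. -/
theorem compare_skew [TopologicalSpace M] (hS : Continuous (gradeInv 𝒮))
    (hS' : Continuous (gradeInv 𝒮')) [IsModuleTopology ℝ S']
    [IsModuleTopology ℝ R'] (T : M →L[ℝ] M)
    (hT : ∀ (r : R) (m : M), T (r • m) = gradeInv ℛ r • T m) (x : BaseChange G (d.Dual M)) :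
    h.compare M (BaseChange.skewCLM G (d.dualCLM hS T hT) (d.dualMap_smul T hT) x) =
      d'.dualCLM hS' (BaseChange.skewCLM F T hT) (BaseChange.skewCLM_smul F T hT)
        (h.compare M x) := by
  induction x using BaseChange.induction G with
  | h s f =>
    refine BaseChange.hom_ext F fun m => ?_
    change gradeInv 𝒮' s • (1 : R') • h.toMap (d.twist (f (T m))) =
      d'.twist (s • gradeInv ℛ' (1 : R') • h.toMap (f (T m)))
    rw [gradeInv_even ℛ' SetLike.GradedOne.one_mem, d'.twist_right, h.map_twist, one_smul,
      one_smul]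
  | hadd x y hx hy => rw [map_add, map_add, hx, hy, map_add, map_add]

-- The comparison map is an isomorphism of modules that intertwines both operators; at the level of
-- classes this says that duality commutes with base change.
include h in
theorem dual_push [IsModuleTopology ℝ S'] [IsModuleTopology ℝ R'] {s s' : ℤˣ} (hs : s' = -s)
    (hS : Continuous (gradeInv 𝒮)) (hS' : Continuous (gradeInv 𝒮'))
    (T : Triple.{w, max w v} ℛ s) :
    Triple.Iso ((d.dual hS hs T).push G)
      (Duality.dual.{max w v, w'} d' hS' hs (T.push F)) :=
  ⟨LinearEquiv.ofBijective (h.compare T.carrier) (h.compare_bijective T.carrier),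
    h.compare_skew T.carrier hS hS' T.fst _, h.compare_skew T.carrier hS hS' T.snd _⟩

/-- The isomorphisms of groups given by dualities are compatible with base change. -/
theorem equiv_map [IsModuleTopology ℝ S'] [IsModuleTopology ℝ R'] {s s' : ℤˣ} (hs : s' = -s)
    (hs' : s = -s') (hR : Continuous (gradeInv ℛ)) (hS : Continuous (gradeInv 𝒮))
    (hR' : Continuous (gradeInv ℛ')) (hS' : Continuous (gradeInv 𝒮'))
    (h : DualityHom d d' F G) (x : KGroup.{w, max w v} ℛ s) :
    KGroup.map.{w, max w v, w'} s' G (d.equiv hR hS hs hs' x) =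
      Duality.equiv.{max w v, w'} d' hR' hS' hs hs' (KGroup.map.{w, max w v, w'} s F x) := by
  obtain ⟨T⟩ := x
  exact Quotient.sound (.of_iso (h.dual_push hs hS hS' T))

end DualityHom

end DualityBaseChange


/-! ### Dualities from full corners -/

/-- The module topology is the finest one compatible with the module structure, so it is enough that
the identity of `N` is continuous into it. It factors as `p ∘ i`, and the linear map `p` is
continuous into any such topology. Only continuity of `i` is needed, not linearity. It shows that
the subspace topology of `R p` is the module topology over both `R` and `S`. -/
theorem isModuleTopology_of_retract {R : Type*} [Ring R] [TopologicalSpace R] {M N : Type*}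
    [AddCommGroup M] [Module R M] [TopologicalSpace M] [IsModuleTopology R M]
    [AddCommGroup N] [Module R N] [TopologicalSpace N] [ContinuousAdd N] [ContinuousSMul R N]
    (i : N → M) (hi : Continuous i) (p : M →ₗ[R] N) (h : ∀ n, p (i n) = n) :
    IsModuleTopology R N := by
  refine IsModuleTopology.of_continuous_id ?_
  have hp : @Continuous M N _ (moduleTopology R N) p :=
    letI := moduleTopology R N
    haveI : ContinuousAdd N := ModuleTopology.continuousAdd R N
    haveI : ContinuousSMul R N := ModuleTopology.continuousSMul R N
    IsModuleTopology.continuous_of_linearMap p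
  have e : (id : N → N) = fun n => p (i n) := funext fun n => (h n).symm
  rw [e]
  exact @Continuous.comp N M N _ _ (moduleTopology R N) _ _ hp hi

section Corner

variable {R S : Type w} [Ring R] [Algebra ℝ R] [TopologicalSpace R] [Ring S] [Algebra ℝ S]
  [TopologicalSpace S]

/-- An identification of the opposite of `S` with a full corner `p R p` of `R`, for which the
grading of `S` is the grading of `R` twisted by an odd involution `u`. -/
structure Corner (ℛ : ZMod 2 → Submodule ℝ R) (𝒮 : ZMod 2 → Submodule ℝ S) [GradedAlgebra ℛ]
    [GradedAlgebra 𝒮] where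
  p : R
  u : R
  full : ∃ (k : ℕ) (x y : Fin k → R), ∑ i, x i * p * y i = 1
  p_mul_p : p * p = p
  u_mul_u : u * u = 1
  gradeInv_u : gradeInv ℛ u = -u
  gradeInv_p : gradeInv ℛ p = u * p * u
  incl : S →ₗ[ℝ] R
  incl_one : incl 1 = p
  incl_mul : ∀ s t, incl (s * t) = incl t * incl s
  incl_gradeInv : ∀ s, incl (gradeInv 𝒮 s) = u * gradeInv ℛ (incl s) * u
  continuous_incl : Continuous incl
  proj : R →ₗ[ℝ] S
  proj_incl : ∀ s, proj (incl s) = s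
  incl_proj : ∀ r, incl (proj (p * r * p)) = p * r * p
  continuous_proj : Continuous proj

namespace Corner

variable {ℛ : ZMod 2 → Submodule ℝ R} {𝒮 : ZMod 2 → Submodule ℝ S} [GradedAlgebra ℛ]
  [GradedAlgebra 𝒮] (c : Corner ℛ 𝒮)

theorem incl_mul_p (s : S) : c.incl s * c.p = c.incl s := by
  rw [← c.incl_one, ← c.incl_mul, one_mul]

theorem p_mul_incl (s : S) : c.p * c.incl s = c.incl s := by
  rw [← c.incl_one, ← c.incl_mul, mul_one]

/-- The left ideal `R p`. -/
def ideal : Submodule R R where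
  carrier := {q | q * c.p = q}
  add_mem' := fun {a b} ha hb => by
    rw [Set.mem_ofPred_eq] at *
    rw [add_mul, ha, hb]
  zero_mem' := zero_mul _
  smul_mem' := fun r q hq => by
    rw [Set.mem_ofPred_eq] at *
    rw [smul_eq_mul, mul_assoc, hq]

/-- The left ideal `R p` as a bimodule. -/
def Bimodule : Type w := c.ideal

instance : AddCommGroup c.Bimodule := inferInstanceAs (AddCommGroup c.ideal)

instance : Module R c.Bimodule := inferInstanceAs (Module R c.ideal)

noncomputable instance : Module ℝ c.Bimodule := inferInstanceAs (Module ℝ c.ideal)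

instance : IsScalarTower ℝ R c.Bimodule := inferInstanceAs (IsScalarTower ℝ R c.ideal)

instance : TopologicalSpace c.Bimodule := inferInstanceAs (TopologicalSpace c.ideal)

/-- The inclusion of the ideal in the algebra. -/
noncomputable def val : c.Bimodule →ₗ[R] R := c.ideal.subtype

theorem val_injective : Function.Injective c.val := Subtype.val_injective

theorem val_mul_p (q : c.Bimodule) : c.val q * c.p = c.val q := q.2

theorem continuous_val : Continuous c.val := continuous_subtype_val

theorem val_smul_left (r : R) (q : c.Bimodule) : c.val (r • q) = r * c.val q := rfl

theorem val_real_smul (a : ℝ) (q : c.Bimodule) : c.val (a • q) = a • c.val q := rfl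

/-- The projection `r ↦ r p`. -/
def mulP : R →ₗ[R] c.Bimodule where
  toFun r := ⟨r * c.p, by change _ * _ * _ = _ * _; rw [mul_assoc, c.p_mul_p]⟩
  map_add' r r' := Subtype.ext (add_mul _ _ _)
  map_smul' r r' := Subtype.ext (mul_assoc _ _ _)

theorem val_mulP (r : R) : c.val (c.mulP r) = r * c.p := rfl

theorem mulP_val (q : c.Bimodule) : c.mulP (c.val q) = q := c.val_injective (c.val_mul_p q)

noncomputable instance : SMul S c.Bimodule where
  smul s q := c.mulP (c.val q * c.incl s)

theorem val_smul (s : S) (q : c.Bimodule) : c.val (s • q) = c.val q * c.incl s := by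
  change c.val q * c.incl s * c.p = _
  rw [mul_assoc, c.incl_mul_p]

noncomputable instance : Module S c.Bimodule where
  one_smul q := c.val_injective (by rw [val_smul, c.incl_one, c.val_mul_p])
  mul_smul s t q := c.val_injective (by
    rw [val_smul, val_smul, val_smul, c.incl_mul, mul_assoc])
  smul_zero s := c.val_injective (by rw [val_smul, map_zero, zero_mul])
  smul_add s q q' := c.val_injective (by
    rw [val_smul, map_add, map_add, val_smul, val_smul, add_mul])
  add_smul s t q := c.val_injective (by
    rw [val_smul, map_add, map_add, val_smul, val_smul, mul_add])
  zero_smul q := c.val_injective (by rw [val_smul, map_zero, map_zero, mul_zero])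

instance : IsScalarTower ℝ S c.Bimodule where
  smul_assoc a s q := c.val_injective (by
    rw [val_smul, val_real_smul, val_smul, map_smul, mul_smul_comm])

instance : SMulCommClass R S c.Bimodule where
  smul_comm r s q := c.val_injective (by
    rw [val_smul_left, val_smul, val_smul, val_smul_left, mul_assoc])

instance : Module.Finite R c.Bimodule :=
  Module.Finite.of_surjective c.mulP fun q => ⟨c.val q, c.mulP_val q⟩

instance : Module.Projective R c.Bimodule :=
  Module.Projective.of_split c.val c.mulP (LinearMap.ext c.mulP_val)

/-- Since `q = q p`, the product `p r q` lies in `p R p`, where `proj` inverts `incl`. -/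
theorem val_mem (q : c.Bimodule) (r : R) :
    c.incl (c.proj (c.p * r * c.val q)) = c.p * r * c.val q := by
  have h := c.incl_proj (r * c.val q)
  rwa [mul_assoc, mul_assoc, c.val_mul_p, ← mul_assoc] at h

/-- The map `q ↦ p y q` to `S`. -/
noncomputable def coord (y : R) : c.Bimodule →ₗ[S] S where
  toFun q := c.proj (c.p * y * c.val q)
  map_add' q q' := by rw [map_add, mul_add, map_add]
  map_smul' s q := by
    have h := congrArg c.proj (c.incl_mul s (c.proj (c.p * y * c.val q)))
    rw [c.proj_incl, c.val_mem] at h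
    rw [c.val_smul, ← mul_assoc, ← h]
    rfl

theorem incl_coord (y : R) (q : c.Bimodule) : c.incl (c.coord y q) = c.p * y * c.val q :=
  c.val_mem q y

/-- Fullness `1 = ∑ x_i p y_i` gives `q = ∑ (x_i p)(p y_i q)` with `p y_i q` in the corner: the `x_i
p` and the coordinates `p y_i q` form a dual basis of `R p` over `S`. -/
theorem sum_coord {k : ℕ} {x y : Fin k → R} (h : ∑ i, x i * c.p * y i = 1) (q : c.Bimodule) :
    ∑ i, c.coord (y i) q • c.mulP (x i) = q := by
  refine c.val_injective ?_
  rw [map_sum]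
  simp only [val_smul, val_mulP, incl_coord]
  calc _ = ∑ i, x i * c.p * y i * c.val q := Finset.sum_congr rfl fun i _ => by
        rw [← mul_assoc, ← mul_assoc, mul_assoc (x i), c.p_mul_p]
    _ = c.val q := by rw [← Finset.sum_mul, h, one_mul]

/-- The last clause records a formula for the coordinates, which is what makes the retraction
continuous and identifies the topology of `R p` over `S`. -/
theorem exists_retract : ∃ (k : ℕ) (i : c.Bimodule →ₗ[S] (Fin k → S))
    (p : (Fin k → S) →ₗ[S] c.Bimodule), (∀ q, p (i q) = q) ∧
      ∀ j, ∃ y : R, ∀ q, i q j = c.proj (c.p * y * c.val q) := by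
  obtain ⟨k, x, y, h⟩ := c.full
  refine ⟨k, LinearMap.pi fun i => c.coord (y i),
    ∑ i, (LinearMap.toSpanSingleton S c.Bimodule (c.mulP (x i))) ∘ₗ LinearMap.proj i, fun q => ?_,
    fun j => ⟨y j, fun q => rfl⟩⟩
  rw [LinearMap.sum_apply]
  exact c.sum_coord h q

instance : Module.Finite S c.Bimodule := by
  obtain ⟨k, i, p, h, -⟩ := c.exists_retract
  exact Module.Finite.of_surjective p fun q => ⟨i q, h q⟩

instance : Module.Projective S c.Bimodule := by
  obtain ⟨k, i, p, h, -⟩ := c.exists_retract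
  exact Module.Projective.of_split i p (LinearMap.ext h)

/-- The operator `q ↦ θ(q) u`. -/
noncomputable def twist : c.Bimodule →ₗ[ℝ] c.Bimodule where
  toFun q := c.mulP (gradeInv ℛ (c.val q) * c.u)
  map_add' q q' := by rw [map_add, map_add, add_mul, map_add]
  map_smul' a q := by
    rw [val_real_smul, map_smul, smul_mul_assoc]
    exact c.val_injective (smul_mul_assoc _ _ _)

/-- From `θ(p) u = u p` one gets `θ(q) u = θ(q p) u = θ(q) u p`. So `θ(q) u` is already in `R p`,
and the projection used to define the operator changes nothing. -/
theorem val_twist (q : c.Bimodule) : c.val (c.twist q) = gradeInv ℛ (c.val q) * c.u := by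
  change gradeInv ℛ (c.val q) * c.u * c.p = _
  conv_rhs => rw [← c.val_mul_p q, gradeInv_mul, c.gradeInv_p]
  conv_lhs => rw [← c.val_mul_p q, gradeInv_mul, c.gradeInv_p]
  simp only [mul_assoc, c.u_mul_u, mul_one, c.p_mul_p]

variable [IsTopologicalRing R] [IsTopologicalRing S]

instance : ContinuousAdd c.Bimodule := inferInstanceAs (ContinuousAdd c.ideal)

instance : ContinuousSMul R c.Bimodule := inferInstanceAs (ContinuousSMul R c.ideal)

instance : ContinuousSMul S c.Bimodule where
  continuous_smul := by
    refine Continuous.subtype_mk (?_ : Continuous fun x : S × c.Bimodule =>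
      c.val x.2 * c.incl x.1 * c.p) _
    exact ((c.continuous_val.comp continuous_snd).mul
      (c.continuous_incl.comp continuous_fst)).mul continuous_const

instance : IsModuleTopology R c.Bimodule :=
  isModuleTopology_of_retract c.val c.continuous_val c.mulP c.mulP_val

instance : IsModuleTopology S c.Bimodule := by
  obtain ⟨k, i, p, h, h'⟩ := c.exists_retract
  refine isModuleTopology_of_retract i (continuous_pi fun j => ?_) p h
  obtain ⟨y, hy⟩ := h' j
  simp only [hy]
  exact c.continuous_proj.comp (continuous_const.mul c.continuous_val)

/-- The duality given by the bimodule `R p`. -/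
noncomputable def duality : Duality ℛ 𝒮 where
  carrier := c.Bimodule
  twist := c.twist
  twist_left r q := c.val_injective (by
    rw [val_twist, val_smul_left, val_smul_left, val_twist, gradeInv_mul, mul_assoc])
  twist_right s q := c.val_injective (by
    rw [val_twist, val_smul, val_smul, val_twist, gradeInv_mul, c.incl_gradeInv, ← mul_assoc,
      ← mul_assoc, mul_assoc _ c.u c.u, c.u_mul_u, mul_one])
  -- Applying the twist twice gives `q θ(u) u = -q u²`; the sign comes from `u` being odd.
  twist_twist q := c.val_injective (by
    rw [val_twist, val_twist, gradeInv_mul, gradeInv_gradeInv, c.gradeInv_u, map_neg, mul_neg,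
      neg_mul, mul_assoc, c.u_mul_u, mul_one])
  exists_left h := by
    obtain ⟨k, x, y, hxy⟩ := c.full
    -- Writing `q = ∑ (x_i p)(p y_i q)` and using that `h` is `S`-linear, `h(q) = ∑ h(x_i p) y_i q`.
    refine ⟨∑ i, c.val (h (c.mulP (x i))) * y i, fun q => c.val_injective ?_⟩
    conv_lhs => rw [← c.sum_coord hxy q, map_sum, map_sum]
    rw [map_smul, smul_eq_mul, Finset.sum_mul]
    refine Finset.sum_congr rfl fun i _ => ?_
    rw [map_smul, val_smul, incl_coord, ← mul_assoc, ← mul_assoc, val_mul_p]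
  exists_right h := by
    -- Here `h(q) = h(q p) = q h(p)`, and `h(p) = p h(p)` is an element of the corner, hence comes
    -- from `S`.
    refine ⟨c.coord 1 (h (c.mulP 1)), fun q => c.val_injective ?_⟩
    have h1 : c.p • h (c.mulP 1) = h (c.mulP 1) := by
      rw [← map_smul]
      refine congrArg h (c.val_injective ?_)
      rw [map_smul, val_mulP, one_mul, smul_eq_mul, c.p_mul_p]
    have h2 : q = c.val q • c.mulP 1 := c.val_injective (by
      rw [map_smul, val_mulP, one_mul, smul_eq_mul, c.val_mul_p])
    conv_lhs => rw [h2, map_smul, ← h1]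
    rw [val_smul, incl_coord, mul_one, map_smul, map_smul, smul_eq_mul, smul_eq_mul]
  faithful_left r hr := by
    obtain ⟨k, x, y, hxy⟩ := c.full
    rw [← mul_one r, ← hxy, Finset.mul_sum]
    refine Finset.sum_eq_zero fun i _ => ?_
    have h := congrArg c.val (hr (c.mulP (x i)))
    rw [map_smul, val_mulP, map_zero, smul_eq_mul] at h
    rw [← mul_assoc, h, zero_mul]
  faithful_right s hs := by
    have h := congrArg c.val (hs (c.mulP 1))
    rw [val_smul, val_mulP, one_mul, map_zero, c.p_mul_incl] at h
    rw [← c.proj_incl s, h, map_zero]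

end Corner

end Corner

/-! ### Naturality of the dualities given by corners -/

section CornerHom

universe w'

variable {R S : Type w} [Ring R] [Algebra ℝ R] [TopologicalSpace R] [IsTopologicalRing R]
  [ContinuousSMul ℝ R] [Ring S] [Algebra ℝ S] [TopologicalSpace S] [IsTopologicalRing S]
  [ContinuousSMul ℝ S] {ℛ : ZMod 2 → Submodule ℝ R} {𝒮 : ZMod 2 → Submodule ℝ S}
  [GradedAlgebra ℛ] [GradedAlgebra 𝒮]
  {R' S' : Type w'} [Ring R'] [Algebra ℝ R'] [TopologicalSpace R'] [IsTopologicalRing R']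
  [ContinuousSMul ℝ R'] [Ring S'] [Algebra ℝ S'] [TopologicalSpace S'] [IsTopologicalRing S']
  [ContinuousSMul ℝ S'] {ℛ' : ZMod 2 → Submodule ℝ R'} {𝒮' : ZMod 2 → Submodule ℝ S'}
  [GradedAlgebra ℛ'] [GradedAlgebra 𝒮']

namespace Corner

/-- A pair of graded homomorphisms compatible with corners induces a morphism of dualities. -/
theorem nonempty_dualityHom (c : Corner ℛ 𝒮) (c' : Corner ℛ' 𝒮') (F : GradedHom ℛ ℛ')
    (G : GradedHom 𝒮 𝒮') (hp : F.toAlgHom c.p = c'.p) (hu : F.toAlgHom c.u = c'.u)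
    (h : ∀ s, F.toAlgHom (c.incl s) = c'.incl (G.toAlgHom s)) :
    Nonempty (DualityHom c.duality c'.duality F G) := by
  let f : c.Bimodule →ₗ[ℝ] c'.Bimodule :=
    { toFun := fun q => c'.mulP (F.toAlgHom (c.val q))
      map_add' := fun q q' => by rw [map_add, map_add, map_add]
      map_smul' := fun a q => by
        rw [val_real_smul, map_smul]
        exact c'.val_injective (smul_mul_assoc _ _ _) }
  have hf : ∀ q, c'.val (f q) = F.toAlgHom (c.val q) := fun q => by
    change F.toAlgHom (c.val q) * c'.p = _
    rw [← hp, ← map_mul, c.val_mul_p]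
  have hright : ∀ (s : S) (q : c.Bimodule), f (s • q) = G.toAlgHom s • f q :=
    fun s q => c'.val_injective (by
      rw [hf, val_smul, map_mul, val_smul, hf, h])
  obtain ⟨k, x, y, hxy⟩ := c.full
  have hxy' : ∑ i, F.toAlgHom (x i) * c'.p * F.toAlgHom (y i) = 1 := by
    rw [← hp, ← map_one F.toAlgHom, ← hxy, map_sum]
    simp only [map_mul]
  have hx : ∀ i, f (c.mulP (x i)) = c'.mulP (F.toAlgHom (x i)) := fun i =>
    c'.val_injective (by rw [hf, val_mulP, val_mulP, map_mul, hp])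
  have hleft : ∀ (r : R) (q : c.Bimodule), f (r • q) = F.toAlgHom r • f q :=
    fun r q => c'.val_injective (by
      rw [hf, val_smul_left, val_smul_left, hf, map_mul])
  have htwist : ∀ q : c.Bimodule, f (c.twist q) = c'.twist (f q) :=
    fun q => c'.val_injective (by
      rw [hf, val_twist, val_twist, hf, map_mul, hu, F.map_gradeInv])
  -- A decomposition `1 = ∑ x_i p y_i` in `R` is mapped by `F` to one in `R'`. The inverse therefore
  -- uses the coordinates in `S'` attached to `F(y_i)` and the elements `1 ⊗ x_i p`.
  let inv : c'.Bimodule →ₗ[S'] BaseChange G c.Bimodule :=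
    ∑ i, (LinearMap.toSpanSingleton S' _ (BaseChange.unit G c.Bimodule (c.mulP (x i)))) ∘ₗ
      c'.coord (F.toAlgHom (y i))
  have hinv : ∀ q, inv q = ∑ i, c'.coord (F.toAlgHom (y i)) q •
      BaseChange.unit G c.Bimodule (c.mulP (x i)) := fun q => LinearMap.sum_apply _ _ _
  have h1 : ∀ q : c.Bimodule, inv (f q) = BaseChange.unit G c.Bimodule q := fun q => by
    rw [hinv]
    conv_rhs => rw [← c.sum_coord hxy q, map_sum]
    refine Finset.sum_congr rfl fun i _ => ?_
    have hcoord : c'.coord (F.toAlgHom (y i)) (f q) = G.toAlgHom (c.coord (y i) q) := by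
      rw [← c'.proj_incl (G.toAlgHom _), ← h, incl_coord, map_mul F.toAlgHom,
        map_mul F.toAlgHom, hp, ← hf]
      rfl
    rw [BaseChange.unit_smul, hcoord]
  have h2 : ∀ q : c'.Bimodule, BaseChange.lift G f hright (inv q) = q := fun q => by
    rw [hinv, map_sum]
    refine Eq.trans (Finset.sum_congr rfl fun i _ => ?_) (c'.sum_coord hxy' q)
    rw [map_smul, ← hx]
    exact congrArg _ (one_smul S' _)
  exact ⟨⟨f, hleft, hright, htwist, inv, h1, h2⟩⟩

/-- The isomorphism of groups of triples given by a corner. -/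
noncomputable def equiv (c : Corner ℛ 𝒮) (hR : Continuous (gradeInv ℛ))
    (hS : Continuous (gradeInv 𝒮)) {s s' : ℤˣ} (hs : s' = -s) (hs' : s = -s') :
    KGroup.{w, max w v} ℛ s ≃+ KGroup.{w, max w v} 𝒮 s' :=
  c.duality.equiv hR hS hs hs'

/-- The kernels of base change along compatible homomorphisms correspond under the isomorphisms
given by corners. -/
theorem nonempty_ker_equiv (c : Corner ℛ 𝒮) (c' : Corner ℛ' 𝒮') (F : GradedHom ℛ ℛ')
    (G : GradedHom 𝒮 𝒮') (hp : F.toAlgHom c.p = c'.p) (hu : F.toAlgHom c.u = c'.u)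
    (h : ∀ s, F.toAlgHom (c.incl s) = c'.incl (G.toAlgHom s))
    [IsModuleTopology ℝ S'] [IsModuleTopology ℝ R'] (hR : Continuous (gradeInv ℛ))
    (hS : Continuous (gradeInv 𝒮)) {s s' : ℤˣ} (hs : s' = -s) (hs' : s = -s') :
    Nonempty ((KGroup.map.{w, max w v, w'} s F).ker ≃+ (KGroup.map.{w, max w v, w'} s' G).ker) := by
  obtain ⟨d⟩ := nonempty_dualityHom c c' F G hp hu h
  have hR' : Continuous (gradeInv ℛ') := continuous_gradeInv ℛ'
  have hS' : Continuous (gradeInv 𝒮') := continuous_gradeInv 𝒮'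
  have key := DualityHom.equiv_map.{v} hs hs' hR hS hR' hS' d
  refine ⟨(c.duality.equiv hR hS hs hs').addSubgroupMap _ |>.trans
    (AddEquiv.addSubgroupCongr (AddSubgroup.ext fun x => ?_))⟩
  obtain ⟨x, rfl⟩ := (Duality.equiv.{v} c.duality hR hS hs hs').surjective x
  rw [AddMonoidHom.mem_ker, key, AddEquiv.map_eq_zero_iff, AddSubgroup.mem_map]
  constructor
  · rintro ⟨y, hy, hyx⟩
    rw [← (Duality.equiv.{v} c.duality hR hS hs hs').injective hyx]
    exact hy
  · exact fun hx => ⟨x, hx, rfl⟩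

end Corner

end CornerHom


/-! ### Even and odd parts -/

section Parts

variable {A : Type u} [AddCommGroup A] [Module ℝ A] (𝒜 : ZMod 2 → Submodule ℝ A)
  [DirectSum.Decomposition 𝒜]

/-- The even part of an element. -/
noncomputable def evenPart : A →ₗ[ℝ] A := (2⁻¹ : ℝ) • (LinearMap.id + gradeInv 𝒜)

/-- The odd part of an element. -/
noncomputable def oddPart : A →ₗ[ℝ] A := (2⁻¹ : ℝ) • (LinearMap.id - gradeInv 𝒜)

theorem evenPart_apply (a : A) : evenPart 𝒜 a = (2⁻¹ : ℝ) • (a + gradeInv 𝒜 a) := rfl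

theorem oddPart_apply (a : A) : oddPart 𝒜 a = (2⁻¹ : ℝ) • (a - gradeInv 𝒜 a) := rfl

theorem evenPart_even {a : A} (ha : a ∈ 𝒜 0) : evenPart 𝒜 a = a := by
  rw [evenPart_apply, gradeInv_even 𝒜 ha]
  module

theorem evenPart_odd {a : A} (ha : a ∈ 𝒜 1) : evenPart 𝒜 a = 0 := by
  rw [evenPart_apply, gradeInv_odd 𝒜 ha]
  module

theorem oddPart_even {a : A} (ha : a ∈ 𝒜 0) : oddPart 𝒜 a = 0 := by
  rw [oddPart_apply, gradeInv_even 𝒜 ha]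
  module

theorem oddPart_odd {a : A} (ha : a ∈ 𝒜 1) : oddPart 𝒜 a = a := by
  rw [oddPart_apply, gradeInv_odd 𝒜 ha]
  module

theorem evenPart_add_oddPart (a : A) : evenPart 𝒜 a + oddPart 𝒜 a = a := by
  rw [evenPart_apply, oddPart_apply]
  module

theorem evenPart_mem (a : A) : evenPart 𝒜 a ∈ 𝒜 0 := by
  rw [mem_even_iff, evenPart_apply, map_smul, map_add, gradeInv_gradeInv, add_comm]

theorem oddPart_mem (a : A) : oddPart 𝒜 a ∈ 𝒜 1 := by
  rw [mem_odd_iff, oddPart_apply, map_smul, map_sub, gradeInv_gradeInv, ← smul_neg, neg_sub]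

theorem gradeInv_evenPart (a : A) : gradeInv 𝒜 (evenPart 𝒜 a) = evenPart 𝒜 a :=
  gradeInv_even 𝒜 (evenPart_mem 𝒜 a)

theorem gradeInv_oddPart (a : A) : gradeInv 𝒜 (oddPart 𝒜 a) = -oddPart 𝒜 a :=
  gradeInv_odd 𝒜 (oddPart_mem 𝒜 a)

theorem continuous_evenPart [TopologicalSpace A] [ContinuousAdd A] [ContinuousSMul ℝ A]
    (h : Continuous (gradeInv 𝒜)) : Continuous (evenPart 𝒜) :=
  (continuous_id.add h).const_smul (2⁻¹ : ℝ)

theorem continuous_oddPart [TopologicalSpace A] [IsTopologicalAddGroup A] [ContinuousSMul ℝ A]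
    (h : Continuous (gradeInv 𝒜)) : Continuous (oddPart 𝒜) :=
  (continuous_id.sub h).const_smul (2⁻¹ : ℝ)

end Parts

/-! ### Topology of graded tensor products with a finite-dimensional factor -/

section TensorTopology

variable {A : Type u} {B : Type v} [Ring A] [Algebra ℝ A] [Ring B] [Algebra ℝ B]
  (𝒜 : ZMod 2 → Submodule ℝ A) (ℬ : ZMod 2 → Submodule ℝ B) [GradedAlgebra 𝒜] [GradedAlgebra ℬ]

/-- The product `a ⊗ b` as a bilinear map. -/
noncomputable def tmulBilin : A →ₗ[ℝ] B →ₗ[ℝ] 𝒜 ᵍ⊗[ℝ] ℬ :=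
  (TensorProduct.mk ℝ A B).compr₂ (GradedTensorProduct.of ℝ 𝒜 ℬ).toLinearMap

theorem tmul_eq_tmulBilin (a : A) (b : B) :
    (GradedTensorProduct.tmul ℝ a b : 𝒜 ᵍ⊗[ℝ] ℬ) = tmulBilin 𝒜 ℬ a b := rfl

-- The sign rule is written without homogeneity assumptions: it splits according to the parity of
-- `b`, and the odd part of `b` acts on `a'` through `θ`. In this form the product is visibly built
-- from linear maps, which makes its continuity accessible.
open GradedTensorProduct in
theorem tmul_mul_tmul_left (a a' : A) (b b' : B) :
    (tmul ℝ a b * tmul ℝ a' b' : 𝒜 ᵍ⊗[ℝ] ℬ) =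
      tmul ℝ (a * a') (evenPart ℬ b * b') + tmul ℝ (a * gradeInv 𝒜 a') (oddPart ℬ b * b') := by
  induction a' using grade_induction 𝒜 with
  | h0 a' ha =>
    induction b using grade_induction ℬ with
    | h0 b hb =>
      rw [evenPart_even ℬ hb, oddPart_even ℬ hb, zero_mul, tmul_eq_tmulBilin _ _ _ 0, map_zero,
        add_zero]
      exact tmul_zero_coe_mul_coe_tmul 𝒜 ℬ a ⟨b, hb⟩ ⟨a', ha⟩ b'
    | h1 b hb =>
      rw [evenPart_odd ℬ hb, oddPart_odd ℬ hb, zero_mul, tmul_eq_tmulBilin _ _ _ 0, map_zero,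
        zero_add, gradeInv_even 𝒜 ha]
      exact tmul_coe_mul_zero_coe_tmul 𝒜 ℬ a ⟨b, hb⟩ ⟨a', ha⟩ b'
    | hadd b c hb hc =>
      simp only [tmul_eq_tmulBilin, map_add, add_mul] at hb hc ⊢
      rw [hb, hc]
      abel
  | h1 a' ha =>
    induction b using grade_induction ℬ with
    | h0 b hb =>
      rw [evenPart_even ℬ hb, oddPart_even ℬ hb, zero_mul, tmul_eq_tmulBilin _ _ _ 0, map_zero,
        add_zero]
      exact tmul_zero_coe_mul_coe_tmul 𝒜 ℬ a ⟨b, hb⟩ ⟨a', ha⟩ b'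
    | h1 b hb =>
      rw [evenPart_odd ℬ hb, oddPart_odd ℬ hb, zero_mul, tmul_eq_tmulBilin _ _ _ 0, map_zero,
        zero_add, gradeInv_odd 𝒜 ha]
      refine (tmul_coe_mul_coe_tmul (R := ℝ) 𝒜 ℬ a ⟨b, hb⟩ ⟨a', ha⟩ b').trans ?_
      rw [mul_one, uzpow_one, Units.neg_smul, one_smul, mul_neg, tmul_eq_tmulBilin,
        tmul_eq_tmulBilin, map_neg]
      rfl
    | hadd b c hb hc =>
      simp only [tmul_eq_tmulBilin, map_add, add_mul] at hb hc ⊢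
      rw [hb, hc]
      abel
  | hadd x y hx hy =>
    simp only [tmul_eq_tmulBilin, map_add, mul_add, LinearMap.add_apply] at hx hy ⊢
    rw [hx, hy]
    abel

-- The sign is symmetric in the two inner factors, so the parity projections can be moved to `a'`.
-- This form serves when `A` is the finite-dimensional factor.
open GradedTensorProduct in
theorem tmul_mul_tmul_right (a a' : A) (b b' : B) :
    (tmul ℝ a b * tmul ℝ a' b' : 𝒜 ᵍ⊗[ℝ] ℬ) =
      tmul ℝ (a * evenPart 𝒜 a') (b * b') + tmul ℝ (a * oddPart 𝒜 a') (gradeInv ℬ b * b') := by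
  rw [tmul_mul_tmul_left]
  conv_lhs => rw [← evenPart_add_oddPart 𝒜 a']
  conv_rhs => rw [← evenPart_add_oddPart ℬ b]
  rw [map_add, map_add, gradeInv_evenPart, gradeInv_oddPart, gradeInv_evenPart, gradeInv_oddPart]
  simp only [tmul_eq_tmulBilin, map_add, mul_add, add_mul, mul_neg, neg_mul, map_neg,
    LinearMap.add_apply, LinearMap.neg_apply]
  abel

variable [TopologicalSpace A] [TopologicalSpace B] [IsTopologicalRing A] [IsTopologicalRing B]
  [ContinuousSMul ℝ A] [ContinuousSMul ℝ B]

theorem continuous_gradeInv_tensor (hA : Continuous (gradeInv 𝒜)) (hB : Continuous (gradeInv ℬ)) :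
    Continuous (gradeInv (tensorGrading 𝒜 ℬ)) := by
  refine tensor_continuous_iff _ ?_
  simp only [gradeInv_tmul]
  exact (continuous_tmul 𝒜 ℬ).comp (hA.prodMap hB)

/-- Negation is multiplication by the real scalar `-1`. -/
theorem isTopologicalRing_of_continuousMul_of_real (R : Type*) [Ring R] [Algebra ℝ R]
    [TopologicalSpace R] [ContinuousAdd R] [ContinuousMul R] [ContinuousSMul ℝ R] :
    IsTopologicalRing R where
  continuous_neg := by
    have h : (fun x : R => -x) = fun x => (-1 : ℝ) • x := by
      funext x
      rw [neg_smul, one_smul]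
    rw [h]
    exact continuous_const_smul _

/-- A basis `β_i` of `B` gives continuous coordinates in `A`. The product of `∑ a_i ⊗ β_i` and `∑
a'_j ⊗ β_j` is then a finite sum of terms in `a_i a'_j` and `a_i θ(a'_j)` with constant second
factors. -/
theorem isTopologicalRing_tensor_right [IsModuleTopology ℝ B] [Module.Finite ℝ B]
    (hA : Continuous (gradeInv 𝒜)) : IsTopologicalRing (𝒜 ᵍ⊗[ℝ] ℬ) := by
  let β := Module.finBasis ℝ B
  let c : ∀ i, 𝒜 ᵍ⊗[ℝ] ℬ →ₗ[ℝ] A := fun i =>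
    TensorProduct.lift (((LinearMap.lsmul ℝ A).flip).compl₂ (β.coord i)) ∘ₗ
      (GradedTensorProduct.of ℝ 𝒜 ℬ).symm.toLinearMap
  have hc : ∀ i a b, c i (GradedTensorProduct.tmul ℝ a b) = β.coord i b • a := fun _ _ _ => rfl
  have hcont : ∀ i, Continuous (c i) := fun i => by
    refine tensor_continuous_iff _ ?_
    simp only [hc]
    exact ((IsModuleTopology.continuous_of_linearMap (β.coord i)).comp continuous_snd).smul
      continuous_fst
  have hx : ∀ x, ∑ i, tmulBilin 𝒜 ℬ (c i x) (β i) = x := fun x => by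
    induction x using tensor_induction 𝒜 ℬ with
    | h j k a ha b hb =>
      simp only [hc, map_smul, LinearMap.smul_apply]
      simp only [← map_smul, ← map_sum]
      rw [tmul_eq_tmulBilin]
      exact congrArg _ (β.sum_repr b)
    | h0 => simp
    | hadd x y hx hy =>
      simp only [map_add, LinearMap.add_apply, Finset.sum_add_distrib]
      rw [hx, hy]
  have hmul : ContinuousMul (𝒜 ᵍ⊗[ℝ] ℬ) := by
    refine ⟨?_⟩
    have e : (fun p : 𝒜 ᵍ⊗[ℝ] ℬ × 𝒜 ᵍ⊗[ℝ] ℬ => p.1 * p.2) = fun p => ∑ i, ∑ j,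
        ((GradedTensorProduct.tmul ℝ (c i p.1 * c j p.2) (evenPart ℬ (β i) * β j) : 𝒜 ᵍ⊗[ℝ] ℬ) +
        GradedTensorProduct.tmul ℝ (c i p.1 * gradeInv 𝒜 (c j p.2)) (oddPart ℬ (β i) * β j)) := by
      funext p
      conv_lhs => rw [← hx p.1, ← hx p.2, Finset.sum_mul_sum]
      simp only [← tmul_mul_tmul_left]
      rfl
    rw [e]
    refine continuous_finsetSum _ fun i _ => continuous_finsetSum _ fun j _ => ?_
    have h1 : Continuous fun p : 𝒜 ᵍ⊗[ℝ] ℬ × 𝒜 ᵍ⊗[ℝ] ℬ => c i p.1 := (hcont i).comp continuous_fst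
    have h2 : Continuous fun p : 𝒜 ᵍ⊗[ℝ] ℬ × 𝒜 ᵍ⊗[ℝ] ℬ => c j p.2 := (hcont j).comp continuous_snd
    exact ((continuous_tmul 𝒜 ℬ).comp ((h1.mul h2).prodMk continuous_const)).add
      ((continuous_tmul 𝒜 ℬ).comp ((h1.mul (hA.comp h2)).prodMk continuous_const))
  exact isTopologicalRing_of_continuousMul_of_real _

/-- Now the basis is one of `A`, so the product formula with parity projections on the first factor
is the one that leaves only constants there. -/
theorem isTopologicalRing_tensor_left [IsModuleTopology ℝ A] [Module.Finite ℝ A]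
    (hB : Continuous (gradeInv ℬ)) : IsTopologicalRing (𝒜 ᵍ⊗[ℝ] ℬ) := by
  let α := Module.finBasis ℝ A
  let c : ∀ i, 𝒜 ᵍ⊗[ℝ] ℬ →ₗ[ℝ] B := fun i =>
    TensorProduct.lift ((LinearMap.lsmul ℝ B) ∘ₗ (α.coord i)) ∘ₗ
      (GradedTensorProduct.of ℝ 𝒜 ℬ).symm.toLinearMap
  have hc : ∀ i a b, c i (GradedTensorProduct.tmul ℝ a b) = α.coord i a • b := fun _ _ _ => rfl
  have hcont : ∀ i, Continuous (c i) := fun i => by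
    refine tensor_continuous_iff _ ?_
    simp only [hc]
    exact ((IsModuleTopology.continuous_of_linearMap (α.coord i)).comp continuous_fst).smul
      continuous_snd
  have hx : ∀ x, ∑ i, tmulBilin 𝒜 ℬ (α i) (c i x) = x := fun x => by
    induction x using tensor_induction 𝒜 ℬ with
    | h j k a ha b hb =>
      simp only [hc, map_smul]
      rw [tmul_eq_tmulBilin]
      conv_rhs => rw [← α.sum_repr a, map_sum, LinearMap.sum_apply]
      simp only [map_smul, LinearMap.smul_apply]
      rfl
    | h0 => simp
    | hadd x y hx hy =>
      simp only [map_add, Finset.sum_add_distrib]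
      rw [hx, hy]
  have hmul : ContinuousMul (𝒜 ᵍ⊗[ℝ] ℬ) := by
    refine ⟨?_⟩
    have e : (fun p : 𝒜 ᵍ⊗[ℝ] ℬ × 𝒜 ᵍ⊗[ℝ] ℬ => p.1 * p.2) = fun p => ∑ i, ∑ j,
        ((GradedTensorProduct.tmul ℝ (α i * evenPart 𝒜 (α j)) (c i p.1 * c j p.2) : 𝒜 ᵍ⊗[ℝ] ℬ) +
        GradedTensorProduct.tmul ℝ (α i * oddPart 𝒜 (α j)) (gradeInv ℬ (c i p.1) * c j p.2)) := by
      funext p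
      conv_lhs => rw [← hx p.1, ← hx p.2, Finset.sum_mul_sum]
      simp only [← tmul_mul_tmul_right]
      rfl
    rw [e]
    refine continuous_finsetSum _ fun i _ => continuous_finsetSum _ fun j _ => ?_
    have h1 : Continuous fun p : 𝒜 ᵍ⊗[ℝ] ℬ × 𝒜 ᵍ⊗[ℝ] ℬ => c i p.1 := (hcont i).comp continuous_fst
    have h2 : Continuous fun p : 𝒜 ᵍ⊗[ℝ] ℬ × 𝒜 ᵍ⊗[ℝ] ℬ => c j p.2 := (hcont j).comp continuous_snd
    exact ((continuous_tmul 𝒜 ℬ).comp (continuous_const.prodMk (h1.mul h2))).add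
      ((continuous_tmul 𝒜 ℬ).comp (continuous_const.prodMk ((hB.comp h1).mul h2)))
  exact isTopologicalRing_of_continuousMul_of_real _

end TensorTopology


/-! ### Clifford extensions -/

section CliffordExt

variable {A : Type w} [Ring A] [Algebra ℝ A] (𝒜 : ZMod 2 → Submodule ℝ A) [GradedAlgebra 𝒜]
  {κ : Type} (sgn : κ → ℝ)

/-- Elements `g i` with squares `sgn i` that anticommute with each other and with the odd elements
of `A`, and commute with the even ones. -/
structure CliffordRel {X : Type v} [Ring X] [Algebra ℝ X] (f : A →ₐ[ℝ] X) (g : κ → X) : Prop where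
  sq : ∀ i, g i * g i = algebraMap ℝ X (sgn i)
  anticomm : ∀ i j, i ≠ j → g i * g j = -(g j * g i)
  skew : ∀ i a, g i * f a = f (gradeInv 𝒜 a) * g i

/-- A graded topological algebra `R` that is obtained from `A` by adjoining odd generators as in
`CliffordRel`. -/
structure CliffordExt {R : Type w} [Ring R] [Algebra ℝ R] [TopologicalSpace A]
    [TopologicalSpace R] (ℛ : ZMod 2 → Submodule ℝ R) [GradedAlgebra ℛ] where
  incl : A →ₐ[ℝ] R
  gen : κ → R
  rel : CliffordRel 𝒜 sgn incl gen
  gradeInv_incl : ∀ a, gradeInv ℛ (incl a) = incl (gradeInv 𝒜 a)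
  gradeInv_gen : ∀ i, gradeInv ℛ (gen i) = -gen i
  continuous_incl : Continuous incl
  exists_lift : ∀ (X : Type w) [Ring X] [Algebra ℝ X] (f : A →ₐ[ℝ] X) (g : κ → X),
    CliffordRel 𝒜 sgn f g → ∃ F : R →ₐ[ℝ] X, (∀ a, F (incl a) = f a) ∧ ∀ i, F (gen i) = g i
  continuous_of_comp_incl : ∀ (X : Type w) [Ring X] [Algebra ℝ X] [TopologicalSpace X]
    [ContinuousAdd X] [ContinuousMul X] [ContinuousSMul ℝ X] (F : R →ₐ[ℝ] X),
    Continuous (fun a => F (incl a)) → Continuous F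
  induction : ∀ P : R → Prop, P 1 → (∀ x y, P x → P y → P (x + y)) →
    (∀ a x, P x → P (incl a * x)) → (∀ i x, P x → P (gen i * x)) → ∀ x, P x

variable {𝒜 sgn}

/-- Renaming the generators. -/
def CliffordExt.reindex {R : Type w} [Ring R] [Algebra ℝ R] [TopologicalSpace A]
    [TopologicalSpace R] {ℛ : ZMod 2 → Submodule ℝ R} [GradedAlgebra ℛ]
    (E : CliffordExt 𝒜 sgn ℛ) {κ' : Type} {sgn' : κ' → ℝ} (e : κ' ≃ κ)
    (h : ∀ i, sgn (e i) = sgn' i) : CliffordExt 𝒜 sgn' ℛ where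
  incl := E.incl
  gen i := E.gen (e i)
  rel := ⟨fun i => by rw [E.rel.sq, h], fun i j hij => E.rel.anticomm _ _ (e.injective.ne hij),
    fun i => E.rel.skew _⟩
  gradeInv_incl := E.gradeInv_incl
  gradeInv_gen i := E.gradeInv_gen _
  continuous_incl := E.continuous_incl
  exists_lift X _ _ f g hfg := by
    obtain ⟨F, h1, h2⟩ := E.exists_lift X f (fun i => g (e.symm i))
      ⟨fun i => by rw [hfg.sq, ← h, e.apply_symm_apply],
        fun i j hij => hfg.anticomm _ _ (e.symm.injective.ne hij), fun i => hfg.skew _⟩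
    exact ⟨F, h1, fun i => by rw [h2, e.symm_apply_apply]⟩
  continuous_of_comp_incl := E.continuous_of_comp_incl
  induction P h1 h2 h3 h4 := E.induction P h1 h2 h3 fun i => by
    have h := h4 (e.symm i)
    rwa [e.apply_symm_apply] at h

/-- Every algebra is an extension of itself without generators. -/
noncomputable def CliffordExt.refl [TopologicalSpace A] [IsEmpty κ] : CliffordExt 𝒜 sgn 𝒜 where
  incl := AlgHom.id ℝ A
  gen := isEmptyElim
  rel := ⟨fun i => isEmptyElim i, fun i => isEmptyElim i, fun i => isEmptyElim i⟩
  gradeInv_incl _ := rfl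
  gradeInv_gen i := isEmptyElim i
  continuous_incl := continuous_id
  exists_lift X _ _ f _ _ := ⟨f, fun _ => rfl, fun i => isEmptyElim i⟩
  continuous_of_comp_incl _ _ _ _ _ _ _ _ h := h
  induction P h1 h2 h3 h4 x := by
    have h := h3 x 1 h1
    rwa [mul_one] at h

end CliffordExt

/-! ### Generators and the universal property of `Cl_{p,q}` -/

section CliffordLift

variable {p q : ℕ}

/-- The squares of the generators of `Cl_{p,q}`. -/
def clSign (p q : ℕ) : Fin p ⊕ Fin q → ℝ := Sum.elim (fun _ => 1) (fun _ => -1)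

theorem stdForm_apply (x : Fin p ⊕ Fin q → ℝ) :
    stdForm p q x = ∑ i, clSign p q i * (x i * x i) := by
  rw [stdForm, QuadraticMap.weightedSumSquares_apply]
  rfl

/-- The generators of `Cl_{p,q}`. -/
noncomputable def clGen (i : Fin p ⊕ Fin q) : Cl p q :=
  CliffordAlgebra.ι (stdForm p q) (Pi.single i 1)

theorem sum_clGen (x : Fin p ⊕ Fin q → ℝ) :
    CliffordAlgebra.ι (stdForm p q) x = ∑ i, x i • clGen i := by
  conv_lhs => rw [← Finset.univ_sum_single x, map_sum]
  refine Finset.sum_congr rfl fun i _ => ?_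
  rw [clGen, ← map_smul, ← Pi.single_smul, smul_eq_mul, mul_one]

theorem clGen_sq (i : Fin p ⊕ Fin q) :
    (clGen i * clGen i : Cl p q) = algebraMap ℝ _ (clSign p q i) := by
  rw [clGen, CliffordAlgebra.ι_sq_scalar, stdForm_apply, Finset.sum_eq_single i]
  · simp
  · intro j _ hj
    simp [hj]
  · simp

theorem clGen_anticomm {i j : Fin p ⊕ Fin q} (h : i ≠ j) :
    (clGen i * clGen j : Cl p q) = -(clGen j * clGen i) := by
  rw [← add_eq_zero_iff_eq_neg, clGen, clGen, CliffordAlgebra.ι_mul_ι_add_swap, QuadraticMap.polar]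
  rw [stdForm_apply, stdForm_apply, stdForm_apply, ← Finset.sum_sub_distrib,
    ← Finset.sum_sub_distrib, Finset.sum_eq_zero, map_zero]
  intro k _
  by_cases hi : k = i
  · rw [hi, Pi.add_apply, Pi.single_eq_of_ne h]
    ring
  · rw [Pi.add_apply, Pi.single_eq_of_ne hi]
    ring

theorem clGen_mem (i : Fin p ⊕ Fin q) : clGen i ∈ clGrading p q 1 :=
  CliffordAlgebra.ι_mem_evenOdd_one _ _

theorem gradeInv_clGen (i : Fin p ⊕ Fin q) : gradeInv (clGrading p q) (clGen i) = -clGen i :=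
  gradeInv_odd _ (clGen_mem i)

theorem cl_induction {P : Cl p q → Prop} (h0 : ∀ r : ℝ, P (algebraMap ℝ _ r))
    (hadd : ∀ x y, P x → P y → P (x + y)) (hsmul : ∀ (r : ℝ) x, P x → P (r • x))
    (hgen : ∀ i x, P x → P (clGen i * x)) (x : Cl p q) : P x := by
  induction x using CliffordAlgebra.left_induction with
  | algebraMap r => exact h0 r
  | add x y hx hy => exact hadd x y hx hy
  | ι_mul x m hx =>
    rw [sum_clGen, Finset.sum_mul]
    refine Finset.sum_induction _ P hadd ?_ fun i _ => ?_
    · have h := h0 0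
      rwa [map_zero] at h
    · rw [smul_mul_assoc]
      exact hsmul _ _ (hgen i x hx)

/-- The universal property of `Cl_{p,q}` in terms of generators. -/
theorem exists_clLift {X : Type v} [Ring X] [Algebra ℝ X] (g : Fin p ⊕ Fin q → X)
    (h1 : ∀ i, g i * g i = algebraMap ℝ X (clSign p q i))
    (h2 : ∀ i j, i ≠ j → g i * g j = -(g j * g i)) :
    ∃ G : Cl p q →ₐ[ℝ] X, ∀ i, G (clGen i) = g i := by
  let l : (Fin p ⊕ Fin q → ℝ) →ₗ[ℝ] X := Fintype.linearCombination ℝ g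
  have hl : ∀ x, l x * l x = algebraMap ℝ X (stdForm p q x) := fun x => by
    have e : l x = ∑ i, x i • g i := Fintype.linearCombination_apply ℝ g x
    have e1 : l x * l x = ∑ i, ∑ j, (x i * x j) • (g i * g j) := by
      rw [e, Finset.sum_mul_sum]
      simp only [smul_mul_smul_comm]
    have e2 : l x * l x = ∑ i, ∑ j, (x i * x j) • (g j * g i) := by
      rw [e1, Finset.sum_comm]
      exact Finset.sum_congr rfl fun i _ => Finset.sum_congr rfl fun j _ => by
        rw [mul_comm (x j) (x i)]
    -- Symmetrizing the double sum cancels the off-diagonal terms by anticommutation and doubles the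
    -- squares; one may then divide by two.
    have e3 : l x * l x + l x * l x = algebraMap ℝ X (stdForm p q x) +
        algebraMap ℝ X (stdForm p q x) := by
      conv_lhs => enter [1]; rw [e1]
      rw [e2, ← Finset.sum_add_distrib, stdForm_apply, ← map_add, ← Finset.sum_add_distrib, map_sum]
      refine Finset.sum_congr rfl fun i _ => ?_
      rw [← Finset.sum_add_distrib, Finset.sum_eq_single i]
      · rw [h1, ← two_smul ℝ, Algebra.algebraMap_eq_smul_one, Algebra.algebraMap_eq_smul_one,
          smul_smul, smul_smul]
        congr 1
        ring
      · intro j _ hj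
        rw [h2 i j hj.symm, smul_neg, neg_add_cancel]
      · simp
    rw [← two_smul ℝ, ← two_smul ℝ (algebraMap ℝ X _)] at e3
    exact smul_right_injective X (two_ne_zero (α := ℝ)) e3
  refine ⟨CliffordAlgebra.lift (stdForm p q) ⟨l, hl⟩, fun i => ?_⟩
  rw [clGen, CliffordAlgebra.lift_ι_apply]
  exact (Fintype.linearCombination_apply_single ℝ g i 1).trans (one_smul ℝ _)

variable {A : Type w} [Ring A] [Algebra ℝ A] {𝒜 : ZMod 2 → Submodule ℝ A} [GradedAlgebra 𝒜]

/-- Moving an even `a` past a generator costs nothing, and moving an odd `a` past it costs a sign.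
Induction on words in the generators turns this into `θ` applied to the Clifford element, which is
the sign rule required to map out of the graded tensor product. -/
theorem CliffordRel.map_comm {X : Type v} [Ring X] [Algebra ℝ X] {f : A →ₐ[ℝ] X}
    {G : Cl p q →ₐ[ℝ] X} (h : CliffordRel 𝒜 (clSign p q) f fun i => G (clGen i)) :
    ∀ ⦃i j : ZMod 2⦄ (b : clGrading p q i) (a : 𝒜 j),
      G b * f a = (-1 : ℤˣ) ^ (j * i) • (f a * G b) := by
  have h0 : ∀ a ∈ 𝒜 0, ∀ b, G b * f a = f a * G b := fun a ha b => by
    induction b using cl_induction with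
    | h0 r => rw [AlgHom.commutes, Algebra.commutes]
    | hadd x y hx hy => rw [map_add, add_mul, mul_add, hx, hy]
    | hsmul r x hx => rw [map_smul, smul_mul_assoc, mul_smul_comm, hx]
    | hgen i x hx =>
      rw [map_mul, mul_assoc, hx, ← mul_assoc, h.skew, gradeInv_even 𝒜 ha, mul_assoc]
  have h1 : ∀ a ∈ 𝒜 1, ∀ b, G b * f a = f a * G (gradeInv (clGrading p q) b) := fun a ha b => by
    induction b using cl_induction with
    | h0 r =>
      rw [gradeInv_even _ (SetLike.algebraMap_mem_graded _ r), AlgHom.commutes, Algebra.commutes]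
    | hadd x y hx hy => rw [map_add, map_add, map_add, add_mul, mul_add, hx, hy]
    | hsmul r x hx => rw [map_smul, map_smul, map_smul, smul_mul_assoc, mul_smul_comm, hx]
    | hgen i x hx =>
      rw [map_mul, mul_assoc, hx, ← mul_assoc, h.skew, gradeInv_odd 𝒜 ha, gradeInv_mul,
        gradeInv_clGen, map_neg, neg_mul, neg_mul, neg_mul, map_neg, mul_neg, map_mul, mul_assoc]
  have h2 : ∀ k : ZMod 2, k = 0 ∨ k = 1 := by decide
  rintro i j ⟨b, hb⟩ ⟨a, ha⟩
  rcases h2 j with rfl | rfl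
  · rw [zero_mul, uzpow_zero, one_smul]
    exact h0 a ha b
  · rw [one_mul]
    refine (h1 a ha b).trans ?_
    rcases h2 i with rfl | rfl
    · rw [uzpow_zero, one_smul, gradeInv_even _ hb]
    · rw [uzpow_one, Units.neg_smul, one_smul, gradeInv_odd _ hb, map_neg, mul_neg]

/-- Stability under multiplication by `f(A)` and by generators implies stability under the whole
image of the Clifford algebra, since real scalars already lie in `f(A)`. -/
theorem mul_induction_of_gen {X : Type v} [Ring X] [Algebra ℝ X] (f : A →ₐ[ℝ] X)
    (G : Cl p q →ₐ[ℝ] X) {P : X → Prop} (hadd : ∀ x y, P x → P y → P (x + y))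
    (hincl : ∀ a x, P x → P (f a * x)) (hgen : ∀ i x, P x → P (G (clGen i) * x)) (b : Cl p q) :
    ∀ x, P x → P (G b * x) := by
  have hr : ∀ (r : ℝ) x, P x → P (algebraMap ℝ X r * x) := fun r x hx => by
    have h := hincl (algebraMap ℝ A r) x hx
    rwa [AlgHom.commutes] at h
  induction b using cl_induction with
  | h0 r => rw [AlgHom.commutes]; exact hr r
  | hadd b c hb hc =>
    intro x hx
    rw [map_add, add_mul]
    exact hadd _ _ (hb x hx) (hc x hx)
  | hsmul r b hb =>
    intro x hx
    rw [Algebra.smul_def, map_mul, AlgHom.commutes, mul_assoc]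
    exact hr _ _ (hb x hx)
  | hgen i b hb =>
    intro x hx
    rw [map_mul, mul_assoc]
    exact hgen _ _ (hb x hx)

end CliffordLift

/-! ### Graded tensor products with `Cl_{p,q}` as Clifford extensions -/

section TensorExt

variable {A : Type w} [Ring A] [Algebra ℝ A] (𝒜 : ZMod 2 → Submodule ℝ A) [GradedAlgebra 𝒜]
  [TopologicalSpace A] (p q : ℕ)

open GradedTensorProduct in
/-- `A ⊗ Cl_{p,q}` as a Clifford extension of `A`. -/
noncomputable def CliffordExt.tensorRight :
    CliffordExt 𝒜 (clSign p q) (tensorGrading 𝒜 (clGrading p q)) where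
  incl := includeLeft 𝒜 (clGrading p q)
  gen i := includeRight 𝒜 (clGrading p q) (clGen i)
  rel := ⟨fun i => by rw [← map_mul, clGen_sq, AlgHom.commutes],
    fun i j h => by rw [← map_mul, ← map_mul, clGen_anticomm h, map_neg],
    fun i a => by
      have h1 := tmul_mul_tmul_left 𝒜 (clGrading p q) 1 a (clGen i) 1
      have h2 := tmul_one_mul_one_tmul (R := ℝ) 𝒜 (clGrading p q) (gradeInv 𝒜 a) (clGen i)
      rw [evenPart_odd _ (clGen_mem i), zero_mul,
        oddPart_odd _ (clGen_mem i), one_mul, one_mul, mul_one,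
        tmul_eq_tmulBilin _ _ _ 0, map_zero, zero_add] at h1
      exact h1.trans h2.symm⟩
  gradeInv_incl a := by
    refine (gradeInv_tmul 𝒜 _ a 1).trans ?_
    rw [gradeInv_even _ SetLike.GradedOne.one_mem]
    rfl
  gradeInv_gen i := by
    refine (gradeInv_tmul 𝒜 _ 1 (clGen i)).trans ?_
    rw [gradeInv_even _ SetLike.GradedOne.one_mem, gradeInv_clGen, tmul_eq_tmulBilin, map_neg]
    rfl
  continuous_incl := (continuous_tmul 𝒜 (clGrading p q)).comp
    (continuous_id.prodMk continuous_const)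
  exists_lift X _ _ f g h := by
    obtain ⟨G, hG⟩ := exists_clLift g h.sq h.anticomm
    have h' : CliffordRel 𝒜 (clSign p q) f fun i => G (clGen i) := by simpa only [hG] using h
    refine ⟨lift 𝒜 (clGrading p q) f G fun i j a b => ?_, fun a => ?_, fun i => ?_⟩
    · rw [h'.map_comm, smul_smul, mul_comm i j, Int.units_mul_self, one_smul]
    · refine (lift_tmul 𝒜 _ f G _ a 1).trans ?_
      rw [map_one, mul_one]
    · refine (lift_tmul 𝒜 _ f G _ 1 (clGen i)).trans ?_
      rw [map_one, one_mul, hG]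
  continuous_of_comp_incl X _ _ _ _ _ _ F hF := by
    refine tensor_continuous_iff F.toLinearMap ?_
    have h : Continuous (F.toLinearMap ∘ₗ (includeRight 𝒜 (clGrading p q)).toLinearMap) :=
      IsModuleTopology.continuous_of_linearMap _
    have e : (fun x : A × Cl p q => F.toLinearMap (tmul ℝ x.1 x.2)) = fun x =>
        F (includeLeft 𝒜 (clGrading p q) x.1) * F (includeRight 𝒜 (clGrading p q) x.2) := by
      funext x
      rw [← map_mul]
      exact congrArg F (tmul_one_mul_one_tmul (R := ℝ) 𝒜 _ x.1 x.2).symm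
    rw [e]
    exact (hF.comp continuous_fst).mul (h.comp continuous_snd)
  induction P h1 h2 h3 h4 x := by
    have key := mul_induction_of_gen (includeLeft 𝒜 (clGrading p q))
      (includeRight 𝒜 (clGrading p q)) h2 h3 h4
    induction x using tensor_induction 𝒜 (clGrading p q) with
    | h j k a _ b _ =>
      rw [← tmul_one_mul_one_tmul]
      have h := h3 a _ (key b 1 h1)
      rwa [mul_one] at h
    | h0 =>
      have h := h3 0 1 h1
      rwa [map_zero, zero_mul] at h
    | hadd x y hx hy => exact h2 x y hx hy

open GradedTensorProduct in
/-- `Cl_{p,q} ⊗ A` as a Clifford extension of `A`. -/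
noncomputable def CliffordExt.tensorLeft :
    CliffordExt 𝒜 (clSign p q) (tensorGrading (clGrading p q) 𝒜) where
  incl := includeRight (clGrading p q) 𝒜
  gen i := includeLeft (clGrading p q) 𝒜 (clGen i)
  rel := ⟨fun i => by rw [← map_mul, clGen_sq, AlgHom.commutes],
    fun i j h => by rw [← map_mul, ← map_mul, clGen_anticomm h, map_neg],
    fun i a => by
      have h1 := tmul_mul_tmul_right (clGrading p q) 𝒜 1 (clGen i) (gradeInv 𝒜 a) 1
      have h2 := tmul_one_mul_one_tmul (R := ℝ) (clGrading p q) 𝒜 (clGen i) a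
      rw [evenPart_odd _ (clGen_mem i), mul_zero,
        oddPart_odd _ (clGen_mem i), one_mul, mul_one, mul_one,
        gradeInv_gradeInv, tmul_eq_tmulBilin _ _ 0, map_zero, LinearMap.zero_apply, zero_add] at h1
      exact h2.trans h1.symm⟩
  gradeInv_incl a := by
    refine (gradeInv_tmul _ 𝒜 1 a).trans ?_
    rw [gradeInv_even _ SetLike.GradedOne.one_mem]
    rfl
  gradeInv_gen i := by
    refine (gradeInv_tmul _ 𝒜 (clGen i) 1).trans ?_
    rw [gradeInv_even 𝒜 SetLike.GradedOne.one_mem, gradeInv_clGen, tmul_eq_tmulBilin, map_neg]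
    rfl
  continuous_incl := (continuous_tmul (clGrading p q) 𝒜).comp
    (continuous_const.prodMk continuous_id)
  exists_lift X _ _ f g h := by
    obtain ⟨G, hG⟩ := exists_clLift g h.sq h.anticomm
    have h' : CliffordRel 𝒜 (clSign p q) f fun i => G (clGen i) := by simpa only [hG] using h
    refine ⟨lift (clGrading p q) 𝒜 G f h'.map_comm, fun a => ?_, fun i => ?_⟩
    · refine (lift_tmul _ 𝒜 G f _ 1 a).trans ?_
      rw [map_one, one_mul]
    · refine (lift_tmul _ 𝒜 G f _ (clGen i) 1).trans ?_
      rw [map_one, mul_one, hG]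
  continuous_of_comp_incl X _ _ _ _ _ _ F hF := by
    refine tensor_continuous_iff F.toLinearMap ?_
    have h : Continuous (F.toLinearMap ∘ₗ (includeLeft (clGrading p q) 𝒜).toLinearMap) :=
      IsModuleTopology.continuous_of_linearMap _
    have e : (fun x : Cl p q × A => F.toLinearMap (tmul ℝ x.1 x.2)) = fun x =>
        F (includeLeft (clGrading p q) 𝒜 x.1) * F (includeRight (clGrading p q) 𝒜 x.2) := by
      funext x
      rw [← map_mul]
      exact congrArg F (tmul_one_mul_one_tmul (R := ℝ) _ 𝒜 x.1 x.2).symm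
    rw [e]
    exact (h.comp continuous_fst).mul (hF.comp continuous_snd)
  induction P h1 h2 h3 h4 x := by
    have key := mul_induction_of_gen (includeRight (clGrading p q) 𝒜)
      (includeLeft (clGrading p q) 𝒜) h2 h3 h4
    induction x using tensor_induction (clGrading p q) 𝒜 with
    | h j k b _ a _ =>
      rw [← tmul_one_mul_one_tmul]
      have h := key b _ (h3 a 1 h1)
      rwa [mul_one] at h
    | h0 =>
      have h := h3 0 1 h1
      rwa [map_zero, zero_mul] at h
    | hadd x y hx hy => exact h2 x y hx hy

end TensorExt


/-! ### Graded anti-isomorphisms -/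

/-- An isomorphism of `ℬ` with the graded opposite of `𝒜`. -/
structure GradedAntiEquiv {A B : Type w} [Ring A] [Algebra ℝ A] [TopologicalSpace A] [Ring B]
    [Algebra ℝ B] [TopologicalSpace B] (𝒜 : ZMod 2 → Submodule ℝ A)
    (ℬ : ZMod 2 → Submodule ℝ B) [GradedAlgebra 𝒜] [GradedAlgebra ℬ] extends A ≃ₗ[ℝ] B where
  continuous_toFun : Continuous toLinearEquiv
  continuous_invFun : Continuous toLinearEquiv.symm
  map_one : toLinearEquiv 1 = 1
  map_gradeInv : ∀ a, toLinearEquiv (gradeInv 𝒜 a) = gradeInv ℬ (toLinearEquiv a)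
  even_mul : ∀ a ∈ 𝒜 0, ∀ b, toLinearEquiv a * toLinearEquiv b = toLinearEquiv (b * a)
  odd_mul : ∀ a ∈ 𝒜 1, ∀ b,
    toLinearEquiv a * toLinearEquiv b = toLinearEquiv (gradeInv 𝒜 b * a)

section AntiEquiv

variable {A B : Type w} [Ring A] [Algebra ℝ A] [TopologicalSpace A] [Ring B] [Algebra ℝ B]
  [TopologicalSpace B] {𝒜 : ZMod 2 → Submodule ℝ A} {ℬ : ZMod 2 → Submodule ℝ B}
  [GradedAlgebra 𝒜] [GradedAlgebra ℬ]

namespace GradedAntiEquiv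

variable (o : GradedAntiEquiv 𝒜 ℬ)

theorem map_even {a : A} (ha : a ∈ 𝒜 0) : o.toLinearEquiv a ∈ ℬ 0 := by
  rw [mem_even_iff, ← o.map_gradeInv, gradeInv_even 𝒜 ha]

theorem map_odd {a : A} (ha : a ∈ 𝒜 1) : o.toLinearEquiv a ∈ ℬ 1 := by
  rw [mem_odd_iff, ← o.map_gradeInv, gradeInv_odd 𝒜 ha, map_neg]

theorem symm_gradeInv (b : B) :
    o.toLinearEquiv.symm (gradeInv ℬ b) = gradeInv 𝒜 (o.toLinearEquiv.symm b) := by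
  rw [LinearEquiv.symm_apply_eq, o.map_gradeInv, LinearEquiv.apply_symm_apply]

/-- The inverse of a graded anti-isomorphism. -/
def symm : GradedAntiEquiv ℬ 𝒜 where
  __ := o.toLinearEquiv.symm
  continuous_toFun := o.continuous_invFun
  continuous_invFun := o.continuous_toFun
  map_one := (LinearEquiv.symm_apply_eq _).2 o.map_one.symm
  map_gradeInv := o.symm_gradeInv
  even_mul x hx y := by
    obtain ⟨a, rfl⟩ := o.toLinearEquiv.surjective x
    obtain ⟨b, rfl⟩ := o.toLinearEquiv.surjective y
    rw [mem_even_iff, ← o.map_gradeInv, o.toLinearEquiv.injective.eq_iff, ← mem_even_iff] at hx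
    change o.toLinearEquiv.symm (o.toLinearEquiv a) * o.toLinearEquiv.symm (o.toLinearEquiv b) =
      o.toLinearEquiv.symm _
    rw [LinearEquiv.symm_apply_apply, LinearEquiv.symm_apply_apply, LinearEquiv.eq_symm_apply]
    induction b using grade_induction 𝒜 with
    | h0 b hb => rw [o.even_mul b hb]
    | h1 b hb => rw [o.odd_mul b hb, gradeInv_even 𝒜 hx]
    | hadd b c hb hc => rw [mul_add, map_add, map_add, add_mul, hb, hc]
  odd_mul x hx y := by
    obtain ⟨a, rfl⟩ := o.toLinearEquiv.surjective x
    obtain ⟨b, rfl⟩ := o.toLinearEquiv.surjective y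
    rw [mem_odd_iff, ← o.map_gradeInv, ← map_neg, o.toLinearEquiv.injective.eq_iff,
      ← mem_odd_iff] at hx
    change o.toLinearEquiv.symm (o.toLinearEquiv a) * o.toLinearEquiv.symm (o.toLinearEquiv b) =
      o.toLinearEquiv.symm _
    rw [LinearEquiv.symm_apply_apply, LinearEquiv.symm_apply_apply, LinearEquiv.eq_symm_apply,
      ← o.map_gradeInv]
    induction b using grade_induction 𝒜 with
    | h0 b hb => rw [gradeInv_even 𝒜 hb, o.even_mul b hb]
    | h1 b hb =>
      rw [gradeInv_odd 𝒜 hb, map_neg, neg_mul, o.odd_mul b hb, gradeInv_odd 𝒜 hx, neg_mul,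
        map_neg, neg_neg]
    | hadd b c hb hc => rw [mul_add, map_add, map_add, map_add, add_mul, hb, hc]

theorem symm_apply_apply (a : A) : o.symm.toLinearEquiv (o.toLinearEquiv a) = a :=
  o.toLinearEquiv.symm_apply_apply a

theorem apply_symm_apply (b : B) : o.toLinearEquiv (o.symm.toLinearEquiv b) = b :=
  o.toLinearEquiv.apply_symm_apply b

variable {X : Type v} [Ring X] [Algebra ℝ X] (f : A →ₐ[ℝ] X) (c : X)

/-- The linear map `o(a) ↦ f(a₀) + f(a₁) c`. -/
noncomputable def untwist : B →ₗ[ℝ] X :=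
  (f.toLinearMap ∘ₗ evenPart 𝒜 + LinearMap.mulRight ℝ c ∘ₗ f.toLinearMap ∘ₗ oddPart 𝒜) ∘ₗ
    o.toLinearEquiv.symm.toLinearMap

theorem untwist_apply (a : A) : o.untwist f c (o.toLinearEquiv a) =
    f (evenPart 𝒜 a) + f (oddPart 𝒜 a) * c := by
  change f (evenPart 𝒜 (o.toLinearEquiv.symm (o.toLinearEquiv a))) +
    f (oddPart 𝒜 (o.toLinearEquiv.symm (o.toLinearEquiv a))) * c = _
  rw [LinearEquiv.symm_apply_apply]

theorem untwist_even {a : A} (ha : a ∈ 𝒜 0) : o.untwist f c (o.toLinearEquiv a) = f a := by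
  rw [untwist_apply, evenPart_even 𝒜 ha, oddPart_even 𝒜 ha, _root_.map_zero, zero_mul, add_zero]

theorem untwist_odd {a : A} (ha : a ∈ 𝒜 1) : o.untwist f c (o.toLinearEquiv a) = f a * c := by
  rw [untwist_apply, evenPart_odd 𝒜 ha, oddPart_odd 𝒜 ha, _root_.map_zero, zero_add]

theorem continuous_untwist [TopologicalSpace X] [IsTopologicalRing X] [IsTopologicalRing A]
    [ContinuousSMul ℝ A] (hA : Continuous (gradeInv 𝒜)) (hf : Continuous f) :
    Continuous (o.untwist f c) :=
  (((hf.comp (continuous_evenPart 𝒜 hA)).add ((hf.comp (continuous_oddPart 𝒜 hA)).mul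
    continuous_const))).comp o.continuous_invFun

theorem induction {P : B → Prop} (h0 : ∀ a ∈ 𝒜 0, P (o.toLinearEquiv a))
    (h1 : ∀ a ∈ 𝒜 1, P (o.toLinearEquiv a)) (hadd : ∀ x y, P x → P y → P (x + y)) (b : B) :
    P b := by
  obtain ⟨a, rfl⟩ := o.toLinearEquiv.surjective b
  rw [← evenPart_add_oddPart 𝒜 a, map_add]
  exact hadd _ _ (h0 _ (evenPart_mem 𝒜 a)) (h1 _ (oddPart_mem 𝒜 a))

variable {f c}

theorem untwist_one : o.untwist f c 1 = 1 := by
  rw [← o.map_one, untwist_even o f c SetLike.GradedOne.one_mem, _root_.map_one]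

/-- For odd `a` and `b`, `f(b) c f(a) c = -f(b) f(a) c² = -f(b a)`, and this sign is the one in the
graded opposite product `o(a) o(b)`. The other parities carry no sign. So multiplying odd elements
by `c` turns the graded opposite into the ordinary one. -/
theorem untwist_mul (hc : c * c = 1) (hf : ∀ a, c * f a = f (gradeInv 𝒜 a) * c) (x y : B) :
    o.untwist f c (x * y) = o.untwist f c y * o.untwist f c x := by
  induction x using o.induction with
  | h0 a ha =>
    induction y using o.induction with
    | h0 b hb =>
      have h := SetLike.mul_mem_graded hb ha
      rw [o.even_mul a ha, o.untwist_even f c ha, o.untwist_even f c hb, untwist_even o f c h,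
        map_mul]
    | h1 b hb =>
      have h := SetLike.mul_mem_graded hb ha
      rw [o.even_mul a ha, o.untwist_even f c ha, o.untwist_odd f c hb, untwist_odd o f c h,
        map_mul, mul_assoc, mul_assoc, hf, gradeInv_even 𝒜 ha]
    | hadd y z hy hz => rw [mul_add, map_add, map_add, add_mul, hy, hz]
  | h1 a ha =>
    induction y using o.induction with
    | h0 b hb =>
      have h := SetLike.mul_mem_graded hb ha
      rw [o.odd_mul a ha, o.untwist_odd f c ha, o.untwist_even f c hb, gradeInv_even 𝒜 hb,
        untwist_odd o f c h, map_mul, mul_assoc]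
    | h1 b hb =>
      have h := SetLike.mul_mem_graded hb ha
      rw [o.odd_mul a ha, o.untwist_odd f c ha, o.untwist_odd f c hb, gradeInv_odd 𝒜 hb, neg_mul,
        map_neg, map_neg, untwist_even o f c h, map_mul, mul_assoc, ← mul_assoc c, hf,
        gradeInv_odd 𝒜 ha, map_neg, neg_mul, neg_mul, mul_neg, mul_assoc (f a), hc, mul_one]
    | hadd y z hy hz => rw [mul_add, map_add, map_add, add_mul, hy, hz]
  | hadd x z hx hz => rw [add_mul, map_add, map_add, mul_add, hx, hz]

end GradedAntiEquiv

end AntiEquiv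

/-! ### Product-reversing maps out of Clifford extensions -/

section AntiLift

open MulOpposite

variable {A : Type w} [Ring A] [Algebra ℝ A] [TopologicalSpace A] {𝒜 : ZMod 2 → Submodule ℝ A}
  [GradedAlgebra 𝒜] {κ : Type} {sgn : κ → ℝ}
  {R : Type w} [Ring R] [Algebra ℝ R] [TopologicalSpace R]
  {ℛ : ZMod 2 → Submodule ℝ R} [GradedAlgebra ℛ]

/-- A linear map that reverses products and has prescribed values on the generators of a Clifford
extension. -/
structure CliffordExt.IsAntiLift (E : CliffordExt 𝒜 sgn ℛ) {X : Type w} [Ring X] [Algebra ℝ X]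
    (f : A →ₗ[ℝ] X) (g : κ → X) (K : R →ₗ[ℝ] X) : Prop where
  map_one : K 1 = 1
  map_mul : ∀ x y, K (x * y) = K y * K x
  map_incl : ∀ a, K (E.incl a) = f a
  map_gen : ∀ i, K (E.gen i) = g i

/-- The universal property of Clifford extensions for linear maps that reverse products. -/
theorem CliffordExt.exists_antiLift (E : CliffordExt 𝒜 sgn ℛ) {X : Type w} [Ring X] [Algebra ℝ X]
    (f : A →ₗ[ℝ] X) (f_one : f 1 = 1) (f_mul : ∀ a b, f (a * b) = f b * f a) (g : κ → X)
    (h1 : ∀ i, g i * g i = algebraMap ℝ X (sgn i))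
    (h2 : ∀ i j, i ≠ j → g i * g j = -(g j * g i))
    (h3 : ∀ i a, f a * g i = g i * f (gradeInv 𝒜 a)) :
    ∃ K : R →ₗ[ℝ] X, E.IsAntiLift f g K ∧ ∀ [TopologicalSpace X] [IsTopologicalRing X]
        [ContinuousSMul ℝ X], Continuous f → Continuous K := by
  -- A product-reversing map to `X` is a homomorphism to the opposite ring, where the usual
  -- universal property applies.
  let f' : A →ₐ[ℝ] Xᵐᵒᵖ := AlgHom.ofLinearMap ((opLinearEquiv ℝ).toLinearMap ∘ₗ f)
    (congrArg op f_one) (fun x y => congrArg op (f_mul x y))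
  obtain ⟨F, hF1, hF2⟩ := E.exists_lift Xᵐᵒᵖ f' (fun i => op (g i))
    ⟨fun i => congrArg op (h1 i), fun i j h => congrArg op (h2 j i h.symm),
      fun i a => congrArg op (h3 i a)⟩
  refine ⟨(opLinearEquiv ℝ).symm.toLinearMap ∘ₗ F.toLinearMap, ⟨congrArg unop (map_one F),
    fun x y => congrArg unop (map_mul F x y), fun a => congrArg unop (hF1 a),
    fun i => congrArg unop (hF2 i)⟩, ?_⟩
  intro _ _ _ hf
  refine continuous_unop.comp (E.continuous_of_comp_incl Xᵐᵒᵖ F ?_)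
  simp only [hF1]
  exact continuous_op.comp hf

end AntiLift


/-! ### Corners of Clifford extensions -/

section CornerOfAntiMap

variable {R S : Type w} [Ring R] [Algebra ℝ R] [TopologicalSpace R] [IsTopologicalRing R]
  [Ring S] [Algebra ℝ S] [TopologicalSpace S]
  {ℛ : ZMod 2 → Submodule ℝ R} {𝒮 : ZMod 2 → Submodule ℝ S} [GradedAlgebra ℛ] [GradedAlgebra 𝒮]

/-- The corner given by a product reversing map `K : S → R` whose values commute with `p`. -/
def Corner.ofAntiMap (p u : R) (full : ∃ (k : ℕ) (x y : Fin k → R), ∑ i, x i * p * y i = 1)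
    (p_mul_p : p * p = p) (u_mul_u : u * u = 1) (gradeInv_u : gradeInv ℛ u = -u)
    (gradeInv_p : gradeInv ℛ p = u * p * u) (K : S →ₗ[ℝ] R) (K_one : K 1 = 1)
    (K_mul : ∀ s t, K (s * t) = K t * K s) (p_mul_K : ∀ s, p * K s = K s * p)
    (K_gradeInv : ∀ s, K (gradeInv 𝒮 s) = u * gradeInv ℛ (K s) * u) (hK : Continuous K)
    (proj : R →ₗ[ℝ] S) (proj_K : ∀ s, proj (K s * p) = s)
    (exists_K : ∀ r, ∃ s, p * r * p = K s * p) (hproj : Continuous proj) : Corner ℛ 𝒮 where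
  p := p
  u := u
  full := full
  p_mul_p := p_mul_p
  u_mul_u := u_mul_u
  gradeInv_u := gradeInv_u
  gradeInv_p := gradeInv_p
  incl := LinearMap.mulRight ℝ p ∘ₗ K
  incl_one := by
    change K 1 * p = p
    rw [K_one, one_mul]
  incl_mul s t := by
    change K (s * t) * p = K t * p * (K s * p)
    rw [K_mul, mul_assoc (K t) p, ← mul_assoc p, p_mul_K, mul_assoc (K s), p_mul_p, mul_assoc]
  incl_gradeInv s := by
    change K (gradeInv 𝒮 s) * p = u * gradeInv ℛ (K s * p) * u
    rw [gradeInv_mul, gradeInv_p, K_gradeInv]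
    simp only [mul_assoc, u_mul_u, mul_one]
  continuous_incl := hK.mul continuous_const
  proj := proj
  proj_incl := proj_K
  incl_proj r := by
    obtain ⟨s, hs⟩ := exists_K r
    rw [hs, proj_K]
    rfl
  continuous_proj := hproj

end CornerOfAntiMap

/-! ### A model by two by two matrices -/

section MatrixModel

variable {S : Type w} [Ring S] [Algebra ℝ S] (𝒮 : ZMod 2 → Submodule ℝ S) [GradedAlgebra 𝒮]

/-- The homomorphism `s ↦ diag(s, θ(s))`. -/
noncomputable def twistedDiagonal : S →ₐ[ℝ] Matrix (Fin 2) (Fin 2) S :=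
  AlgHom.ofLinearMap
    { toFun := fun s => !![s, 0; 0, gradeInv 𝒮 s]
      map_add' := fun s t => by simp
      map_smul' := fun r s => by simp [Matrix.smul_of] }
    (by simp [gradeInv_even 𝒮 SetLike.GradedOne.one_mem, Matrix.one_fin_two])
    (fun s t => by simp [gradeInv_mul])

theorem twistedDiagonal_apply (s : S) : twistedDiagonal 𝒮 s = !![s, 0; 0, gradeInv 𝒮 s] := rfl

theorem continuous_twistedDiagonal [TopologicalSpace S] (hS : Continuous (gradeInv 𝒮)) :
    Continuous (twistedDiagonal 𝒮) := by
  refine continuous_matrix fun i j => ?_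
  fin_cases i <;> fin_cases j
  · exact continuous_id
  · exact continuous_const
  · exact continuous_const
  · exact hS

variable (S) in
/-- The matrix that exchanges the two summands. -/
def swapMatrix : Matrix (Fin 2) (Fin 2) S := !![0, 1; 1, 0]

variable (S) in
/-- The matrix `diag(1, -1)`. -/
def signMatrix : Matrix (Fin 2) (Fin 2) S := !![1, 0; 0, -1]

theorem swapMatrix_mul_self : swapMatrix S * swapMatrix S = 1 := by
  simp [swapMatrix, Matrix.one_fin_two]

theorem signMatrix_mul_self : signMatrix S * signMatrix S = 1 := by
  simp [signMatrix, Matrix.one_fin_two]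

theorem swapMatrix_mul_signMatrix :
    swapMatrix S * signMatrix S = -(signMatrix S * swapMatrix S) := by
  simp [swapMatrix, signMatrix]

/-- The second diagonal entry carries `θ` precisely so that the exchange matrix anticommutes with
the images of odd elements, as an odd generator must. -/
theorem swapMatrix_mul_twistedDiagonal (s : S) :
    swapMatrix S * twistedDiagonal 𝒮 s = twistedDiagonal 𝒮 (gradeInv 𝒮 s) * swapMatrix S := by
  simp [swapMatrix, twistedDiagonal_apply, gradeInv_gradeInv]

theorem signMatrix_mul_twistedDiagonal (s : S) :
    signMatrix S * twistedDiagonal 𝒮 s = twistedDiagonal 𝒮 s * signMatrix S := by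
  simp [signMatrix, twistedDiagonal_apply]

end MatrixModel


/-! ### The corners of extensions by one generator, and by at least two generators -/

section CliffordCorner

variable {A B R S : Type w} [Ring A] [Algebra ℝ A] [TopologicalSpace A] [IsTopologicalRing A]
  [ContinuousSMul ℝ A] [Ring B] [Algebra ℝ B] [TopologicalSpace B] [IsTopologicalRing B]
  [ContinuousSMul ℝ B]
  [Ring R] [Algebra ℝ R] [TopologicalSpace R] [IsTopologicalRing R] [ContinuousSMul ℝ R]
  [Ring S] [Algebra ℝ S] [TopologicalSpace S] [IsTopologicalRing S] [ContinuousSMul ℝ S]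
  {𝒜 : ZMod 2 → Submodule ℝ A} {ℬ : ZMod 2 → Submodule ℝ B}
  {ℛ : ZMod 2 → Submodule ℝ R} {𝒮 : ZMod 2 → Submodule ℝ S}
  [GradedAlgebra 𝒜] [GradedAlgebra ℬ] [GradedAlgebra ℛ] [GradedAlgebra 𝒮]

@[elab_as_elim]
theorem CliffordExt.induction_on {κ : Type} {sgn : κ → ℝ} (E : CliffordExt 𝒜 sgn ℛ) {P : R → Prop}
    (r : R) (one : P 1) (add : ∀ x y, P x → P y → P (x + y))
    (incl_mul : ∀ a x, P x → P (E.incl a * x)) (gen_mul : ∀ i x, P x → P (E.gen i * x)) : P r :=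
  E.induction P one add incl_mul gen_mul r

/-- A product-reversing map is determined by its values on `A` and on the generators, so a square of
such maps commutes as soon as it commutes there. -/
theorem CliffordExt.IsAntiLift.comp_eq {κ : Type} {sgn : κ → ℝ} {A' R' X' : Type v}
    [Ring A'] [Algebra ℝ A'] [TopologicalSpace A'] {𝒜' : ZMod 2 → Submodule ℝ A'} [GradedAlgebra 𝒜']
    [Ring R'] [Algebra ℝ R'] [TopologicalSpace R'] {ℛ' : ZMod 2 → Submodule ℝ R'}
    [GradedAlgebra ℛ'] {X : Type w} [Ring X] [Algebra ℝ X] [Ring X'] [Algebra ℝ X']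
    {E : CliffordExt 𝒜 sgn ℛ} {E' : CliffordExt 𝒜' sgn ℛ'} {f : A →ₗ[ℝ] X} {f' : A' →ₗ[ℝ] X'}
    {g : κ → X} {g' : κ → X'} {K : R →ₗ[ℝ] X} {K' : R' →ₗ[ℝ] X'} (h : E.IsAntiLift f g K)
    (h' : E'.IsAntiLift f' g' K') (F : X →ₐ[ℝ] X') (G : R →ₐ[ℝ] R') (φ : A → A')
    (hG : ∀ a, G (E.incl a) = E'.incl (φ a)) (hG' : ∀ i, G (E.gen i) = E'.gen i)
    (hF : ∀ a, F (f a) = f' (φ a)) (hF' : ∀ i, F (g i) = g' i) (r : R) :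
    F (K r) = K' (G r) := by
  refine E.induction_on r ?_ ?_ ?_ ?_
  · rw [h.map_one, _root_.map_one, _root_.map_one, h'.map_one]
  · intro x y hx hy
    simp only [map_add, hx, hy]
  · intro a x hx
    rw [h.map_mul, _root_.map_mul, _root_.map_mul, h'.map_mul, hx, hG, h.map_incl, h'.map_incl, hF]
  · intro i x hx
    rw [h.map_mul, _root_.map_mul, _root_.map_mul, h'.map_mul, hx, hG', h.map_gen, h'.map_gen, hF']

theorem CliffordRel.map_even {κ : Type} {sgn : κ → ℝ} {X : Type v} [Ring X] [Algebra ℝ X]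
    {f : A →ₐ[ℝ] X} {g : κ → X} (h : CliffordRel 𝒜 sgn f g) {a : A} (ha : a ∈ 𝒜 0) (i : κ) :
    g i * f a = f a * g i := by
  rw [h.skew, gradeInv_even 𝒜 ha]

theorem CliffordRel.map_odd {κ : Type} {sgn : κ → ℝ} {X : Type v} [Ring X] [Algebra ℝ X]
    {f : A →ₐ[ℝ] X} {g : κ → X} (h : CliffordRel 𝒜 sgn f g) {a : A} (ha : a ∈ 𝒜 1) (i : κ) :
    g i * f a = -(f a * g i) := by
  rw [h.skew, gradeInv_odd 𝒜 ha, map_neg, neg_mul]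

/-- If `R` is obtained from `A` by adjoining one generator with square `1`, and `S` likewise from
the opposite of `A`, then the opposite of `S` is isomorphic to `R`, with twisted gradings. -/
theorem CliffordExt.exists_corner_of_one (E : CliffordExt 𝒜 (fun _ : Unit => 1) ℛ)
    (E' : CliffordExt ℬ (fun _ : Unit => 1) 𝒮) (o : GradedAntiEquiv 𝒜 ℬ)
    (hA : Continuous (gradeInv 𝒜)) (hB : Continuous (gradeInv ℬ)) :
    ∃ (c : Corner ℛ 𝒮) (K : S →ₗ[ℝ] R),
      E'.IsAntiLift (o.untwist E.incl (E.gen ())) (fun _ => E.gen ()) K ∧ c.p = 1 ∧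
      c.u = E.gen () ∧ ∀ s, c.incl s = K s * c.p := by
  have huu : E.gen () * E.gen () = 1 := (E.rel.sq ()).trans (map_one _)
  have hff : E'.gen () * E'.gen () = 1 := (E'.rel.sq ()).trans (map_one _)
  -- `K` sends `o(a)` to `a` or `a u` according to parity, and the generator of `S` to `u`, where
  -- `u` is the generator of `R`.
  obtain ⟨K, hK, hKc⟩ := E'.exists_antiLift (o.untwist E.incl (E.gen ())) o.untwist_one
    (o.untwist_mul huu (E.rel.skew ())) (fun _ => E.gen ()) (E.rel.sq) (fun i j h => absurd rfl h)
    (fun i b => by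
      induction b using o.induction with
      | h0 a ha =>
        rw [← o.map_gradeInv, gradeInv_even 𝒜 ha, o.untwist_even _ _ ha, E.rel.map_even ha]
      | h1 a ha =>
        rw [← o.map_gradeInv, gradeInv_odd 𝒜 ha, map_neg, map_neg, o.untwist_odd _ _ ha, mul_neg,
          ← mul_assoc, E.rel.map_odd ha, neg_mul, neg_neg]
      | hadd x y hx hy => simp only [map_add, add_mul, mul_add, hx, hy])
  have hcc : -E'.gen () * -E'.gen () = 1 := by rw [neg_mul_neg, hff]
  have hcf : ∀ b, -E'.gen () * E'.incl b = E'.incl (gradeInv ℬ b) * -E'.gen () := fun b => by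
    rw [neg_mul, E'.rel.skew, mul_neg]
  -- The inverse of `K`. The sign in the twisting element is forced: `L(a u) = f · o(a) · (-f) =
  -- o(a) f² = o(a)` for odd `a`, since the generator `f` of `S` anticommutes with `o(a)`.
  obtain ⟨L, hL, hLc⟩ := E.exists_antiLift (o.symm.untwist E'.incl (-E'.gen ())) o.symm.untwist_one
    (o.symm.untwist_mul hcc hcf) (fun _ => E'.gen ()) (E'.rel.sq) (fun i j h => absurd rfl h)
    (fun i b => by
      induction b using o.symm.induction with
      | h0 a ha =>
        rw [← o.symm.map_gradeInv, gradeInv_even ℬ ha, o.symm.untwist_even _ _ ha,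
          E'.rel.map_even ha]
      | h1 a ha =>
        rw [← o.symm.map_gradeInv, gradeInv_odd ℬ ha, map_neg, map_neg, o.symm.untwist_odd _ _ ha,
          mul_neg, mul_neg, mul_neg, neg_neg, ← mul_assoc, E'.rel.map_odd ha, neg_mul]
      | hadd x y hx hy => simp only [map_add, add_mul, mul_add, hx, hy])
  have hLK : ∀ s, L (K s) = s := fun s => by
    refine E'.induction_on s ?_ ?_ ?_ ?_
    · rw [hK.map_one, hL.map_one]
    · intro x y hx hy
      rw [map_add, map_add, hx, hy]
    · intro b x hx
      rw [hK.map_mul, hL.map_mul, hx, hK.map_incl]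
      congr 1
      induction b using o.induction with
      | h0 a ha =>
        rw [o.untwist_even _ _ ha, hL.map_incl]
        conv_lhs => rw [← o.symm_apply_apply a]
        rw [o.symm.untwist_even _ _ (o.map_even ha)]
      | h1 a ha =>
        rw [o.untwist_odd _ _ ha, hL.map_mul, hL.map_incl, hL.map_gen]
        conv_lhs => rw [← o.symm_apply_apply a]
        rw [o.symm.untwist_odd _ _ (o.map_odd ha), mul_neg, mul_neg, ← mul_assoc,
          E'.rel.map_odd (o.map_odd ha), neg_mul, neg_neg, mul_assoc, hff, mul_one]
      | hadd x y hx hy => simp only [map_add, hx, hy]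
    · intro i x hx
      rw [hK.map_mul, hL.map_mul, hx, hK.map_gen, hL.map_gen]
  have hKL : ∀ r, K (L r) = r := fun r => by
    refine E.induction_on r ?_ ?_ ?_ ?_
    · rw [hL.map_one, hK.map_one]
    · intro x y hx hy
      rw [map_add, map_add, hx, hy]
    · intro a x hx
      rw [hL.map_mul, hK.map_mul, hx, hL.map_incl]
      congr 1
      induction a using o.symm.induction with
      | h0 b hb =>
        rw [o.symm.untwist_even _ _ hb, hK.map_incl]
        conv_lhs => rw [← o.apply_symm_apply b]
        rw [o.untwist_even _ _ (o.symm.map_even hb)]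
      | h1 b hb =>
        rw [o.symm.untwist_odd _ _ hb, hK.map_mul, hK.map_incl, map_neg, hK.map_gen]
        conv_lhs => rw [← o.apply_symm_apply b]
        rw [o.untwist_odd _ _ (o.symm.map_odd hb), neg_mul, ← mul_assoc,
          E.rel.map_odd (o.symm.map_odd hb), neg_mul, neg_neg, mul_assoc, huu, mul_one]
      | hadd x y hx hy => simp only [map_add, hx, hy]
    · intro i x hx
      rw [hL.map_mul, hK.map_mul, hx, hL.map_gen, hK.map_gen]
  -- The grading of `S` corresponds to `θ` followed by conjugation with `u`; for instance `u θ(u) u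
  -- = -u` matches the oddness of the generator.
  have hKg : ∀ s, K (gradeInv 𝒮 s) = E.gen () * gradeInv ℛ (K s) * E.gen () := fun s => by
    have hm : ∀ x y, gradeInv ℛ (x * y) = gradeInv ℛ x * gradeInv ℛ y := gradeInv_mul ℛ
    refine E'.induction_on s ?_ ?_ ?_ ?_
    · rw [gradeInv_even 𝒮 SetLike.GradedOne.one_mem, hK.map_one,
        gradeInv_even ℛ SetLike.GradedOne.one_mem, mul_one, huu]
    · intro x y hx hy
      simp only [map_add, hx, hy, mul_add, add_mul]
    · intro b x hx
      have key : K (gradeInv 𝒮 (E'.incl b)) =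
          E.gen () * gradeInv ℛ (K (E'.incl b)) * E.gen () := by
        rw [E'.gradeInv_incl, hK.map_incl, hK.map_incl]
        induction b using o.induction with
        | h0 a ha =>
          rw [← o.map_gradeInv, gradeInv_even 𝒜 ha, o.untwist_even _ _ ha, E.gradeInv_incl,
            gradeInv_even 𝒜 ha, E.rel.map_even ha, mul_assoc, huu, mul_one]
        | h1 a ha =>
          rw [← o.map_gradeInv, gradeInv_odd 𝒜 ha, map_neg, map_neg, o.untwist_odd _ _ ha, hm,
            E.gradeInv_incl, gradeInv_odd 𝒜 ha, E.gradeInv_gen, map_neg, neg_mul_neg, ← mul_assoc,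
            E.rel.map_odd ha, mul_assoc, huu, mul_one]
        | hadd x y hx hy => simp only [map_add, add_mul, mul_add, hx, hy]
      rw [gradeInv_mul, hK.map_mul, hK.map_mul, hm, hx, key]
      simp only [mul_assoc]
      rw [← mul_assoc (E.gen ()) (E.gen ()), huu, one_mul]
    · intro i x hx
      rw [gradeInv_mul, hK.map_mul, hK.map_mul, hm, hx, E'.gradeInv_gen, map_neg, hK.map_gen,
        E.gradeInv_gen]
      simp only [mul_assoc, neg_mul, mul_neg, huu]
  have hKc' := hKc (o.continuous_untwist _ _ hA E.continuous_incl)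
  have hLc' := hLc (o.symm.continuous_untwist _ _ hB E'.continuous_incl)
  exact ⟨Corner.ofAntiMap 1 (E.gen ()) ⟨1, fun _ => 1, fun _ => 1, by simp⟩ (one_mul 1) huu
    (E.gradeInv_gen ()) (by rw [gradeInv_even ℛ SetLike.GradedOne.one_mem, mul_one, huu]) K
    hK.map_one hK.map_mul (fun s => by rw [one_mul, mul_one]) hKg hKc' L
    (fun s => by rw [mul_one, hLK]) (fun r => ⟨L r, by rw [hKL, one_mul]⟩) hLc', K, hK, rfl, rfl,
    fun s => rfl⟩

/-- If `R` is obtained from `A` by adjoining generators `u`, `e` and `g_j` with square `1`, and `S`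
is obtained from the opposite of `A` by adjoining as many generators as there are `g_j`, but with
square `-1`, then the opposite of `S` is isomorphic to the corner of `R` cut out by the idempotent
`(1 + e) / 2`. -/
theorem CliffordExt.exists_corner_of_two {J : Type}
    (E : CliffordExt 𝒜 (fun _ : Fin 2 ⊕ J => 1) ℛ) (E' : CliffordExt ℬ (fun _ : J => -1) 𝒮)
    (o : GradedAntiEquiv 𝒜 ℬ) (hA : Continuous (gradeInv 𝒜)) (hB : Continuous (gradeInv ℬ))
    (hS : Continuous (gradeInv 𝒮)) :
    ∃ (c : Corner ℛ 𝒮) (K : S →ₗ[ℝ] R),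
      E'.IsAntiLift (o.untwist E.incl (E.gen (.inl 0)))
        (fun j => E.gen (.inr j) * E.gen (.inl 0)) K ∧
      c.p = (2⁻¹ : ℝ) • (1 + E.gen (.inl 1)) ∧ c.u = E.gen (.inl 0) ∧
      ∀ s, c.incl s = K s * c.p := by
  set u := E.gen (.inl 0) with hu
  set e := E.gen (.inl 1) with he
  set g : J → R := fun j => E.gen (.inr j) with hg
  have huu : u * u = 1 := (E.rel.sq _).trans (map_one _)
  have hee : e * e = 1 := (E.rel.sq _).trans (map_one _)
  have hgg : ∀ j, g j * g j = 1 := fun j => (E.rel.sq _).trans (map_one _)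
  have heu : e * u = -(u * e) := E.rel.anticomm _ _ (by simp)
  have hgu : ∀ j, g j * u = -(u * g j) := fun j => E.rel.anticomm _ _ (by simp)
  have hge : ∀ j, g j * e = -(e * g j) := fun j => E.rel.anticomm _ _ (by simp)
  have hguu : ∀ j x, g j * (u * x) = -(u * (g j * x)) := fun j x => by
    rw [← mul_assoc, hgu, neg_mul, mul_assoc]
  have huux : ∀ x, u * (u * x) = x := fun x => by rw [← mul_assoc, huu, one_mul]
  have hm : ∀ x y, gradeInv ℛ (x * y) = gradeInv ℛ x * gradeInv ℛ y := gradeInv_mul ℛ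
  have hθu : gradeInv ℛ u = -u := E.gradeInv_gen _
  have hθe : gradeInv ℛ e = -e := E.gradeInv_gen _
  have hθg : ∀ j, gradeInv ℛ (g j) = -g j := fun j => E.gradeInv_gen _
  -- The generators of `S` go to `g_j u`, whose square is `g_j u g_j u = -g_j² u² = -1`. The
  -- relations hold because `u` anticommutes with every `g_j`.
  obtain ⟨K, hK, hKc⟩ := E'.exists_antiLift (o.untwist E.incl u) o.untwist_one
    (o.untwist_mul huu (E.rel.skew _)) (fun j => g j * u)
    (fun j => by
      rw [mul_assoc, hguu, ← mul_assoc (g j), hgg, one_mul, huu, map_neg, map_one])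
    (fun i j h => by
      have hij : g i * g j = -(g j * g i) := E.rel.anticomm _ _ (by simpa using h)
      rw [mul_assoc, mul_assoc, hguu, hguu, ← mul_assoc (g i), hij, neg_mul, mul_neg, mul_assoc])
    (fun j b => by
      induction b using o.induction with
      | h0 a ha =>
        rw [← o.map_gradeInv, gradeInv_even 𝒜 ha, o.untwist_even _ _ ha, mul_assoc,
          E.rel.map_even ha, ← mul_assoc, ← mul_assoc, E.rel.map_even ha]
      | h1 a ha =>
        rw [← o.map_gradeInv, gradeInv_odd 𝒜 ha, map_neg, map_neg, o.untwist_odd _ _ ha,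
          mul_neg, mul_assoc (E.incl a), ← neg_eq_iff_eq_neg.2 (hguu j u), huu, mul_one, mul_neg,
          mul_assoc (g j), ← mul_assoc u, E.rel.map_odd ha, neg_mul, mul_assoc (E.incl a), huu,
          mul_one, mul_neg, E.rel.map_odd ha, neg_neg]
      | hadd x y hx hy => simp only [map_add, add_mul, mul_add, hx, hy])
  -- The opposite of `R` is represented by two by two matrices over `S`. This representation will
  -- recover an element of `S` from its image in the corner.
  set D := twistedDiagonal 𝒮 with hD
  set U := swapMatrix S with hU
  set Z := signMatrix S with hZ
  have hUU : U * U = 1 := swapMatrix_mul_self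
  have hZZ : Z * Z = 1 := signMatrix_mul_self
  have hUZ : U * Z = -(Z * U) := swapMatrix_mul_signMatrix
  have hUD : ∀ s, U * D s = D (gradeInv 𝒮 s) * U := swapMatrix_mul_twistedDiagonal 𝒮
  have hZD : ∀ s, Z * D s = D s * Z := signMatrix_mul_twistedDiagonal 𝒮
  have hUDD : ∀ s t, U * D s * (U * D t) = D (gradeInv 𝒮 s * t) := fun s t => by
    rw [hUD, mul_assoc, ← mul_assoc U, hUU, one_mul, ← map_mul]
  have hUUD : ∀ s, gradeInv 𝒮 s = -s → U * (U * D s) = -(U * D s * U) := fun s h => by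
    rw [← mul_assoc, hUU, one_mul, hUD, h, map_neg, neg_mul, neg_mul, neg_neg, mul_assoc, hUU,
      mul_one]
  have hZUD : ∀ s, Z * (U * D s) = -(U * D s * Z) := fun s => by
    rw [mul_assoc, ← hZD, ← mul_assoc, ← mul_assoc, hUZ, neg_mul, neg_neg]
  have hff : ∀ j, E'.gen j * E'.gen j = -1 := fun j => (E'.rel.sq j).trans (by
    rw [map_neg, map_one])
  have hcc : -U * -U = 1 := by rw [neg_mul_neg, hUU]
  have hcf : ∀ b, -U * (D.comp E'.incl) b = (D.comp E'.incl) (gradeInv ℬ b) * -U := fun b => by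
    rw [neg_mul, AlgHom.comp_apply, hUD, mul_neg, E'.gradeInv_incl]
    rfl
  -- The values on `u` and `e` are the exchange matrix `U` and `diag(1, -1)`. The value `U D(f_j)`
  -- on `g_j`, with `f_j` the generators of `S`, is chosen so that `L(g_j u) = U U D(f_j) = D(f_j)`,
  -- and the twisting element `-U` so that `L(a u) = D(o(a))` for odd `a`.
  obtain ⟨L, hL, hLc⟩ := E.exists_antiLift (o.symm.untwist (D.comp E'.incl) (-U))
    o.symm.untwist_one (o.symm.untwist_mul hcc hcf)
    (Sum.elim ![U, Z] fun j => U * D (E'.gen j))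
    (by
      rintro (i | j)
      · fin_cases i
        · exact hUU.trans (map_one _).symm
        · exact hZZ.trans (map_one _).symm
      · change U * D _ * (U * D _) = algebraMap ℝ _ 1
        rw [hUDD, E'.gradeInv_gen, neg_mul, hff, neg_neg, map_one, map_one])
    (by
      rintro (i | j) (i' | j') h
      · fin_cases i <;> fin_cases i'
        · exact absurd rfl h
        · exact hUZ
        · exact neg_eq_iff_eq_neg.1 hUZ.symm
        · exact absurd rfl h
      · fin_cases i
        · exact hUUD _ (E'.gradeInv_gen j')
        · exact hZUD _
      · fin_cases i'
        · exact (neg_eq_iff_eq_neg.2 (hUUD _ (E'.gradeInv_gen j))).symm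
        · exact (neg_eq_iff_eq_neg.2 (hZUD _)).symm
      · change U * D _ * (U * D _) = -(U * D _ * (U * D _))
        rw [hUDD, hUDD, E'.gradeInv_gen, E'.gradeInv_gen, neg_mul, neg_mul,
          E'.rel.anticomm j j' (by simpa using h), neg_neg, map_neg, neg_neg])
    (by
      intro i a
      induction a using o.symm.induction with
      | h0 b hb =>
        rw [← o.symm.map_gradeInv, gradeInv_even ℬ hb, o.symm.untwist_even _ _ hb]
        change D (E'.incl b) * _ = _ * D (E'.incl b)
        have hUb : U * D (E'.incl b) = D (E'.incl b) * U := by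
          rw [hUD, E'.gradeInv_incl, gradeInv_even ℬ hb]
        rcases i with i | j
        · fin_cases i
          · exact hUb.symm
          · exact (hZD _).symm
        · change D (E'.incl b) * (U * D _) = U * D _ * D (E'.incl b)
          rw [mul_assoc, ← map_mul, E'.rel.map_even hb, map_mul, ← mul_assoc, ← mul_assoc, hUb]
      | h1 b hb =>
        rw [← o.symm.map_gradeInv, gradeInv_odd ℬ hb, map_neg, map_neg, o.symm.untwist_odd _ _ hb]
        change D (E'.incl b) * -U * _ = _ * -(D (E'.incl b) * -U)
        have hUb : U * D (E'.incl b) = -(D (E'.incl b) * U) := by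
          rw [hUD, E'.gradeInv_incl, gradeInv_odd ℬ hb, map_neg, map_neg, neg_mul]
        rw [mul_neg, neg_neg, neg_mul]
        rcases i with i | j
        · fin_cases i
          · change -(D (E'.incl b) * U * U) = U * (D (E'.incl b) * U)
            rw [← mul_assoc, hUb, neg_mul]
          · change -(D (E'.incl b) * U * Z) = Z * (D (E'.incl b) * U)
            rw [← mul_assoc, hZD, mul_assoc, hUZ, mul_neg, neg_neg, mul_assoc]
        · change -(D (E'.incl b) * U * (U * D _)) = U * D _ * (D (E'.incl b) * U)
          rw [mul_assoc, ← mul_assoc U U, hUU, one_mul, ← mul_assoc, mul_assoc U, ← map_mul D, ← map_mul D,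
            E'.rel.map_odd hb, map_neg, mul_neg, neg_mul, hUD, mul_assoc, hUU, mul_one,
            gradeInv_mul, E'.gradeInv_gen, E'.gradeInv_incl, gradeInv_odd ℬ hb, map_neg,
            neg_mul_neg]
      | hadd x y hx hy => simp only [map_add, add_mul, mul_add, hx, hy])
  have hLK : ∀ s, L (K s) = D s := fun s => by
    refine E'.induction_on s ?_ ?_ ?_ ?_
    · rw [hK.map_one, hL.map_one, map_one]
    · intro x y hx hy
      simp only [map_add, hx, hy]
    · intro b x hx
      rw [hK.map_mul, hL.map_mul, hx, hK.map_incl, map_mul]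
      congr 1
      induction b using o.induction with
      | h0 a ha =>
        rw [o.untwist_even _ _ ha, hL.map_incl]
        conv_lhs => rw [← o.symm_apply_apply a]
        rw [o.symm.untwist_even _ _ (o.map_even ha)]
        rfl
      | h1 a ha =>
        rw [o.untwist_odd _ _ ha, hL.map_mul, hL.map_incl, hL.map_gen]
        conv_lhs => rw [← o.symm_apply_apply a]
        rw [o.symm.untwist_odd _ _ (o.map_odd ha)]
        change U * (D (E'.incl _) * -U) = D (E'.incl _)
        rw [mul_neg, mul_neg, ← mul_assoc, hUD, E'.gradeInv_incl, gradeInv_odd ℬ (o.map_odd ha), map_neg,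
          map_neg, neg_mul, neg_mul, neg_neg, mul_assoc, hUU, mul_one]
      | hadd x y hx hy => simp only [map_add, hx, hy]
    · intro i x hx
      rw [hK.map_mul, hL.map_mul, hx, hK.map_gen, hL.map_mul, hL.map_gen, hL.map_gen, map_mul]
      change U * (U * D (E'.gen i)) * _ = _
      rw [← mul_assoc, hUU, one_mul]
  -- The image of `K` is generated by even elements of `R`: even `a`, `a u` with `a` odd, and `g_j
  -- u`.
  have hKθ : ∀ s, gradeInv ℛ (K s) = K s := fun s => by
    refine E'.induction_on s ?_ ?_ ?_ ?_
    · rw [hK.map_one, gradeInv_even ℛ SetLike.GradedOne.one_mem]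
    · intro x y hx hy
      simp only [map_add, hx, hy]
    · intro b x hx
      rw [hK.map_mul, hm, hx, hK.map_incl]
      congr 1
      induction b using o.induction with
      | h0 a ha => rw [o.untwist_even _ _ ha, E.gradeInv_incl, gradeInv_even 𝒜 ha]
      | h1 a ha =>
        rw [o.untwist_odd _ _ ha, hm, E.gradeInv_incl, gradeInv_odd 𝒜 ha, hθu, map_neg, neg_mul_neg]
      | hadd x y hx hy => simp only [map_add, hx, hy]
    · intro i x hx
      rw [hK.map_mul, hm, hx, hK.map_gen, hm, hθg, hθu, neg_mul_neg]
  -- In `a u` with `a` odd and in `g_j u` the generator `e` anticommutes with both factors, so it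
  -- commutes with the product.
  have heK : ∀ s, e * K s = K s * e := fun s => by
    refine E'.induction_on s ?_ ?_ ?_ ?_
    · rw [hK.map_one, one_mul, mul_one]
    · intro x y hx hy
      simp only [map_add, add_mul, mul_add, hx, hy]
    · intro b x hx
      rw [hK.map_mul, ← mul_assoc, hx, mul_assoc, mul_assoc, hK.map_incl]
      congr 1
      induction b using o.induction with
      | h0 a ha => rw [o.untwist_even _ _ ha, E.rel.map_even ha]
      | h1 a ha =>
        rw [o.untwist_odd _ _ ha, ← mul_assoc, E.rel.map_odd ha, neg_mul, mul_assoc, heu, mul_neg,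
          neg_neg, mul_assoc]
      | hadd x y hx hy => simp only [map_add, add_mul, mul_add, hx, hy]
    · intro j x hx
      have h : e * (g j * u) = g j * u * e := by
        rw [mul_assoc, ← neg_eq_iff_eq_neg.2 heu, mul_neg, ← mul_assoc, ← mul_assoc, hge, neg_mul,
          neg_neg]
      rw [hK.map_mul, ← mul_assoc, hx, mul_assoc, mul_assoc, hK.map_gen, h]
  -- All values of `K` being even in `R`, the grading of `S` is visible only through conjugation by
  -- `u`.
  have huK : ∀ s, u * K s = K (gradeInv 𝒮 s) * u := fun s => by
    refine E'.induction_on s ?_ ?_ ?_ ?_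
    · rw [gradeInv_even 𝒮 SetLike.GradedOne.one_mem, hK.map_one, one_mul, mul_one]
    · intro x y hx hy
      simp only [map_add, add_mul, mul_add, hx, hy]
    · intro b x hx
      rw [gradeInv_mul, hK.map_mul, hK.map_mul, ← mul_assoc, hx, mul_assoc, mul_assoc,
        E'.gradeInv_incl, hK.map_incl, hK.map_incl]
      congr 1
      induction b using o.induction with
      | h0 a ha =>
        rw [← o.map_gradeInv, gradeInv_even 𝒜 ha, o.untwist_even _ _ ha, E.rel.map_even ha]
      | h1 a ha =>
        rw [← o.map_gradeInv, gradeInv_odd 𝒜 ha, map_neg, map_neg, o.untwist_odd _ _ ha,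
          ← mul_assoc, E.rel.map_odd ha, neg_mul]
      | hadd x y hx hy => simp only [map_add, add_mul, mul_add, hx, hy]
    · intro j x hx
      rw [gradeInv_mul, hK.map_mul, hK.map_mul, ← mul_assoc, hx, mul_assoc, mul_assoc,
        E'.gradeInv_gen, map_neg, hK.map_gen, ← mul_assoc u, ← neg_eq_iff_eq_neg.2 (hgu j)]
  set p : R := (2⁻¹ : ℝ) • (1 + e) with hp
  have hep : e * p = p := by
    rw [hp, mul_smul_comm, mul_add, mul_one, hee, add_comm]
  have hpe : p * e = p := by
    rw [hp, smul_mul_assoc, add_mul, one_mul, hee, add_comm]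
  have hpp : p * p = p := by
    conv_lhs => enter [1]; rw [hp]
    rw [smul_mul_assoc, add_mul, one_mul, hep, ← two_smul ℝ, smul_smul, inv_mul_cancel₀ two_ne_zero,
      one_smul]
  have hpu : p * u = u * ((2⁻¹ : ℝ) • (1 - e)) := by
    rw [hp, smul_mul_assoc, add_mul, heu, mul_smul_comm, mul_sub, one_mul, mul_one, sub_eq_add_neg]
  have hupu : u * p * u = (2⁻¹ : ℝ) • (1 - e) := by rw [mul_assoc, hpu, huux]
  have hpK : ∀ s, p * K s = K s * p := fun s => by
    rw [hp, smul_mul_assoc, mul_smul_comm, add_mul, mul_add, heK, one_mul, mul_one]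
  -- Passing `u` to the left turns `p` into the complementary idempotent `(1 - e) / 2`, which
  -- annihilates `p`.
  have hpup : p * u * p = 0 := by
    rw [hpu, mul_assoc, smul_mul_assoc, sub_mul, one_mul, hep, sub_self, smul_zero, mul_zero]
  have hKc' := hKc (o.continuous_untwist _ _ hA E.continuous_incl)
  have hLc' := hLc (o.symm.continuous_untwist _ _ hB
    ((continuous_twistedDiagonal 𝒮 hS).comp E'.continuous_incl))
  -- Under `L`, `K(s) p` becomes `diag(1, 0) · diag(s, θ(s))`, so its upper left entry is `s`.
  let proj : R →ₗ[ℝ] S := Matrix.entryLinearMap ℝ S 0 0 ∘ₗ L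
  have hproj : Continuous proj := (continuous_apply_apply (0 : Fin 2) (0 : Fin 2)).comp hLc'
  have hprojK : ∀ s, proj (K s * p) = s := fun s => by
    change L (K s * p) 0 0 = s
    rw [hL.map_mul, hLK, hp, map_smul, map_add, hL.map_one, hL.map_gen]
    change (((2⁻¹ : ℝ) • (1 + Z)) * D s) 0 0 = s
    have h : (Z * D s) 0 0 = s := by
      simp [hZ, hD, signMatrix, twistedDiagonal_apply]
    rw [smul_mul_assoc, add_mul, one_mul, Matrix.smul_apply, Matrix.add_apply, h]
    change (2⁻¹ : ℝ) • (s + s) = s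
    module
  -- The sum `K(S) p + u K(S) p` is the whole ideal `R p`: it contains `p` and is stable under left
  -- multiplication by `K(S)`, `u` and `e`. The remaining generators reduce to these, as odd `a`
  -- equals `K(o(a)) u` and `g_j` equals `K(f_j) u`.
  have hT : ∀ r, ∃ s t, r * p = K s * p + u * (K t * p) := fun r => by
    have hKT : ∀ s x, (∃ s t, x = K s * p + u * (K t * p)) →
        ∃ s' t, K s * x = K s' * p + u * (K t * p) := by
      rintro s _ ⟨t, t', rfl⟩
      refine ⟨t * s, t' * gradeInv 𝒮 s, ?_⟩
      have h := huK (gradeInv 𝒮 s)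
      rw [gradeInv_gradeInv] at h
      rw [mul_add, hK.map_mul, hK.map_mul, ← mul_assoc (K s) u, ← h]
      simp only [mul_assoc]
    have huT : ∀ x, (∃ s t, x = K s * p + u * (K t * p)) →
        ∃ s t, u * x = K s * p + u * (K t * p) := by
      rintro _ ⟨t, t', rfl⟩
      exact ⟨t', t, by rw [mul_add, huux, add_comm]⟩
    refine E.induction_on r ⟨1, 0, ?_⟩ ?_ ?_ ?_
    · rw [hK.map_one, map_zero, zero_mul, mul_zero, add_zero]
    · rintro x y ⟨s, t, h⟩ ⟨s', t', h'⟩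
      refine ⟨s + s', t + t', ?_⟩
      rw [add_mul, h, h', map_add, map_add, add_mul, add_mul, mul_add]
      abel
    · intro a x hx
      rw [mul_assoc]
      obtain ⟨y, hy⟩ : ∃ y, y = x * p := ⟨_, rfl⟩
      rw [← hy] at hx ⊢
      induction a using grade_induction 𝒜 with
      | h0 a ha =>
        have h := hK.map_incl (o.toLinearEquiv a)
        rw [o.untwist_even _ _ ha] at h
        rw [← h]
        exact hKT _ _ hx
      | h1 a ha =>
        have h := hK.map_incl (o.toLinearEquiv a)
        rw [o.untwist_odd _ _ ha] at h
        have h2 : E.incl a = K (E'.incl (o.toLinearEquiv a)) * u := by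
          rw [h, mul_assoc, huu, mul_one]
        rw [h2, mul_assoc]
        exact hKT _ _ (huT _ hx)
      | hadd a b ha hb =>
        obtain ⟨s, t, h⟩ := ha
        obtain ⟨s', t', h'⟩ := hb
        refine ⟨s + s', t + t', ?_⟩
        rw [map_add, add_mul, h, h', map_add, map_add, add_mul, add_mul, mul_add]
        abel
    · rintro (i | j) x hx
      · fin_cases i
        · rw [mul_assoc]
          exact huT _ hx
        · obtain ⟨s, t, h⟩ := hx
          refine ⟨s, -t, ?_⟩
          change e * x * p = _
          rw [mul_assoc, h, mul_add, ← mul_assoc e, heK, mul_assoc, hep, ← mul_assoc e, heu, neg_mul,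
            mul_assoc u, ← mul_assoc e, heK, mul_assoc (K t), hep, map_neg, neg_mul, mul_neg]
      · have h2 : E.gen (.inr j) = K (E'.gen j) * u := by
          rw [hK.map_gen, mul_assoc, huu, mul_one]
        rw [h2, mul_assoc, mul_assoc]
        exact hKT _ _ (huT _ hx)
  -- Multiplying by `p` on the left kills the second summand, because `K` commutes with `p` and `p u
  -- p = 0`.
  have hpT : ∀ r, ∃ s, p * r * p = K s * p := fun r => by
    obtain ⟨s, t, h⟩ := hT r
    refine ⟨s, ?_⟩
    rw [mul_assoc, h, mul_add, ← mul_assoc, hpK, mul_assoc, hpp, ← hpK t, ← mul_assoc, ← mul_assoc,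
      hpup, zero_mul, add_zero]
  -- Fullness is `p + u p u = (1 + e) / 2 + (1 - e) / 2 = 1`.
  exact ⟨Corner.ofAntiMap p u ⟨2, ![1, u], ![1, u], by
    rw [Fin.sum_univ_two]
    change 1 * p * 1 + u * p * u = 1
    rw [one_mul, mul_one, hupu, hp]
    module⟩ hpp huu hθu (by
      rw [hupu, hp, map_smul, map_add, hθe, gradeInv_even ℛ SetLike.GradedOne.one_mem,
        sub_eq_add_neg]) K
    hK.map_one hK.map_mul hpK (fun s => by rw [hKθ, huK, mul_assoc, huu, mul_one]) hKc' proj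
    hprojK hpT hproj, K, hK, rfl, rfl, fun s => rfl⟩

end CliffordCorner


/-! ### The grading involution of a graded real C*-algebra is continuous -/

section CStarContinuity

/-- An element of norm less than one of a Banach algebra without unit has a left quasi-inverse. -/
theorem exists_left_quasiInverse {A : Type u} [NonUnitalNormedRing A] [CompleteSpace A] (k : A)
    (hk : ‖k‖ < 1) : ∃ g : A, k + g * k = g := by
  -- The equation for `g` is a fixed point equation of a map with Lipschitz constant at most `‖k‖`.
  have h : ContractingWith ‖k‖₊ (fun x : A => k + x * k) := by
    refine ⟨by exact_mod_cast hk, LipschitzWith.of_dist_le_mul fun x y => ?_⟩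
    rw [dist_add_left, dist_eq_norm, dist_eq_norm, ← sub_mul, mul_comm (‖k‖₊ : ℝ)]
    exact norm_mul_le _ _
  exact ⟨h.fixedPoint, h.fixedPoint_isFixedPt⟩

/-- On a Hilbert space, `‖c‖² - c* c` has no left inverse unless `c = 0`. -/
theorem not_left_inverse_of_norm_sq {H : Type u} [NormedAddCommGroup H] [InnerProductSpace ℝ H]
    [CompleteSpace H] (c G : H →L[ℝ] H) (hc : 0 < ‖c‖)
    (h : (‖c‖ ^ 2)⁻¹ • (star c * c) + G * ((‖c‖ ^ 2)⁻¹ • (star c * c)) = G) : False := by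
  set l := ‖c‖ ^ 2 with hl
  have hl0 : 0 < l := by positivity
  set T := star c * c with hT
  -- The hypothesis says `(1 + G)(1 - l⁻¹ T) = 1`, hence `l - T` is bounded below.
  have h1 : ∀ x, ‖x‖ ≤ (1 + ‖G‖) * (l⁻¹ * ‖l • x - T x‖) := fun x => by
    have e : x = (1 + G) (l⁻¹ • (l • x - T x)) := by
      have hx := congrArg (fun f : H →L[ℝ] H => f x) h
      simp only [add_apply, smul_apply, mul_apply_eq_comp, map_smul] at hx
      rw [smul_sub, smul_smul, inv_mul_cancel₀ hl0.ne', one_smul, map_sub,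
        add_apply, add_apply, one_apply_eq_self, one_apply_eq_self, map_smul, hx,
        add_sub_cancel_right]
    calc ‖x‖ = ‖(1 + G) (l⁻¹ • (l • x - T x))‖ := by rw [← e]
      _ ≤ ‖(1 + G)‖ * ‖l⁻¹ • (l • x - T x)‖ := ContinuousLinearMap.le_opNorm _ _
      _ ≤ (1 + ‖G‖) * (l⁻¹ * ‖l • x - T x‖) := by
        rw [norm_smul, Real.norm_of_nonneg (inv_nonneg.2 hl0.le)]
        gcongr
        exact (norm_add_le _ _).trans (by gcongr; exact ContinuousLinearMap.norm_id_le)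
  -- Vectors on which `c` nearly attains its norm are nearly eigenvectors of `c* c` for the
  -- eigenvalue `l = ‖c‖²`.
  have h2 : ∀ x, ‖l • x - T x‖ ^ 2 ≤ l * (l * ‖x‖ ^ 2 - ‖c x‖ ^ 2) := fun x => by
    have hTx : T x = ContinuousLinearMap.adjoint c (c x) := rfl
    have e1 : inner ℝ x (T x) = ‖c x‖ ^ 2 := by
      rw [hTx, ContinuousLinearMap.adjoint_inner_right, real_inner_self_eq_norm_sq]
    have e2 : ‖T x‖ ^ 2 ≤ l * ‖c x‖ ^ 2 := by
      rw [hTx, hl, ← mul_pow]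
      gcongr
      refine (ContinuousLinearMap.le_opNorm _ _).trans ?_
      rw [LinearIsometryEquiv.norm_map]
    rw [norm_sub_sq_real, inner_smul_left, e1, norm_smul, Real.norm_of_nonneg hl0.le, mul_pow]
    simp only [conj_trivial]
    nlinarith
  set C := ((1 + ‖G‖) * l⁻¹) ^ 2 * l with hC
  have hC0 : 0 < C := by positivity
  -- Together the two estimates leave a gap `C⁻¹`: they give `‖c‖² ≤ l - C⁻¹`, against `‖c‖² = l`.
  have h3 : ∀ x, ‖c x‖ ^ 2 ≤ (l - C⁻¹) * ‖x‖ ^ 2 := fun x => by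
    have h4 : ‖x‖ ^ 2 ≤ C * (l * ‖x‖ ^ 2 - ‖c x‖ ^ 2) := by
      calc ‖x‖ ^ 2 ≤ ((1 + ‖G‖) * l⁻¹ * ‖l • x - T x‖) ^ 2 := by
            rw [mul_assoc]
            exact pow_le_pow_left₀ (norm_nonneg _) (h1 x) 2
        _ ≤ ((1 + ‖G‖) * l⁻¹) ^ 2 * (l * (l * ‖x‖ ^ 2 - ‖c x‖ ^ 2)) := by
            rw [mul_pow]
            gcongr
            exact h2 x
        _ = _ := by rw [hC]; ring
    have h5 : C⁻¹ * ‖x‖ ^ 2 ≤ l * ‖x‖ ^ 2 - ‖c x‖ ^ 2 := by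
      rwa [inv_mul_le_iff₀ hC0]
    linarith
  have h6 : ‖c‖ ≤ Real.sqrt (l - C⁻¹) := by
    refine ContinuousLinearMap.opNorm_le_bound _ (Real.sqrt_nonneg _) fun x => ?_
    rw [← Real.sqrt_sq (norm_nonneg x), ← Real.sqrt_mul' _ (sq_nonneg _)]
    exact Real.le_sqrt_of_sq_le (h3 x)
  rw [Real.le_sqrt' hc, ← hl] at h6
  have h7 : 0 < C⁻¹ := inv_pos.2 hC0
  linarith

variable {A : Type u} [NonUnitalNormedRing A] [NormedSpace ℝ A] [StarRing A]
  (𝒜 : ZMod 2 → Submodule ℝ A) [DirectSum.Decomposition 𝒜]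

variable {𝒜} in
theorem IsGradedRealCStarAlgebra.gradeInv_star (h : IsGradedRealCStarAlgebra 𝒜) (a : A) :
    gradeInv 𝒜 (star a) = star (gradeInv 𝒜 a) := by
  induction a using grade_induction 𝒜 with
  | h0 a ha => rw [gradeInv_even 𝒜 ha, gradeInv_even 𝒜 (h.star_mem 0 a ha)]
  | h1 a ha => rw [gradeInv_odd 𝒜 ha, gradeInv_odd 𝒜 (h.star_mem 1 a ha), star_neg]
  | hadd a b ha hb => rw [star_add, map_add, ha, hb, map_add, star_add]

-- Suppose `‖a‖ < ‖θ(a)‖` and let `c` represent `θ(a)`. Then `‖c‖⁻² a* a` has norm less than one and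
-- so has a left quasi-inverse. Applying `θ`, which is multiplicative and commutes with the
-- involution, gives one for `‖c‖⁻² c* c`, which is impossible on a Hilbert space. No continuity of
-- `θ` is presupposed, since quasi-invertibility is algebraic.
variable {𝒜} in
theorem IsGradedRealCStarAlgebra.norm_gradeInv_le [IsScalarTower ℝ A A] [SetLike.GradedMul 𝒜]
    (h : IsGradedRealCStarAlgebra 𝒜) (a : A) : ‖gradeInv 𝒜 a‖ ≤ ‖a‖ := by
  obtain ⟨H, _, _, _, φ, hφ⟩ := h.exists_representation
  have := h.complete
  have hn : ∀ x, ‖φ x‖ = ‖x‖ := fun x => by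
    simpa using hφ.dist_eq x 0
  by_contra hlt
  rw [not_le] at hlt
  set c := φ (gradeInv 𝒜 a) with hc
  rw [← hn (gradeInv 𝒜 a), ← hc] at hlt
  have hc0 : 0 < ‖c‖ := (norm_nonneg a).trans_lt hlt
  have hk : ‖(‖c‖ ^ 2)⁻¹ • (star a * a)‖ < 1 := by
    rw [norm_smul, norm_inv, norm_pow, norm_norm, inv_mul_lt_iff₀ (by positivity), mul_one,
      ← hn, map_mul, map_star]
    refine (norm_mul_le _ _).trans_lt ?_
    have hs : ‖star (φ a)‖ = ‖φ a‖ := LinearIsometryEquiv.norm_map ContinuousLinearMap.adjoint _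
    rw [hs, hn, ← sq]
    gcongr
  obtain ⟨g, hg⟩ := exists_left_quasiInverse _ hk
  refine not_left_inverse_of_norm_sq c (φ (gradeInv 𝒜 g)) hc0 ?_
  -- The representation composed with `θ` transports the algebraic identity to operators.
  have e := congrArg (fun x => φ (gradeInv 𝒜 x)) hg
  simp only [map_add, gradeInv_mul, map_smul, map_mul, h.gradeInv_star, map_star] at e
  exact e

variable {𝒜} in
theorem IsGradedRealCStarAlgebra.continuous_gradeInv [IsScalarTower ℝ A A] [SetLike.GradedMul 𝒜]
    (h : IsGradedRealCStarAlgebra 𝒜) : Continuous (gradeInv 𝒜) :=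
  AddMonoidHomClass.continuous_of_bound (gradeInv 𝒜) 1 fun a => by
    rw [one_mul]
    exact h.norm_gradeInv_le a

end CStarContinuity


/-! ### The graded anti-isomorphisms `A → A^op` and `A_+ → (A^op)_+` -/

namespace GradedOp

section NonUnital

variable {A : Type u} [NonUnitalRing A] [Module ℝ A] (𝒜 : ZMod 2 → Submodule ℝ A)
  [TopologicalSpace A]

theorem continuous_op : Continuous (op 𝒜) := continuous_id

theorem continuous_op_symm : Continuous (op 𝒜).symm := continuous_id

instance [IsTopologicalAddGroup A] : IsTopologicalAddGroup (GradedOp 𝒜) :=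
  inferInstanceAs (IsTopologicalAddGroup A)

variable [DirectSum.Decomposition 𝒜]

theorem gradeInv_op (a : A) : gradeInv (grading 𝒜) (op 𝒜 a) = op 𝒜 (gradeInv 𝒜 a) := rfl

/-- The components of the decomposition are replaced by parity projections, which are continuous
when `θ` is. -/
theorem op_mul_eq (a b : A) :
    op 𝒜 a * op 𝒜 b = op 𝒜 (b * evenPart 𝒜 a + gradeInv 𝒜 b * oddPart 𝒜 a) := by
  conv_lhs => rw [← evenPart_add_oddPart 𝒜 a, map_add, add_mul']
  rw [even_op_mul 𝒜 (evenPart_mem 𝒜 a), odd_op_mul 𝒜 (oddPart_mem 𝒜 a), map_add]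

theorem continuousMul [IsTopologicalAddGroup A] [ContinuousMul A] [ContinuousSMul ℝ A]
    (hA : Continuous (gradeInv 𝒜)) : ContinuousMul (GradedOp 𝒜) := by
  refine ⟨?_⟩
  have e : (fun x : GradedOp 𝒜 × GradedOp 𝒜 => x.1 * x.2) = fun x =>
      op 𝒜 ((op 𝒜).symm x.2 * evenPart 𝒜 ((op 𝒜).symm x.1) +
        gradeInv 𝒜 ((op 𝒜).symm x.2) * oddPart 𝒜 ((op 𝒜).symm x.1)) :=
    funext fun x => op_mul_eq 𝒜 _ _
  have h1 := (continuous_op_symm 𝒜).comp (continuous_fst (X := GradedOp 𝒜) (Y := GradedOp 𝒜))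
  have h2 := (continuous_op_symm 𝒜).comp (continuous_snd (X := GradedOp 𝒜) (Y := GradedOp 𝒜))
  rw [e]
  exact (continuous_op 𝒜).comp ((h2.mul ((continuous_evenPart 𝒜 hA).comp h1)).add
    ((hA.comp h2).mul ((continuous_oddPart 𝒜 hA).comp h1)))

end NonUnital

section Unital

variable {A : Type u} [Ring A] [Algebra ℝ A] [TopologicalSpace A] (𝒜 : ZMod 2 → Submodule ℝ A)
  [GradedAlgebra 𝒜]

/-- The identity map `A → A^op`. -/
noncomputable def antiEquiv : GradedAntiEquiv 𝒜 (grading 𝒜) where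
  __ := op 𝒜
  continuous_toFun := continuous_op 𝒜
  continuous_invFun := continuous_op_symm 𝒜
  map_one := rfl
  map_gradeInv _ := rfl
  even_mul _ ha b := even_op_mul 𝒜 ha b
  odd_mul _ ha b := odd_op_mul 𝒜 ha b

theorem isTopologicalRing [IsTopologicalRing A] [ContinuousSMul ℝ A]
    (hA : Continuous (gradeInv 𝒜)) : IsTopologicalRing (GradedOp 𝒜) :=
  have : ContinuousMul (GradedOp 𝒜) := continuousMul 𝒜 hA
  { continuous_neg := (continuous_neg : Continuous fun x : GradedOp 𝒜 => -x) }

end Unital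

end GradedOp

namespace AddUnit

variable {A : Type u} [NonUnitalRing A] [Module ℝ A] [IsScalarTower ℝ A A] [SMulCommClass ℝ A A]
  (𝒜 : ZMod 2 → Submodule ℝ A)

section Topology

variable [TopologicalSpace A]

theorem continuous_vectorPart : Continuous (vectorPart A) :=
  continuous_snd.comp (continuous_induced_dom :
    Continuous ((augmentation A).toLinearMap.prod (vectorPart A)))

theorem continuous_of_parts {X : Type*} [TopologicalSpace X] {f : X → AddUnit A}
    (h1 : Continuous fun x => augmentation A (f x)) (h2 : Continuous fun x => vectorPart A (f x)) :
    Continuous f :=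
  continuous_induced_rng.2 (h1.prodMk h2)

theorem isTopologicalRing [IsTopologicalAddGroup A] [ContinuousMul A] [ContinuousSMul ℝ A] :
    IsTopologicalRing (AddUnit A) := by
  have h1 : Continuous fun x : AddUnit A × AddUnit A => augmentation A x.1 :=
    continuous_augmentation.comp continuous_fst
  have h2 : Continuous fun x : AddUnit A × AddUnit A => augmentation A x.2 :=
    continuous_augmentation.comp continuous_snd
  have h3 : Continuous fun x : AddUnit A × AddUnit A => vectorPart A x.1 :=
    continuous_vectorPart.comp continuous_fst
  have h4 : Continuous fun x : AddUnit A × AddUnit A => vectorPart A x.2 :=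
    continuous_vectorPart.comp continuous_snd
  have hadd : ContinuousAdd (AddUnit A) := by
    refine ⟨continuous_of_parts ?_ ?_⟩
    · simp only [map_add]
      exact h1.add h2
    · simp only [map_add]
      exact h3.add h4
  have hmul : ContinuousMul (AddUnit A) := by
    refine ⟨continuous_of_parts ?_ ?_⟩
    · simp only [map_mul]
      exact h1.mul h2
    · simp only [vectorPart_mul]
      exact ((h1.smul h4).add (h2.smul h3)).add (h3.mul h4)
  exact isTopologicalRing_of_continuousMul_of_real _

end Topology

variable [DirectSum.Decomposition 𝒜]

/-- This makes `θ` on `A_+` explicit: the identity on the scalar part and the given `θ` on the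
vector part. -/
theorem gradeInv_eq_involution (x : AddUnit A) : gradeInv (grading 𝒜) x = involution 𝒜 x := by
  induction x using grade_induction (grading 𝒜) with
  | h0 x hx =>
    rw [gradeInv_even _ hx]
    refine ext_parts (augmentation_involution 𝒜 x).symm ?_
    rw [vectorPart_involution, gradeInv_even 𝒜 hx.1]
  | h1 x hx =>
    rw [gradeInv_odd _ hx]
    refine ext_parts ?_ ?_
    · rw [augmentation_involution, map_neg, hx.2 rfl, neg_zero]
    · rw [vectorPart_involution, gradeInv_odd 𝒜 hx.1, map_neg]
  | hadd x y hx hy => rw [map_add, map_add, hx, hy]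

theorem augmentation_gradeInv (x : AddUnit A) :
    augmentation A (gradeInv (grading 𝒜) x) = augmentation A x := by
  rw [gradeInv_eq_involution, augmentation_involution]

theorem vectorPart_gradeInv (x : AddUnit A) :
    vectorPart A (gradeInv (grading 𝒜) x) = gradeInv 𝒜 (vectorPart A x) := by
  rw [gradeInv_eq_involution, vectorPart_involution]

theorem continuous_gradeInv [TopologicalSpace A] (hA : Continuous (gradeInv 𝒜)) :
    Continuous (gradeInv (grading 𝒜)) := by
  refine continuous_of_parts ?_ ?_
  · simp only [augmentation_gradeInv]
    exact continuous_augmentation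
  · simp only [vectorPart_gradeInv]
    exact hA.comp continuous_vectorPart

/-- The linear map `A_+ → B_+` that extends a linear map `A → B`. -/
noncomputable def mapParts {B : Type u} [NonUnitalRing B] [Module ℝ B] [IsScalarTower ℝ B B]
    [SMulCommClass ℝ B B] (f : A →ₗ[ℝ] B) : AddUnit A →ₗ[ℝ] AddUnit B :=
  Algebra.linearMap ℝ (AddUnit B) ∘ₗ (augmentation A).toLinearMap + incl B ∘ₗ f ∘ₗ vectorPart A

theorem augmentation_mapParts {B : Type u} [NonUnitalRing B] [Module ℝ B] [IsScalarTower ℝ B B]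
    [SMulCommClass ℝ B B] (f : A →ₗ[ℝ] B) (x : AddUnit A) :
    augmentation B (mapParts f x) = augmentation A x := by
  change augmentation B (algebraMap ℝ (AddUnit B) (augmentation A x) +
    incl B (f (vectorPart A x))) = _
  rw [map_add, AlgHom.commutes]
  exact add_zero _

theorem vectorPart_mapParts {B : Type u} [NonUnitalRing B] [Module ℝ B] [IsScalarTower ℝ B B]
    [SMulCommClass ℝ B B] (f : A →ₗ[ℝ] B) (x : AddUnit A) :
    vectorPart B (mapParts f x) = f (vectorPart A x) :=
  zero_add _

theorem mapParts_mapParts {B : Type u} [NonUnitalRing B] [Module ℝ B] [IsScalarTower ℝ B B]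
    [SMulCommClass ℝ B B] (f : A →ₗ[ℝ] B) (g : B →ₗ[ℝ] A) (h : ∀ x, f (g x) = x)
    (x : AddUnit B) : mapParts f (mapParts g x) = x :=
  ext_parts (by rw [augmentation_mapParts, augmentation_mapParts])
    (by rw [vectorPart_mapParts, vectorPart_mapParts, h])

variable [SetLike.GradedMul 𝒜]

/-- The identity map `A_+ → (A^op)_+` as a linear equivalence. -/
noncomputable def opEquiv : AddUnit A ≃ₗ[ℝ] AddUnit (GradedOp 𝒜) :=
  LinearEquiv.ofLinearMap (mapParts (GradedOp.op 𝒜).toLinearMap)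
    (mapParts (GradedOp.op 𝒜).symm.toLinearMap)
    (LinearMap.ext (mapParts_mapParts _ _ (GradedOp.op 𝒜).apply_symm_apply))
    (LinearMap.ext (mapParts_mapParts _ _ (GradedOp.op 𝒜).symm_apply_apply))

theorem augmentation_opEquiv (x : AddUnit A) :
    augmentation (GradedOp 𝒜) (opEquiv 𝒜 x) = augmentation A x := augmentation_mapParts _ _

theorem vectorPart_opEquiv (x : AddUnit A) :
    vectorPart (GradedOp 𝒜) (opEquiv 𝒜 x) = GradedOp.op 𝒜 (vectorPart A x) :=
  vectorPart_mapParts _ _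

theorem continuous_mapParts {B : Type u} [NonUnitalRing B] [Module ℝ B] [IsScalarTower ℝ B B]
    [SMulCommClass ℝ B B] [TopologicalSpace A] [TopologicalSpace B] (f : A →ₗ[ℝ] B)
    (hf : Continuous f) : Continuous (mapParts f) := by
  refine continuous_of_parts ?_ ?_
  · simp only [augmentation_mapParts]
    exact continuous_augmentation
  · simp only [vectorPart_mapParts]
    exact hf.comp continuous_vectorPart

/-- The identity map `A_+ → (A^op)_+`. -/
noncomputable def antiEquiv [TopologicalSpace A] :
    GradedAntiEquiv (grading 𝒜) (grading (GradedOp.grading 𝒜)) where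
  __ := opEquiv 𝒜
  continuous_toFun := continuous_mapParts _ (GradedOp.continuous_op 𝒜)
  continuous_invFun := continuous_mapParts _ (GradedOp.continuous_op_symm 𝒜)
  map_one := ext_parts ((augmentation_opEquiv 𝒜 1).trans (by rw [map_one, map_one]))
    ((vectorPart_opEquiv 𝒜 1).trans (by rw [vectorPart_one, vectorPart_one, map_zero]))
  map_gradeInv x := ext_parts
    (by
      rw [augmentation_opEquiv, augmentation_gradeInv, augmentation_gradeInv, augmentation_opEquiv])
    (by
      rw [vectorPart_opEquiv, vectorPart_gradeInv, vectorPart_gradeInv, vectorPart_opEquiv,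
        GradedOp.gradeInv_op])
  even_mul x hx y := ext_parts
    (by
      rw [map_mul, augmentation_opEquiv, augmentation_opEquiv, augmentation_opEquiv, map_mul,
        mul_comm])
    (by
      rw [vectorPart_mul, augmentation_opEquiv, augmentation_opEquiv, vectorPart_opEquiv,
        vectorPart_opEquiv, vectorPart_opEquiv, vectorPart_mul, GradedOp.even_op_mul 𝒜 hx.1,
        map_add, map_add, map_smul, map_smul, add_comm (augmentation A x • _)])
  odd_mul x hx y := ext_parts
    (by
      rw [map_mul, augmentation_opEquiv, augmentation_opEquiv, augmentation_opEquiv, map_mul,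
        hx.2 rfl, mul_zero, zero_mul])
    (by
      rw [vectorPart_mul, augmentation_opEquiv, augmentation_opEquiv, vectorPart_opEquiv,
        vectorPart_opEquiv, vectorPart_opEquiv, vectorPart_mul, GradedOp.odd_op_mul 𝒜 hx.1,
        hx.2 rfl, zero_smul, zero_smul, zero_add, add_zero, augmentation_gradeInv,
        vectorPart_gradeInv, map_add, map_smul])

theorem augmentation_antiEquiv [TopologicalSpace A] (x : AddUnit A) :
    augmentation (GradedOp 𝒜) ((antiEquiv 𝒜).toLinearEquiv x) = augmentation A x :=
  augmentation_opEquiv 𝒜 x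

end AddUnit

/-- The identity map of `ℝ` as a graded anti-isomorphism. -/
noncomputable def realAntiEquiv : GradedAntiEquiv realGrading realGrading where
  __ := LinearEquiv.refl ℝ ℝ
  continuous_toFun := continuous_id
  continuous_invFun := continuous_id
  map_one := rfl
  map_gradeInv _ := rfl
  even_mul a _ b := mul_comm a b
  odd_mul a ha b := by
    rw [mem_realGrading_one.1 ha]
    simp


/-! ### Naturality of the corners, and the theorem -/

section Naturality

variable {A B A' B' R S R' S' : Type*}
  [Ring A] [Algebra ℝ A] [TopologicalSpace A] [Ring B] [Algebra ℝ B] [TopologicalSpace B]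
  [Ring A'] [Algebra ℝ A'] [TopologicalSpace A'] [Ring B'] [Algebra ℝ B'] [TopologicalSpace B']
  {𝒜 : ZMod 2 → Submodule ℝ A} {ℬ : ZMod 2 → Submodule ℝ B}
  {𝒜' : ZMod 2 → Submodule ℝ A'} {ℬ' : ZMod 2 → Submodule ℝ B'}
  [GradedAlgebra 𝒜] [GradedAlgebra ℬ] [GradedAlgebra 𝒜'] [GradedAlgebra ℬ']

theorem GradedHom.map_evenPart (φ : GradedHom 𝒜 𝒜') (a : A) :
    φ.toAlgHom (evenPart 𝒜 a) = evenPart 𝒜' (φ.toAlgHom a) := by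
  rw [evenPart_apply, evenPart_apply, map_smul, map_add, φ.map_gradeInv]

theorem GradedHom.map_oddPart (φ : GradedHom 𝒜 𝒜') (a : A) :
    φ.toAlgHom (oddPart 𝒜 a) = oddPart 𝒜' (φ.toAlgHom a) := by
  rw [oddPart_apply, oddPart_apply, map_smul, map_sub, φ.map_gradeInv]

end Naturality

/-! ### Kernels of base change for Clifford extensions -/

section Main

variable {A B R S : Type w} {A' B' R' S' : Type v}
  [Ring A] [Algebra ℝ A] [TopologicalSpace A] [IsTopologicalRing A] [ContinuousSMul ℝ A]
  [Ring B] [Algebra ℝ B] [TopologicalSpace B] [IsTopologicalRing B] [ContinuousSMul ℝ B]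
  [Ring R] [Algebra ℝ R] [TopologicalSpace R] [IsTopologicalRing R] [ContinuousSMul ℝ R]
  [Ring S] [Algebra ℝ S] [TopologicalSpace S] [IsTopologicalRing S] [ContinuousSMul ℝ S]
  [Ring A'] [Algebra ℝ A'] [TopologicalSpace A'] [IsTopologicalRing A'] [ContinuousSMul ℝ A']
  [Ring B'] [Algebra ℝ B'] [TopologicalSpace B'] [IsTopologicalRing B'] [ContinuousSMul ℝ B']
  [Ring R'] [Algebra ℝ R'] [TopologicalSpace R'] [IsTopologicalRing R'] [ContinuousSMul ℝ R']
  [Ring S'] [Algebra ℝ S'] [TopologicalSpace S'] [IsTopologicalRing S'] [ContinuousSMul ℝ S']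
  {𝒜 : ZMod 2 → Submodule ℝ A} {ℬ : ZMod 2 → Submodule ℝ B}
  {ℛ : ZMod 2 → Submodule ℝ R} {𝒮 : ZMod 2 → Submodule ℝ S}
  {𝒜' : ZMod 2 → Submodule ℝ A'} {ℬ' : ZMod 2 → Submodule ℝ B'}
  {ℛ' : ZMod 2 → Submodule ℝ R'} {𝒮' : ZMod 2 → Submodule ℝ S'}
  [GradedAlgebra 𝒜] [GradedAlgebra ℬ] [GradedAlgebra ℛ] [GradedAlgebra 𝒮]
  [GradedAlgebra 𝒜'] [GradedAlgebra ℬ'] [GradedAlgebra ℛ'] [GradedAlgebra 𝒮']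

/-- Graded homomorphisms respect parity projections, hence the formula that defines `untwist`. -/
theorem GradedAntiEquiv.map_untwist (o : GradedAntiEquiv 𝒜 ℬ) (o' : GradedAntiEquiv 𝒜' ℬ')
    (φ : GradedHom 𝒜 𝒜') (ψ : GradedHom ℬ ℬ')
    (ho : ∀ a, ψ.toAlgHom (o.toLinearEquiv a) = o'.toLinearEquiv (φ.toAlgHom a))
    (F : R →ₐ[ℝ] R') (f : A →ₐ[ℝ] R) (f' : A' →ₐ[ℝ] R') (hf : ∀ a, F (f a) = f' (φ.toAlgHom a))
    (c : R) (b : B) :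
    F (o.untwist f c b) = o'.untwist f' (F c) (ψ.toAlgHom b) := by
  obtain ⟨a, rfl⟩ := o.toLinearEquiv.surjective b
  rw [ho, untwist_apply, untwist_apply, map_add, map_mul, hf, hf, φ.map_evenPart, φ.map_oddPart]

/-- A homomorphism of Clifford extensions that extends a homomorphism of the algebras. -/
structure CliffordExt.Compatible {κ : Type} {sgn : κ → ℝ} (E : CliffordExt 𝒜 sgn ℛ)
    (E' : CliffordExt 𝒜' sgn ℛ') (φ : GradedHom 𝒜 𝒜') (F : GradedHom ℛ ℛ') : Prop where
  map_incl : ∀ a, F.toAlgHom (E.incl a) = E'.incl (φ.toAlgHom a)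
  map_gen : ∀ i, F.toAlgHom (E.gen i) = E'.gen i

variable {φ : GradedHom 𝒜 𝒜'} {ψ : GradedHom ℬ ℬ'} {F : GradedHom ℛ ℛ'} {G : GradedHom 𝒮 𝒮'}
  [IsModuleTopology ℝ R'] [IsModuleTopology ℝ S']

/-- The corners on the two sides are given by the same formulas in the generators, and compatible
homomorphisms preserve generators. So `p`, `u` and the inclusions correspond, and naturality of the
duality applies. -/
theorem CliffordExt.nonempty_ker_equiv_of_two {J : Type}
    (E : CliffordExt 𝒜 (fun _ : Fin 2 ⊕ J => 1) ℛ) (D : CliffordExt ℬ (fun _ : J => -1) 𝒮)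
    (o : GradedAntiEquiv 𝒜 ℬ) (hA : Continuous (gradeInv 𝒜)) (hB : Continuous (gradeInv ℬ))
    (hR : Continuous (gradeInv ℛ)) (hS : Continuous (gradeInv 𝒮))
    (E' : CliffordExt 𝒜' (fun _ : Fin 2 ⊕ J => 1) ℛ') (D' : CliffordExt ℬ' (fun _ : J => -1) 𝒮')
    (o' : GradedAntiEquiv 𝒜' ℬ') (hA' : Continuous (gradeInv 𝒜'))
    (hB' : Continuous (gradeInv ℬ')) (hS' : Continuous (gradeInv 𝒮'))
    (ho : ∀ a, ψ.toAlgHom (o.toLinearEquiv a) = o'.toLinearEquiv (φ.toAlgHom a))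
    (hE : E.Compatible E' φ F) (hD : D.Compatible D' ψ G) {s s' : ℤˣ} (hs : s' = -s)
    (hs' : s = -s') :
    Nonempty ((KGroup.map.{w, w, v} s F).ker ≃+ (KGroup.map.{w, w, v} s' G).ker) := by
  obtain ⟨c, K, hK, hp, hu, hi⟩ := E.exists_corner_of_two D o hA hB hS
  obtain ⟨c', K', hK', hp', hu', hi'⟩ := E'.exists_corner_of_two D' o' hA' hB' hS'
  have h1 : F.toAlgHom c.p = c'.p := by
    rw [hp, hp', map_smul, map_add, map_one, hE.map_gen]
  have h2 : F.toAlgHom c.u = c'.u := by rw [hu, hu', hE.map_gen]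
  refine Corner.nonempty_ker_equiv c c' F G h1 h2 (fun s => ?_) hR hS hs hs'
  rw [hi, hi', map_mul, h1]
  congr 1
  refine hK.comp_eq hK' F.toAlgHom G.toAlgHom ψ.toAlgHom hD.map_incl hD.map_gen (fun b => ?_)
    (fun j => ?_) s
  · rw [← hE.map_gen]
    exact o.map_untwist o' φ ψ ho F.toAlgHom E.incl E'.incl hE.map_incl _ b
  · rw [map_mul, hE.map_gen, hE.map_gen]

theorem CliffordExt.nonempty_ker_equiv_of_one
    (E : CliffordExt 𝒜 (fun _ : Unit => 1) ℛ) (D : CliffordExt ℬ (fun _ : Unit => 1) 𝒮)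
    (o : GradedAntiEquiv 𝒜 ℬ) (hA : Continuous (gradeInv 𝒜)) (hB : Continuous (gradeInv ℬ))
    (hR : Continuous (gradeInv ℛ)) (hS : Continuous (gradeInv 𝒮))
    (E' : CliffordExt 𝒜' (fun _ : Unit => 1) ℛ') (D' : CliffordExt ℬ' (fun _ : Unit => 1) 𝒮')
    (o' : GradedAntiEquiv 𝒜' ℬ') (hA' : Continuous (gradeInv 𝒜'))
    (hB' : Continuous (gradeInv ℬ'))
    (ho : ∀ a, ψ.toAlgHom (o.toLinearEquiv a) = o'.toLinearEquiv (φ.toAlgHom a))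
    (hE : E.Compatible E' φ F) (hD : D.Compatible D' ψ G) {s s' : ℤˣ} (hs : s' = -s)
    (hs' : s = -s') :
    Nonempty ((KGroup.map.{w, w, v} s F).ker ≃+ (KGroup.map.{w, w, v} s' G).ker) := by
  obtain ⟨c, K, hK, hp, hu, hi⟩ := E.exists_corner_of_one D o hA hB
  obtain ⟨c', K', hK', hp', hu', hi'⟩ := E'.exists_corner_of_one D' o' hA' hB'
  have h1 : F.toAlgHom c.p = c'.p := by rw [hp, hp', map_one]
  have h2 : F.toAlgHom c.u = c'.u := by rw [hu, hu', hE.map_gen]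
  refine Corner.nonempty_ker_equiv c c' F G h1 h2 (fun s => ?_) hR hS hs hs'
  rw [hi, hi', map_mul, h1]
  congr 1
  refine hK.comp_eq hK' F.toAlgHom G.toAlgHom ψ.toAlgHom hD.map_incl hD.map_gen (fun b => ?_)
    (fun j => hE.map_gen _) s
  rw [← hE.map_gen]
  exact o.map_untwist o' φ ψ ho F.toAlgHom E.incl E'.incl hE.map_incl _ b

end Main

/-! ### Compatibility of the Clifford extensions with tensor products of homomorphisms -/

section Instances

variable {A : Type u} [Ring A] [Algebra ℝ A] [TopologicalSpace A] (𝒜 : ZMod 2 → Submodule ℝ A)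
  [GradedAlgebra 𝒜] {A' : Type v} [Ring A'] [Algebra ℝ A'] [TopologicalSpace A']
  (𝒜' : ZMod 2 → Submodule ℝ A') [GradedAlgebra 𝒜'] {p q : ℕ} {κ : Type} {sgn : κ → ℝ}
  (e : κ ≃ Fin p ⊕ Fin q) (h : ∀ i, clSign p q (e i) = sgn i)

theorem CliffordExt.compatible_tensorRight (φ : GradedHom 𝒜 𝒜') :
    ((tensorRight 𝒜 p q).reindex e h).Compatible ((tensorRight 𝒜' p q).reindex e h) φ
      (φ.tensor (GradedHom.refl (clGrading p q))) where
  map_incl a := (GradedHom.tensorAlgHom_tmul φ (GradedHom.refl (clGrading p q)) a 1)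
  map_gen _ := (GradedHom.tensorAlgHom_tmul φ (GradedHom.refl (clGrading p q)) 1 _).trans
    (congrArg (fun x => GradedTensorProduct.tmul ℝ x _) (map_one φ.toAlgHom))

theorem CliffordExt.compatible_tensorLeft (φ : GradedHom 𝒜 𝒜') :
    ((tensorLeft 𝒜 p q).reindex e h).Compatible ((tensorLeft 𝒜' p q).reindex e h) φ
      ((GradedHom.refl (clGrading p q)).tensor φ) where
  map_incl a := (GradedHom.tensorAlgHom_tmul (GradedHom.refl (clGrading p q)) φ 1 a)
  map_gen _ := (GradedHom.tensorAlgHom_tmul (GradedHom.refl (clGrading p q)) φ _ 1).trans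
    (congrArg (fun x => GradedTensorProduct.tmul ℝ _ x) (map_one φ.toAlgHom))

theorem CliffordExt.compatible_refl [IsEmpty κ] (φ : GradedHom 𝒜 𝒜') :
    (CliffordExt.refl (𝒜 := 𝒜) (sgn := sgn)).Compatible CliffordExt.refl φ φ where
  map_incl _ := rfl
  map_gen i := isEmptyElim i

theorem clSign_eq_one {p q : ℕ} (hq : q = 0) (i : Fin p ⊕ Fin q) : clSign p q i = 1 := by
  subst hq
  rcases i with i | i
  · rfl
  · exact i.elim0

theorem clSign_eq_neg_one {p q : ℕ} (hp : p = 0) (i : Fin p ⊕ Fin q) : clSign p q i = -1 := by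
  subst hp
  rcases i with i | i
  · exact i.elim0
  · rfl

end Instances


/-! ### The cases `n = 0`, `n = 1` and `n ≥ 2` -/

section Classification

variable {A B : Type u} [Ring A] [Algebra ℝ A] [TopologicalSpace A] [IsTopologicalRing A]
  [ContinuousSMul ℝ A] [Ring B] [Algebra ℝ B] [TopologicalSpace B] [IsTopologicalRing B]
  [ContinuousSMul ℝ B] {𝒜 : ZMod 2 → Submodule ℝ A} {ℬ : ZMod 2 → Submodule ℝ B}
  [GradedAlgebra 𝒜] [GradedAlgebra ℬ]

theorem continuous_gradeInv_tensor_cl (hA : Continuous (gradeInv 𝒜)) (p q : ℕ) :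
    Continuous (gradeInv (tensorGrading 𝒜 (clGrading p q))) :=
  continuous_gradeInv_tensor _ _ hA (continuous_gradeInv _)

theorem continuous_gradeInv_cl_tensor (hA : Continuous (gradeInv 𝒜)) (p q : ℕ) :
    Continuous (gradeInv (tensorGrading (clGrading p q) 𝒜)) :=
  continuous_gradeInv_tensor _ _ (continuous_gradeInv _) hA

/-- The corner construction is used with the two algebras exchanged: `Cl_2 ⊗ ℬ` has the two
generators `u`, `e` and no others, and its corner is the opposite of `𝒜` itself. The resulting
isomorphism runs from gradings to polarizations and has to be inverted. -/
theorem nonempty_SPT_equiv_K_two (o : GradedAntiEquiv 𝒜 ℬ) (hA : Continuous (gradeInv 𝒜))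
    (hB : Continuous (gradeInv ℬ)) : Nonempty (SPT 𝒜 ≃+ K ℬ 2) := by
  have := isTopologicalRing_tensor_left (clIntGrading 2) ℬ hB
  obtain ⟨e⟩ : Nonempty (Fin 2 ⊕ Empty ≃ Fin (2 : ℤ).toNat ⊕ Fin (-2 : ℤ).toNat) :=
    ⟨Fintype.equivOfCardEq (by simp)⟩
  have hR := continuous_gradeInv_cl_tensor hB (2 : ℤ).toNat (-2 : ℤ).toNat
  obtain ⟨c, -⟩ := ((CliffordExt.tensorLeft ℬ _ _).reindex e
    (fun i => clSign_eq_one (by simp) (e i))).exists_corner_of_two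
    (CliffordExt.refl (𝒜 := 𝒜)) o.symm hB hA hA
  exact ⟨(Corner.equiv.{u, u} c hR hA (s := 1) (s' := -1) rfl (neg_neg 1).symm).symm⟩

/-- The generators that form the corner must sit on one side. For `n ≥ 2` they lie in `𝒜 ⊗ Cl_n` and
the other side keeps `n - 2` generators of square `-1`; for `n = 1` each side has one generator of
square `1`; for `n = 0` both extra generators lie in `Cl_2 ⊗ ℬ`, and the duality is read backwards.
Any bijection of generators may be used to match index sets, as their squares agree. -/
theorem nonempty_SPTCl_equiv_K (o : GradedAntiEquiv 𝒜 ℬ) (hA : Continuous (gradeInv 𝒜))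
    (hB : Continuous (gradeInv ℬ)) (n : ℕ) : Nonempty (SPTCl 𝒜 n ≃+ K ℬ (2 - n)) := by
  have := isTopologicalRing_tensor_right 𝒜 (clGrading n 0) hA
  have := isTopologicalRing_tensor_left (clIntGrading (2 - n)) ℬ hB
  have hR := continuous_gradeInv_tensor_cl hA n 0
  have hS := continuous_gradeInv_cl_tensor hB (2 - n : ℤ).toNat (-(2 - n) : ℤ).toNat
  obtain rfl | rfl | ⟨m, rfl⟩ : n = 0 ∨ n = 1 ∨ ∃ m, n = 2 + m := by
    rcases n with _ | _ | m
    exacts [.inl rfl, .inr (.inl rfl), .inr (.inr ⟨m, by ring⟩)]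
  · obtain ⟨e⟩ : Nonempty (Fin 2 ⊕ Fin 0 ≃
        Fin (2 - (0 : ℕ) : ℤ).toNat ⊕ Fin (-(2 - (0 : ℕ)) : ℤ).toNat) :=
      ⟨Fintype.equivOfCardEq (by simp)⟩
    obtain ⟨e'⟩ : Nonempty (Fin 0 ≃ Fin 0 ⊕ Fin 0) := ⟨Fintype.equivOfCardEq (by simp)⟩
    obtain ⟨c, -⟩ := ((CliffordExt.tensorLeft ℬ _ _).reindex e
      (fun i => clSign_eq_one (by simp) (e i))).exists_corner_of_two
      ((CliffordExt.tensorRight 𝒜 _ _).reindex e' (fun i => i.elim0)) o.symm hB hA hR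
    exact ⟨(Corner.equiv.{u, u} c hS hR (s := 1) (s' := -1) rfl (neg_neg 1).symm).symm⟩
  · obtain ⟨e⟩ : Nonempty (Unit ≃ Fin 1 ⊕ Fin 0) := ⟨Fintype.equivOfCardEq (by simp)⟩
    obtain ⟨e'⟩ : Nonempty (Unit ≃
        Fin (2 - (1 : ℕ) : ℤ).toNat ⊕ Fin (-(2 - (1 : ℕ)) : ℤ).toNat) :=
      ⟨Fintype.equivOfCardEq (by simp)⟩
    obtain ⟨c, -⟩ := ((CliffordExt.tensorRight 𝒜 _ _).reindex e
      (fun i => clSign_eq_one rfl (e i))).exists_corner_of_one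
      ((CliffordExt.tensorLeft ℬ _ _).reindex e' (fun i => clSign_eq_one (by simp) (e' i))) o hA hB
    exact ⟨Corner.equiv.{u, u} c hR hS (neg_neg 1).symm rfl⟩
  · obtain ⟨e⟩ : Nonempty (Fin 2 ⊕ Fin m ≃ Fin (2 + m) ⊕ Fin 0) :=
      ⟨Fintype.equivOfCardEq (by simp)⟩
    obtain ⟨e'⟩ : Nonempty (Fin m ≃
        Fin (2 - (2 + m : ℕ) : ℤ).toNat ⊕ Fin (-(2 - (2 + m : ℕ)) : ℤ).toNat) :=
      ⟨Fintype.equivOfCardEq (by simp)⟩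
    obtain ⟨c, -⟩ := ((CliffordExt.tensorRight 𝒜 _ _).reindex e
      (fun i => clSign_eq_one rfl (e i))).exists_corner_of_two
      ((CliffordExt.tensorLeft ℬ _ _).reindex e' (fun i => clSign_eq_neg_one (by simp) (e' i)))
      o hA hB hS
    exact ⟨Corner.equiv.{u, u} c hR hS (neg_neg 1).symm rfl⟩

variable {A' B' : Type v} [Ring A'] [Algebra ℝ A'] [TopologicalSpace A'] [IsTopologicalRing A']
  [ContinuousSMul ℝ A'] [Ring B'] [Algebra ℝ B'] [TopologicalSpace B'] [IsTopologicalRing B']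
  [ContinuousSMul ℝ B'] {𝒜' : ZMod 2 → Submodule ℝ A'} {ℬ' : ZMod 2 → Submodule ℝ B'}
  [GradedAlgebra 𝒜'] [GradedAlgebra ℬ'] [IsModuleTopology ℝ A'] [IsModuleTopology ℝ B']
  [Module.Finite ℝ A'] [Module.Finite ℝ B'] {φ : GradedHom 𝒜 𝒜'} {ψ : GradedHom ℬ ℬ'}

theorem nonempty_ker_equiv_K_two (o : GradedAntiEquiv 𝒜 ℬ) (o' : GradedAntiEquiv 𝒜' ℬ')
    (ho : ∀ a, ψ.toAlgHom (o.toLinearEquiv a) = o'.toLinearEquiv (φ.toAlgHom a))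
    (hA : Continuous (gradeInv 𝒜)) (hB : Continuous (gradeInv ℬ)) :
    Nonempty ((KGroup.map.{u, u, v} (-1) φ).ker ≃+
      (KGroup.map.{u, u, v} 1 ((GradedHom.refl (clIntGrading 2)).tensor ψ)).ker) := by
  have hA' : Continuous (gradeInv 𝒜') := continuous_gradeInv _
  have hB' : Continuous (gradeInv ℬ') := continuous_gradeInv _
  have := isTopologicalRing_tensor_left (clIntGrading 2) ℬ hB
  have := isTopologicalRing_tensor_left (clIntGrading 2) ℬ' hB'
  obtain ⟨e⟩ : Nonempty (Fin 2 ⊕ Empty ≃ Fin (2 : ℤ).toNat ⊕ Fin (-2 : ℤ).toNat) :=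
    ⟨Fintype.equivOfCardEq (by simp)⟩
  have hR := continuous_gradeInv_cl_tensor hB (2 : ℤ).toNat (-2 : ℤ).toNat
  have ho' : ∀ b, φ.toAlgHom (o.symm.toLinearEquiv b) = o'.symm.toLinearEquiv (ψ.toAlgHom b) :=
    fun b => by
      obtain ⟨a, rfl⟩ := o.toLinearEquiv.surjective b
      rw [o.symm_apply_apply, ho, o'.symm_apply_apply]
  obtain ⟨c⟩ := CliffordExt.nonempty_ker_equiv_of_two (s := 1) (s' := -1)
    ((CliffordExt.tensorLeft ℬ _ _).reindex e fun i => clSign_eq_one (by simp) (e i))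
    (CliffordExt.refl (𝒜 := 𝒜)) o.symm hB hA hR hA
    ((CliffordExt.tensorLeft ℬ' _ _).reindex e fun i => clSign_eq_one (by simp) (e i))
    (CliffordExt.refl (𝒜 := 𝒜')) o'.symm hB' hA' hA' ho'
    (CliffordExt.compatible_tensorLeft ℬ ℬ' e _ ψ) (CliffordExt.compatible_refl 𝒜 𝒜' φ)
    rfl (neg_neg 1).symm
  exact ⟨c.symm⟩

/-- The same three cases, carried out simultaneously over the source and the target of the
augmentation with matching bijections of the generators. -/
theorem nonempty_ker_tensor_equiv_K (o : GradedAntiEquiv 𝒜 ℬ) (o' : GradedAntiEquiv 𝒜' ℬ')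
    (ho : ∀ a, ψ.toAlgHom (o.toLinearEquiv a) = o'.toLinearEquiv (φ.toAlgHom a))
    (hA : Continuous (gradeInv 𝒜)) (hB : Continuous (gradeInv ℬ)) (n : ℕ) :
    Nonempty ((KGroup.map.{u, u, v} (-1) (φ.tensor (GradedHom.refl (clGrading n 0)))).ker ≃+
      (KGroup.map.{u, u, v} 1 ((GradedHom.refl (clIntGrading (2 - n))).tensor ψ)).ker) := by
  have hA' : Continuous (gradeInv 𝒜') := continuous_gradeInv _
  have hB' : Continuous (gradeInv ℬ') := continuous_gradeInv _
  have := isTopologicalRing_tensor_right 𝒜 (clGrading n 0) hA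
  have := isTopologicalRing_tensor_left (clIntGrading (2 - n)) ℬ hB
  have := isTopologicalRing_tensor_right 𝒜' (clGrading n 0) hA'
  have := isTopologicalRing_tensor_left (clIntGrading (2 - n)) ℬ' hB'
  have hR := continuous_gradeInv_tensor_cl hA n 0
  have hS := continuous_gradeInv_cl_tensor hB (2 - n : ℤ).toNat (-(2 - n) : ℤ).toNat
  have hR' := continuous_gradeInv_tensor_cl hA' n 0
  have hS' := continuous_gradeInv_cl_tensor hB' (2 - n : ℤ).toNat (-(2 - n) : ℤ).toNat
  obtain rfl | rfl | ⟨m, rfl⟩ : n = 0 ∨ n = 1 ∨ ∃ m, n = 2 + m := by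
    rcases n with _ | _ | m
    exacts [.inl rfl, .inr (.inl rfl), .inr (.inr ⟨m, by ring⟩)]
  · obtain ⟨e⟩ : Nonempty (Fin 2 ⊕ Fin 0 ≃
        Fin (2 - (0 : ℕ) : ℤ).toNat ⊕ Fin (-(2 - (0 : ℕ)) : ℤ).toNat) :=
      ⟨Fintype.equivOfCardEq (by simp)⟩
    obtain ⟨e'⟩ : Nonempty (Fin 0 ≃ Fin 0 ⊕ Fin 0) := ⟨Fintype.equivOfCardEq (by simp)⟩
    have ho' : ∀ b, φ.toAlgHom (o.symm.toLinearEquiv b) = o'.symm.toLinearEquiv (ψ.toAlgHom b) :=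
      fun b => by
        obtain ⟨a, rfl⟩ := o.toLinearEquiv.surjective b
        rw [o.symm_apply_apply, ho, o'.symm_apply_apply]
    obtain ⟨c⟩ := CliffordExt.nonempty_ker_equiv_of_two (s := 1) (s' := -1)
      ((CliffordExt.tensorLeft ℬ _ _).reindex e fun i => clSign_eq_one (by simp) (e i))
      ((CliffordExt.tensorRight 𝒜 _ _).reindex e' fun i => i.elim0) o.symm hB hA hS hR
      ((CliffordExt.tensorLeft ℬ' _ _).reindex e fun i => clSign_eq_one (by simp) (e i))
      ((CliffordExt.tensorRight 𝒜' _ _).reindex e' fun i => i.elim0) o'.symm hB' hA' hR' ho'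
      (CliffordExt.compatible_tensorLeft ℬ ℬ' e _ ψ) (CliffordExt.compatible_tensorRight 𝒜 𝒜' e' _ φ)
      rfl (neg_neg 1).symm
    exact ⟨c.symm⟩
  · obtain ⟨e⟩ : Nonempty (Unit ≃ Fin 1 ⊕ Fin 0) := ⟨Fintype.equivOfCardEq (by simp)⟩
    obtain ⟨e'⟩ : Nonempty (Unit ≃
        Fin (2 - (1 : ℕ) : ℤ).toNat ⊕ Fin (-(2 - (1 : ℕ)) : ℤ).toNat) :=
      ⟨Fintype.equivOfCardEq (by simp)⟩
    exact CliffordExt.nonempty_ker_equiv_of_one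
      ((CliffordExt.tensorRight 𝒜 _ _).reindex e fun i => clSign_eq_one rfl (e i))
      ((CliffordExt.tensorLeft ℬ _ _).reindex e' fun i => clSign_eq_one (by simp) (e' i))
      o hA hB hR hS
      ((CliffordExt.tensorRight 𝒜' _ _).reindex e fun i => clSign_eq_one rfl (e i))
      ((CliffordExt.tensorLeft ℬ' _ _).reindex e' fun i => clSign_eq_one (by simp) (e' i))
      o' hA' hB' ho (CliffordExt.compatible_tensorRight 𝒜 𝒜' e _ φ)
      (CliffordExt.compatible_tensorLeft ℬ ℬ' e' _ ψ) (neg_neg 1).symm rfl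
  · obtain ⟨e⟩ : Nonempty (Fin 2 ⊕ Fin m ≃ Fin (2 + m) ⊕ Fin 0) :=
      ⟨Fintype.equivOfCardEq (by simp)⟩
    obtain ⟨e'⟩ : Nonempty (Fin m ≃
        Fin (2 - (2 + m : ℕ) : ℤ).toNat ⊕ Fin (-(2 - (2 + m : ℕ)) : ℤ).toNat) :=
      ⟨Fintype.equivOfCardEq (by simp)⟩
    exact CliffordExt.nonempty_ker_equiv_of_two
      ((CliffordExt.tensorRight 𝒜 _ _).reindex e fun i => clSign_eq_one rfl (e i))
      ((CliffordExt.tensorLeft ℬ _ _).reindex e' fun i => clSign_eq_neg_one (by simp) (e' i))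
      o hA hB hR hS
      ((CliffordExt.tensorRight 𝒜' _ _).reindex e fun i => clSign_eq_one rfl (e i))
      ((CliffordExt.tensorLeft ℬ' _ _).reindex e' fun i => clSign_eq_neg_one (by simp) (e' i))
      o' hA' hB' hS' ho (CliffordExt.compatible_tensorRight 𝒜 𝒜' e _ φ)
      (CliffordExt.compatible_tensorLeft ℬ ℬ' e' _ ψ) (neg_neg 1).symm rfl

end Classification

end FreeSPT

open FreeSPT in
/-- Free SPT phases protected by a graded real C*-algebra `A` are classified by the Karoubi
K-theory of the opposite algebra: `SPT^A ≅ K_2(A^op)` and `SPT^{A ⊗ Cl_{+n}} ≅ K_{2-n}(A^op)`, for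
unital algebras and, with the groups defined through the unitization, for all algebras. -/
theorem mainTheorem1 :
    (∀ (A : Type u) [NormedRing A] [NormedAlgebra ℝ A] [StarRing A]
      (𝒜 : ZMod 2 → Submodule ℝ A) [GradedAlgebra 𝒜], IsGradedRealCStarAlgebra 𝒜 →
        Nonempty (SPT 𝒜 ≃+ K (GradedOp.grading 𝒜) 2) ∧
        ∀ n : ℕ, Nonempty (SPTCl 𝒜 n ≃+ K (GradedOp.grading 𝒜) (2 - n))) ∧
    (∀ (A : Type u) [NonUnitalNormedRing A] [NormedSpace ℝ A] [IsScalarTower ℝ A A]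
      [SMulCommClass ℝ A A] [StarRing A] (𝒜 : ZMod 2 → Submodule ℝ A)
      [DirectSum.Decomposition 𝒜] [SetLike.GradedMul 𝒜], IsGradedRealCStarAlgebra 𝒜 →
        Nonempty (nonunitalSPT 𝒜 ≃+ nonunitalK (GradedOp.grading 𝒜) 2) ∧
        ∀ n : ℕ, Nonempty (nonunitalSPTCl 𝒜 n ≃+ nonunitalK (GradedOp.grading 𝒜) (2 - n))) := by
  refine ⟨fun A _ _ _ 𝒜 _ h => ?_, fun A _ _ _ _ _ 𝒜 _ _ h => ?_⟩
  · have hA := h.continuous_gradeInv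
    have := GradedOp.isTopologicalRing 𝒜 hA
    exact ⟨nonempty_SPT_equiv_K_two (GradedOp.antiEquiv 𝒜) hA hA,
      nonempty_SPTCl_equiv_K (GradedOp.antiEquiv 𝒜) hA hA⟩
  -- The unitizations are compared over `ℝ`: the identity `A_+ → (A^op)_+` respects the
  -- augmentations, and `ℝ` is its own graded opposite.
  · have hA := h.continuous_gradeInv
    have := GradedOp.continuousMul 𝒜 hA
    have : IsTopologicalRing (AddUnit A) := AddUnit.isTopologicalRing
    have : IsTopologicalRing (AddUnit (GradedOp 𝒜)) := AddUnit.isTopologicalRing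
    have hA' := AddUnit.continuous_gradeInv 𝒜 hA
    have hB' := AddUnit.continuous_gradeInv (GradedOp.grading 𝒜) hA
    exact ⟨nonempty_ker_equiv_K_two (AddUnit.antiEquiv 𝒜) realAntiEquiv
        (AddUnit.augmentation_antiEquiv 𝒜) hA' hB',
      nonempty_ker_tensor_equiv_K (AddUnit.antiEquiv 𝒜) realAntiEquiv
        (AddUnit.augmentation_antiEquiv 𝒜) hA' hB'⟩
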